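/- **Setting.** Let $F=\mathbb F_d$ be a finite field with $d$ elements, $K=F(X)^h$ the henselization of $F(X)$ for the $X$-adic valuation (the separable closure of $F(X)$ in $F((X))$), $v:K\to\Gamma:=\mathbb Z\cup\{\infty\}$ its valuation, $\varphi(a)=a^d$, and $R=K\langle t\mid t\,a^{\varphi}=a\,t\rangle$; the elements of $R$ are the $r=\sum_i t^i a_i$ with $a_i\in K$, and $r$ is *separable* if $a_0\neq 0$. For $\gamma\in\Gamma$ put $\gamma\cdot r=\min_i\{d^i\gamma+v(a_i)\}$. A *jump value* of $r\ne 0$ is a $\gamma\in\mathbb Z$ for which this minimum is attained at least twice among the $i$ with $a_i\neq0$. For separable $s=\sum_i t^ia_i$ of positive degree let $h(s)$ be the least $\gamma\in\mathbb Z$ with $\gamma\cdot s<\gamma\cdot(s-a_0)$, and $hens(s)=h(s)+v(a_0)$. For $0\le i<d$ let $\lambda_i(\gamma)=\lceil(\gamma-i)/d\rceil$ ($\gamma \in \mathbb Z$) and $\lambda_i(\infty)=\infty$. **Languages and theories.** $L$ is the language of right $R$-modules, $L(\lambda)$ adds unary function symbols $\lambda_0,\dots,\lambda_{d-1}$, $L_{\mathcal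 O}$ adds to $L$ a unary predicate $\mathcal O$, and $L_{\mathcal O}(\lambda)$ adds both. $x\in P_\gamma$ means $x.X^{-\gamma}\in\mathcal O$ for $\gamma\in\mathbb Z$, and $x=0$ for $\gamma=\infty$. * $T_\lambda$ (an $L(\lambda)$-theory): right $R$-modules such that $x=\sum_{i<d}\lambda_i(x).tX^i$ for all $x$, and $x=\sum_i x_i.tX^i$ implies $x_i=\lambda_i(x)$ for all $i$. * $T_{free}$: $T_\lambda$ and $\forall x\exists y\; x=y.s$ for all separable $s$. $T^0_{free}$: the nonzero models of $T_{free}$ that are torsion-free ($x.r=0\to x=0$ for every $r\ne0$). * $T_{hens}$ (an $L_{\mathcal O}(\lambda)$-theory): $T_\lambda$ and, for all $\gamma,\delta\in\Gamma$ unless said otherwise: 0. the $P_\gamma$ are subgroups, and $P_\delta\subsetneq P_\gamma$ whenever $\gamma<\delta$; 1. if $x\in P_\gamma$, $y\in P_\delta$ and $r\in R$, then $x.r+y\in P_{\min\{\gamma\cdot r,\delta\}}$; 2. if $r\neq0$, $\gamma\in\mathbb Z$ is not a jump value of $r$ and $x\in P_\gamma\setminus P_{\gamma+1}$, then $x.r\in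 P_{\gamma\cdot r}\setminus P_{\gamma\cdot r+1}$; 3. $x\in P_\gamma$ if and only if $\lambda_i(x)\in P_{\lambda_i(\gamma)}$ for all $i<d$; 4. for every separable $s$ of positive degree and every $x\in P_{hens(s)}\setminus\{0\}$ there is a unique $y\in P_{h(s)}$ with $y.s=x$. A *p.p. formula* is $\exists\bar y\bigwedge_i\psi_i(\bar x,\bar y)$, a finite conjunction with all $\psi_i$ atomic; a *positive quantifier-free formula* is built from atomic formulas by $\wedge$ and $\vee$. Fix a computable presentation of the field $K$, i.e. a surjection $\nu:\mathbb N\to K$ for which equality is decidable and addition and multiplication are computable. Coding a scalar $\sum_i t^ia_i$ by numbers of its coefficients gives Gödel numbers of p.p. $L_{\mathcal O}$-formulas, and "computable" means computable by a Turing machine from these Gödel numbers and the arity. **Theorem.** (1) There is an algorithm that computes, from any p.p. formula $\phi(x_1,\dots,x_m)$ of $L_{\mathcal O}$, some $\delta\in\mathbb Z$ (so $\delta\neq\infty$) with the following property. There is a positive quantifier-free $L(\lambda)$-formula $\psi(x_1,\dots,x_m)$, depending only on $\phi$ and $T_\lambda$, such that with $V=P_\delta^m$ $$T_{hens}\models \phi\wedge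 V\leftrightarrow\psi\wedge V .$$ Here "depending only on $\phi$ and $T_\lambda$" means that $\psi$ is the strongest positive quantifier-free consequence of $\phi$ modulo $T_\lambda$: $T_\lambda\models\phi\to\psi$, and $T_\lambda\models\psi\to\theta$ for every positive quantifier-free $L(\lambda)$-formula $\theta$ with $T_\lambda\models\phi\to\theta$ (where $T_\lambda$ imposes no condition on $\mathcal O$). The formula $\psi$ does not depend on the Gödel number chosen for $\phi$. (2) There is an algorithm that computes, from any two p.p. formulas $\phi,\phi_1$ of $L_{\mathcal O}$ with the same arity $m$ that are equivalent modulo $T^0_{free}$, some $\gamma\in\mathbb Z$ such that with $W=P_\gamma^m$ $$T_{hens}\models\phi\wedge W\leftrightarrow\phi_1\wedge W .$$ Here it suffices that $\phi$ and $\phi_1$ are equivalent in all models of $T^0_{free}$ in which $\mathcal O$ is interpreted as the whole module. -/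

import Mathlib

open FirstOrder

noncomputable section

namespace HenselMod

universe u

/-! ### The field `K`, the valuation and the ring `R` -/

section Field

variable (F : Type u) [Field F]

open scoped RatFunc in
/-- The henselization `K = F(X)ʰ` of the rational function field `F(X)` with respect to the
`X`-adic valuation, realized as the separable closure of `F(X)` inside its completion `F((X))`. -/
def henselization : Subfield (LaurentSeries F) :=
  (separableClosure (RatFunc F) (LaurentSeries F)).toSubfield

/-- The field `K`. -/
def K : Type u := henselization F

instance : Field (K F) := inferInstanceAs (Field (henselization F))

variable {F} in
/-- The `X`-adic valuation `v : K → ℤ ∪ {∞}`. -/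
def val (a : K F) : WithTop ℤ := HahnSeries.orderTop (a.1 : LaurentSeries F)

open scoped RatFunc in
/-- The uniformizer `X`, as an element of `K`. -/
def unif : K F :=
  ⟨algebraMap (RatFunc F) (LaurentSeries F) RatFunc.X,
    (separableClosure (RatFunc F) (LaurentSeries F)).algebraMap_mem RatFunc.X⟩

/-- `d`, the number of elements of the finite field `F = 𝔽_d`. -/
abbrev d : ℕ := Nat.card F

variable [Finite F]

theorem add_pow_card (n : ℕ) (a b : K F) :
    (a + b) ^ (d F ^ n) = a ^ (d F ^ n) + b ^ (d F ^ n) := by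
  have := Fintype.ofFinite F
  obtain ⟨p, hp⟩ := CharP.exists F
  obtain ⟨k, hpp, hk⟩ := FiniteField.card F p
  have : Fact p.Prime := ⟨hpp⟩
  have : CharP (LaurentSeries F) p :=
    charP_of_injective_ringHom (f := (HahnSeries.C : F →+* HahnSeries ℤ F)) HahnSeries.C_injective p
  apply Subtype.ext
  change ((a.1 + b.1 : LaurentSeries F)) ^ (d F ^ n)
    = (a.1 : LaurentSeries F) ^ (d F ^ n) + (b.1 : LaurentSeries F) ^ (d F ^ n)
  rw [d, Nat.card_eq_fintype_card, hk, ← pow_mul, add_pow_char_pow]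

/-- The action of `ℕ` on `K` by the powers of `φ : a ↦ a ^ d`. -/
instance : MulSemiringAction (Multiplicative ℕ) (K F) where
  smul n a := a ^ (d F ^ n.toAdd)
  one_smul a := by
    change a ^ (d F ^ 0) = a
    simp
  mul_smul m n a := by
    change a ^ (d F ^ (m.toAdd + n.toAdd)) = (a ^ (d F ^ n.toAdd)) ^ (d F ^ m.toAdd)
    rw [← pow_mul, ← pow_add, add_comm]
  smul_zero n := by
    change (0 : K F) ^ (d F ^ n.toAdd) = 0
    exact zero_pow (pow_ne_zero _ Nat.card_pos.ne')
  smul_add n a b := add_pow_card F n.toAdd a b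
  smul_one n := one_pow _
  smul_mul n a b := mul_pow a b _

/-- The ring `R = K⟨t | t a^φ = a t⟩`. In Mathlib's skew polynomials the indeterminate satisfies
`t a = a^φ t`, so `R` is the opposite ring. Its elements are the `∑ tⁱ aᵢ`. -/
abbrev R : Type u := (SkewPolynomial (K F))ᵐᵒᵖ

variable {F}

/-- The monomial `tⁱ a` of `R`. -/
def mono (i : ℕ) (a : K F) : R F := .op (SkewPolynomial.monomial i a)

/-- The coefficient `aᵢ` of `∑ tⁱ aᵢ`. -/
def coeff (r : R F) (i : ℕ) : K F := SkewPolynomial.coeff r.unop i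

/-- The set of the `i` with `aᵢ ≠ 0`. -/
def supp (r : R F) : Finset ℕ := SkewPolynomial.support r.unop

/-- The defining relation `t a^φ = a t`. -/
theorem t_mul (a : K F) :
    (mono 1 1 * mono 0 (a ^ d F) : R F) = mono 0 a * mono 1 1 := by
  have h : a ^ d F = Multiplicative.ofAdd 1 • a := by
    change _ = a ^ (d F ^ 1)
    rw [pow_one]
  simp only [mono, ← MulOpposite.op_mul, SkewPolynomial.monomial_mul_monomial, h]
  simp

theorem mono_eq (i : ℕ) (a : K F) : mono i a = mono 1 1 ^ i * mono 0 a := by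
  simp only [mono, ← MulOpposite.op_mul, ← MulOpposite.op_pow]
  rw [← SkewPolynomial.X, SkewPolynomial.monomial_zero_left,
    SkewPolynomial.C_mul_X_pow_eq_monomial]

set_option linter.unusedSectionVars false in
theorem sum_mono (r : R F) : ∑ i ∈ supp r, mono i (coeff r i) = r := by
  apply MulOpposite.unop_injective
  rw [Finset.unop_sum]
  simp only [mono, MulOpposite.unop_op, supp, coeff]
  rw [← SkewPolynomial.sum_def, SkewPolynomial.sum_monomial]

/-- `q = ∑ tⁱ aᵢ` is separable if `a₀ ≠ 0`. -/
def IsSeparable (q : R F) : Prop := coeff q 0 ≠ 0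

/-! ### The tropical action of `R` on `Γ = ℤ ∪ {∞}` -/

/-- `γ · r = min_i (dⁱ γ + v(aᵢ))` for `r = ∑ tⁱ aᵢ`. -/
def trop (γ : WithTop ℤ) (r : R F) : WithTop ℤ :=
  (supp r).inf fun i => (d F ^ i) • γ + val (coeff r i)

/-- `γ ∈ ℤ` is a jump value of `r` if the minimum `γ · r` is attained at least twice. -/
def IsJump (γ : ℤ) (r : R F) : Prop :=
  ∃ i ∈ supp r, ∃ j ∈ supp r, i ≠ j ∧
    (d F ^ i) • (γ : WithTop ℤ) + val (coeff r i) = trop γ r ∧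
    (d F ^ j) • (γ : WithTop ℤ) + val (coeff r j) = trop γ r

/-- `γ = h(s)`: the least `γ ∈ ℤ` such that `γ · s < γ · (s - a₀)`. -/
def IsH (s : R F) (γ : ℤ) : Prop :=
  IsLeast {γ : ℤ | trop γ s < trop γ (s - mono 0 (coeff s 0))} γ

/-- The action of `λ_i` on `Γ`: `v(λ_i(x)) ≥ ⌈(γ - i) / d⌉` whenever `v(x) ≥ γ`. -/
def lamTrop (i : Fin (d F)) (γ : WithTop ℤ) : WithTop ℤ :=
  γ.map fun n => ⌈((n - (i : ℕ) : ℤ) : ℚ) / (d F : ℚ)⌉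

end Field

/-! ### Languages -/

/-- The function symbols `0`, `-`, `+` and the scalars `x ↦ x.r`. -/
inductive ModFunc (S : Type u) : ℕ → Type u
  | zero : ModFunc S 0
  | neg : ModFunc S 1
  | add : ModFunc S 2
  | smul (r : S) : ModFunc S 1

/-- The function symbols `λ_i`. -/
inductive LamFunc (n : ℕ) : ℕ → Type
  | lam (i : Fin n) : LamFunc n 1

/-- The predicate symbol `𝓞`. -/
inductive BallRel : ℕ → Type
  | mem : BallRel 1

variable (F : Type u) [Field F] [Finite F]

/-- The language `L` of right `R`-modules. -/
abbrev L : FirstOrder.Language.{u, 0} := ⟨ModFunc (R F), fun _ => Empty⟩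

/-- The function symbols `λ_i`, `i < d`. -/
abbrev lamLang : FirstOrder.Language.{0, 0} := ⟨LamFunc (d F), fun _ => Empty⟩

/-- The unary predicate symbol `𝓞`. -/
abbrev ballLang : FirstOrder.Language.{0, 0} := ⟨fun _ => Empty, BallRel⟩

/-- The language `L(λ)`. -/
abbrev Llam : FirstOrder.Language.{u, 0} := (L F).sum (lamLang F)

/-- The language `L_𝓞`. -/
abbrev LO : FirstOrder.Language.{u, 0} := (L F).sum ballLang

/-- The language `L_𝓞(λ)`. -/
abbrev LOlam : FirstOrder.Language.{u, 0} := (Llam F).sum ballLang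

/-- The inclusion of `L(λ)` in `L_𝓞(λ)`. -/
abbrev ofLlam : Llam F →ᴸ LOlam F := FirstOrder.Language.LHom.sumInl

/-- The inclusion of `L_𝓞` in `L_𝓞(λ)`. -/
abbrev ofLO : LO F →ᴸ LOlam F :=
  FirstOrder.Language.LHom.sumMap FirstOrder.Language.LHom.sumInl (FirstOrder.Language.LHom.id ballLang)

section Terms

variable {F} {α : Type*} {Ω : FirstOrder.Language.{0, 0}}

/-! Terms of `L(λ)` and of `L_𝓞` (both are of the form `L.sum Ω`). -/

/-- `0` -/
def tZero : ((L F).sum Ω).Term α := .func (l := 0) (Sum.inl ModFunc.zero) ![]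

/-- `- x` -/
def tNeg (x : ((L F).sum Ω).Term α) : ((L F).sum Ω).Term α :=
  .func (l := 1) (Sum.inl ModFunc.neg) ![x]

/-- `x + y` -/
def tAdd (x y : ((L F).sum Ω).Term α) : ((L F).sum Ω).Term α :=
  .func (l := 2) (Sum.inl ModFunc.add) ![x, y]

/-- `x.r` -/
def tSmul (x : ((L F).sum Ω).Term α) (r : R F) : ((L F).sum Ω).Term α :=
  .func (l := 1) (Sum.inl (ModFunc.smul r)) ![x]

/-- `λ_i(x)` -/
def tLam (i : Fin (d F)) (x : (Llam F).Term α) : (Llam F).Term α :=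
  .func (l := 1) (Sum.inr (LamFunc.lam i)) ![x]

/-- `∑_{i < d} x_i . t X^i` -/
def tDecomp (x : Fin (d F) → (Llam F).Term α) : (Llam F).Term α :=
  (List.ofFn fun i => tSmul (x i) (mono 1 (unif F ^ (i : ℕ)))).foldr tAdd tZero

end Terms

/-! ### Theories -/

section Theories

/-- The axioms of the `L(λ)`-theory `T_λ` of `t`-decomposable right `R`-modules. -/
inductive TLamAx : (Llam F).Sentence → Prop
  | add_assoc : TLamAx (∀' ∀' ∀' (tAdd (tAdd (&0) (&1)) (&2) =' tAdd (&0) (tAdd (&1) (&2))))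
  | add_comm : TLamAx (∀' ∀' (tAdd (&0) (&1) =' tAdd (&1) (&0)))
  | add_zero : TLamAx (∀' (tAdd (&0) tZero =' &0))
  | add_neg : TLamAx (∀' (tAdd (&0) (tNeg (&0)) =' tZero))
  | add_smul (r : R F) :
      TLamAx (∀' ∀' (tSmul (tAdd (&0) (&1)) r =' tAdd (tSmul (&0) r) (tSmul (&1) r)))
  | smul_add (r s : R F) :
      TLamAx (∀' (tSmul (&0) (r + s) =' tAdd (tSmul (&0) r) (tSmul (&0) s)))
  | smul_mul (r s : R F) : TLamAx (∀' (tSmul (&0) (r * s) =' tSmul (tSmul (&0) r) s))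
  | smul_one : TLamAx (∀' (tSmul (&0) 1 =' &0))
  | decomp : TLamAx (∀' (&0 =' tDecomp fun i => tLam i (&0)))
  | decomp_unique (i : Fin (d F)) :
      TLamAx (FirstOrder.Language.BoundedFormula.alls (n := d F + 1)
        ((&(Fin.last (d F)) =' tDecomp fun j => &j.castSucc) ⟹
          (&i.castSucc =' tLam i (&(Fin.last (d F))))))

/-- The theory `T_λ`. -/
def Tlam : (Llam F).Theory := {σ | TLamAx F σ}

/-- The axioms of `T_free`: those of `T_λ`, and `∀ x ∃ y, x = y.s` for all separable `s`. -/
inductive TFreeAx : (Llam F).Sentence → Prop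
  | lam {σ : (Llam F).Sentence} (h : σ ∈ Tlam F) : TFreeAx σ
  | divisible (s : R F) (h : IsSeparable s) : TFreeAx (∀' ∃' (&0 =' tSmul (&1) s))

/-- The theory `T_free`. -/
def Tfree : (Llam F).Theory := {σ | TFreeAx F σ}

/-- The axioms of `T⁰_free`: nonzero torsion-free models of `T_free`. -/
inductive TFreeZeroAx : (Llam F).Sentence → Prop
  | free {σ : (Llam F).Sentence} (h : σ ∈ Tfree F) : TFreeZeroAx σ
  | torsionFree (r : R F) (h : r ≠ 0) : TFreeZeroAx (∀' ((tSmul (&0) r =' tZero) ⟹ (&0 =' tZero)))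
  | nonzero : TFreeZeroAx (∃' ∼(&0 =' tZero))

/-- The theory `T⁰_free`. -/
def TfreeZero : (Llam F).Theory := {σ | TFreeZeroAx F σ}

variable {F} {α : Type} {n : ℕ}

/-- The atomic formula `x ∈ 𝓞`. -/
def fO (x : (Llam F).Term (α ⊕ Fin n)) : (LOlam F).BoundedFormula α n :=
  .rel (l := 1) (Sum.inr BallRel.mem) ![(ofLlam F).onTerm x]

/-- The equation `x = y`, as an `L_𝓞(λ)`-formula. -/
def fEq (x y : (Llam F).Term (α ⊕ Fin n)) : (LOlam F).BoundedFormula α n :=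
  (ofLlam F).onTerm x =' (ofLlam F).onTerm y

/-- `x ∈ P_γ`: this is `x.X^(-γ) ∈ 𝓞` for `γ ∈ ℤ`, and `x = 0` for `γ = ∞`. -/
def fP : WithTop ℤ → (Llam F).Term (α ⊕ Fin n) → (LOlam F).BoundedFormula α n
  | ⊤, x => fEq x tZero
  | (γ : ℤ), x => fO (tSmul x (mono 0 (unif F ^ (-γ))))

variable (F)

/-- The axioms of the theory `T_hens` of henselian filtered modules. -/
inductive THensAx : (LOlam F).Sentence → Prop
  | lam {σ : (Llam F).Sentence} (h : σ ∈ Tlam F) : THensAx ((ofLlam F).onSentence σ)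
  /- the `P_γ` are subgroups and form a strictly decreasing chain -/
  | ball_zero (γ : WithTop ℤ) : THensAx (fP γ tZero)
  | ball_sub (γ : WithTop ℤ) :
      THensAx (∀' ∀' ((fP γ (&0) ⊓ fP γ (&1)) ⟹ fP γ (tAdd (&0) (tNeg (&1)))))
  | ball_le (γ δ : WithTop ℤ) (h : γ < δ) : THensAx (∀' (fP δ (&0) ⟹ fP γ (&0)))
  | ball_ne (γ δ : WithTop ℤ) (h : γ < δ) : THensAx (∃' (fP γ (&0) ⊓ ∼(fP δ (&0))))
  | ultrametric (γ δ : WithTop ℤ) (r : R F) :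
      THensAx (∀' ∀' ((fP γ (&0) ⊓ fP δ (&1)) ⟹ fP (min (trop γ r) δ) (tAdd (tSmul (&0) r) (&1))))
  /- `v(x.r) = v(x) · r` if `v(x) ∈ ℤ` is not a jump value of `r` -/
  | regular (γ : ℤ) (r : R F) (hr : r ≠ 0) (h : ¬ IsJump γ r) :
      THensAx (∀' ((fP γ (&0) ⊓ ∼(fP (γ + 1 : ℤ) (&0))) ⟹
        (fP (trop γ r) (tSmul (&0) r) ⊓ ∼(fP (trop γ r + 1) (tSmul (&0) r)))))
  | lam_regular (γ : WithTop ℤ) :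
      THensAx (∀' (fP γ (&0) ⇔
        FirstOrder.Language.BoundedFormula.iInf fun i : Fin (d F) => fP (lamTrop i γ) (tLam i (&0))))
  /- every nonzero `x ∈ P_{hens(s)}` has exactly one `y ∈ P_{h(s)}` with `y.s = x`,
  where `hens(s) = h(s) + v(a₀)` -/
  | hensel (s : R F) (hs : IsSeparable s) (h : ℤ) (hh : IsH s h) :
      THensAx (∀' ((fP (h + val (coeff s 0)) (&0) ⊓ ∼(fEq (&0) tZero)) ⟹
        ∃' ((fP h (&1) ⊓ fEq (tSmul (&1) s) (&0)) ⊓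
          ∀' ((fP h (&2) ⊓ fEq (tSmul (&2) s) (&0)) ⟹ fEq (&2) (&1)))))

/-- The theory `T_hens`. -/
def Thens : (LOlam F).Theory := {σ | THensAx F σ}

/-- `T⁰_free` as an `L_𝓞(λ)`-theory, with `𝓞` interpreted as the whole module. -/
def TfreeZeroTotal : (LOlam F).Theory :=
  (ofLlam F).onTheory (TfreeZero F) ∪ {∀' (fO (&0))}

variable {F}

/-- The formula `x̄ ∈ P_γ^m`. -/
def ballPow (m : ℕ) (γ : ℤ) : (LOlam F).Formula (Fin m) :=
  FirstOrder.Language.BoundedFormula.iInf fun i : Fin m => fP (n := 0) γ (.var (Sum.inl i))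

end Theories

/-! ### Positive primitive and positive quantifier-free formulas -/

/-- Positive primitive formulas `∃ ȳ, ⋀_i ψ_i(x̄, ȳ)` with `ψ_i` atomic. -/
def IsPP {Λ : FirstOrder.Language} {α : Type*} (φ : Λ.Formula α) : Prop :=
  ∃ (k : ℕ) (l : List (Λ.BoundedFormula α k)), (∀ θ ∈ l, θ.IsAtomic) ∧
    φ = (l.foldr (· ⊓ ·) ⊤).exs

/-- Positive quantifier-free formulas. -/
inductive IsPosQF {Λ : FirstOrder.Language} {α : Type*} : Λ.Formula α → Prop
  | atomic {φ : Λ.Formula α} (h : FirstOrder.Language.BoundedFormula.IsAtomic φ) : IsPosQF φ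
  | inf {φ ψ : Λ.Formula α} (h₁ : IsPosQF φ) (h₂ : IsPosQF ψ) : IsPosQF (φ ⊓ ψ)
  | sup {φ ψ : Λ.Formula α} (h₁ : IsPosQF φ) (h₂ : IsPosQF ψ) : IsPosQF (φ ⊔ ψ)

/-! ### Computability -/

variable {F}

/-- A computable presentation of the field `K`: a numbering of its elements by natural numbers
with decidable equality and computable addition and multiplication. -/
structure IsComputablePresentation (ν : ℕ → K F) : Prop where
  surj : Function.Surjective ν
  eq : ComputablePred fun a : ℕ × ℕ => ν a.1 = ν a.2
  add : ∃ f : ℕ × ℕ → ℕ, Computable f ∧ ∀ a b, ν (f (a, b)) = ν a + ν b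
  mul : ∃ f : ℕ × ℕ → ℕ, Computable f ∧ ∀ a b, ν (f (a, b)) = ν a * ν b

/-- `c` codes the scalar `r = ∑ tⁱ aᵢ`: it is the code of a list of numbers of `a₀, …, a_n`,
where `a_i = 0` for `i > n`. -/
def CodesScalar (ν : ℕ → K F) (c : ℕ) (r : R F) : Prop :=
  ∃ l : List ℕ, c = Encodable.encode l ∧ ∀ i, coeff r i = (l.map ν).getD i 0

/-- Gödel numbers of `L_𝓞`-terms, given a numbering of the variables. -/
inductive CodesTerm (ν : ℕ → K F) {α : Type} (e : α → ℕ) : ℕ → (LO F).Term α → Prop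
  | var (a : α) : CodesTerm ν e (Nat.pair 0 (e a)) (.var a)
  | zero : CodesTerm ν e (Nat.pair 1 0) tZero
  | neg {c : ℕ} {x : (LO F).Term α} (h : CodesTerm ν e c x) :
      CodesTerm ν e (Nat.pair 2 c) (tNeg x)
  | add {c c' : ℕ} {x y : (LO F).Term α} (h : CodesTerm ν e c x) (h' : CodesTerm ν e c' y) :
      CodesTerm ν e (Nat.pair 3 (Nat.pair c c')) (tAdd x y)
  | smul {c s : ℕ} {x : (LO F).Term α} {r : R F} (h : CodesTerm ν e c x)
      (h' : CodesScalar ν s r) : CodesTerm ν e (Nat.pair 4 (Nat.pair s c)) (tSmul x r)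

/-- The numbering of the variables `x_i` and `y_j`. -/
def varCode {m k : ℕ} : Fin m ⊕ Fin k → ℕ
  | .inl i => 2 * i
  | .inr j => 2 * j + 1

/-- Gödel numbers of atomic `L_𝓞`-formulas. -/
inductive CodesAtomic (ν : ℕ → K F) {m k : ℕ} : ℕ → (LO F).BoundedFormula (Fin m) k → Prop
  | equal {c c' : ℕ} {x y : (LO F).Term (Fin m ⊕ Fin k)} (h : CodesTerm ν varCode c x)
      (h' : CodesTerm ν varCode c' y) :
      CodesAtomic ν (Nat.pair 0 (Nat.pair c c')) (.equal x y)
  | mem {c : ℕ} {x : (LO F).Term (Fin m ⊕ Fin k)} (h : CodesTerm ν varCode c x) :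
      CodesAtomic ν (Nat.pair 1 c) (.rel (l := 1) (Sum.inr BallRel.mem) ![x])

/-- `c` is a Gödel number of the p.p. formula `φ = ∃ y₁ … y_k, ⋀_i ψ_i`: it codes `k` and a list
of Gödel numbers of the `ψ_i`. -/
def CodesPP (ν : ℕ → K F) {m : ℕ} (c : ℕ) (φ : (LO F).Formula (Fin m)) : Prop :=
  ∃ (k : ℕ) (l : List ((LO F).BoundedFormula (Fin m) k)) (cs : List ℕ),
    List.Forall₂ (CodesAtomic ν) cs l ∧ c = Nat.pair k (Encodable.encode cs) ∧
      φ = (l.foldr (· ⊓ ·) ⊤).exs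

set_option linter.unusedSectionVars false in
theorem exists_codesScalar (ν : ℕ → K F) (h : Function.Surjective ν) (r : R F) : ∃ c, CodesScalar ν c r := by
  choose g hg using h
  obtain ⟨N, hN⟩ : ∃ N, ∀ i, N ≤ i → coeff r i = 0 := by
    refine ⟨(supp r).sup id + 1, fun i hi => ?_⟩
    by_contra hc
    have : i ∈ supp r := by simpa [supp, coeff] using hc
    have := Finset.le_sup (f := id) this
    simp at this; omega
  refine ⟨_, (List.range N).map (fun i => g (coeff r i)), rfl, fun i => ?_⟩
  by_cases hi : i < N
  · simp [List.getD, hi, hg]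
  · simp [List.getD, hi, hN i (by omega)]

theorem exists_codesTerm (ν : ℕ → K F) (h : Function.Surjective ν) {α : Type} (e : α → ℕ) (t : (LO F).Term α) : ∃ c, CodesTerm ν e c t := by
  induction t with
  | var a => exact ⟨_, .var a⟩
  | @func l f ts ih =>
    match l, f with
    | _, Sum.inl .zero => rw [show ts = ![] from Subsingleton.elim _ _]; exact ⟨_, .zero⟩
    | _, Sum.inl .neg => rw [show ts = ![ts 0] from by ext i; fin_cases i; rfl]; exact ⟨_, .neg (ih 0).choose_spec⟩
    | _, Sum.inl .add => rw [show ts = ![ts 0, ts 1] from by ext i; fin_cases i <;> rfl]; exact ⟨_, .add (ih 0).choose_spec (ih 1).choose_spec⟩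
    | _, Sum.inl (.smul r) =>
      rw [show ts = ![ts 0] from by ext i; fin_cases i; rfl]; exact ⟨_, .smul (ih 0).choose_spec (exists_codesScalar ν h r).choose_spec⟩

/-- Every p.p. formula has a Gödel number. -/
theorem exists_codesPP (ν : ℕ → K F) (h : Function.Surjective ν) {m} (φ : (LO F).Formula (Fin m)) (hφ : IsPP φ) : ∃ c, CodesPP ν c φ := by
  obtain ⟨k, l, hl, rfl⟩ := hφ
  have : ∃ cs, List.Forall₂ (CodesAtomic ν) cs l := by
    induction l with
    | nil => exact ⟨[], .nil⟩
    | cons a l ih =>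
      obtain ⟨cs, hcs⟩ := ih (fun θ h => hl θ (by simp [h]))
      have : ∃ c, CodesAtomic ν c a := by
        have := hl a (by simp)
        cases this with
        | equal t1 t2 => exact ⟨_, .equal (exists_codesTerm ν h _ t1).choose_spec (exists_codesTerm ν h _ t2).choose_spec⟩
        | @rel l R ts =>
          match l, R with
          | _, Sum.inr .mem => rw [show ts = ![ts 0] from by ext i; fin_cases i; rfl]; exact ⟨_, .mem (exists_codesTerm ν h _ _).choose_spec⟩
      exact ⟨this.choose :: cs, .cons this.choose_spec hcs⟩
  obtain ⟨cs, h⟩ := this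
  exact ⟨_, k, l, cs, h, rfl, rfl⟩

end HenselMod

end

/-!
Elimination of quantifiers near zero in henselian modules over `R = K⟨t⟩`, and its effectivity.

Terms are linear forms, so a p.p. formula says that `x.A + y.B = 0` for some `y`, together with
some conditions of membership in `𝓞`, which are trivial when `𝓞` is the whole module and hold
automatically when `x` and `y` are small.

*Saturation.* If the constant coefficients of the columns of `B` are linearly dependent over `K`,
some `K`-combination of the columns has no constant coefficient, and it can be divided by `t`: it
equals `∑_e D_e t X^e`. Replacing a column of maximal degree in the combination by the columns `D_e`
decreases `∑ (d + 1)^degree`. In the end one has columns `C`, spanning those of `B`, say `B = C G`,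
whose constant coefficients are linearly independent (`exists_saturation`). They are obtained from
`B` by a program consisting of `K`-combinations and `t`-decompositions. The same program runs on
the elements `x.A_j` of any model of `T_λ`, and its results are terms of `L(λ)` in `x`
(`exists_run_terms`). If `w = x.A` and `w + y.B = 0`, the program transforms `w` into a `w'` with
`w' + y.C = 0`, hence `w = w'.G`. This condition on `x` is the formula `ψ` (`Elim.Cond`, `IsPsi`).

*Strongest consequence.* `ψ` follows from the formula modulo `T_λ` (`Elim.Valid.cond`,
`psi_of_phi`). If `ψ` holds in `M`, complete `C` to a square matrix `S` with an invertible constant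
part. Then `(M ⊕ R^k) / {(w'.c, S c)}` contains `M` and is again a model of `T_λ`
(`toAdjoin_injective`, `tDec_adjoin`), and in it the formula has a solution. As injective maps
between models of `T_λ` preserve and reflect quantifier-free formulas (`realize_iff_of_injective`),
all positive quantifier-free consequences of the formula hold in `M` (`psi_strongest`).

*Near zero.* By counting dimensions, and by dividing by `t` as far as possible, unit vectors have
separable multiples in the column module of `S` (`NonDeg.exists_separable_multiple`). Hence there
are `U` and `V` such that `S U` and `U V` are diagonal with separable entries. To solve
`y.S = -w'` one solves `y.(S U) = -w'.U` by the Hensel axiom. The difference `y.S + w'` is then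
annihilated by `U`, thus by the separable diagonal `U V`, and it is small, so it is zero
(`IsHens.exists_solution`). The ball on which this works has a radius that is explicit in the number
`s` of steps of the program and in a bound `β` for the absolute values of valuations (`radius`).

*Equivalent formulas.* The separable closure of `F((X))`, with `x.t = x^d`, modulo its separable
torsion is a torsion-free divisible model; it is nonzero because torsion elements are algebraic over
the countable field `K` (`exists_torsionFree_model`). Suppose the first formula implies the second
one there. For `x`, `y` satisfying the equations of the first formula and the run on the input of
the elimination of the second one, the equations `g_j` of the elimination condition of the second
formula hold. All these are linear relations, and the implication between them in this model is due
to identities `g_j r_j = ∑_l C_l z_lj` in `R`, with separable `r_j` and a saturation `C` of the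
relations that are assumed (`exists_trans`). In a model of `T_hens` the identities show that `r_j`
annihilates the value of `g_j`. Near zero this value is small, and separable elements are injective
on small balls, so the elimination condition holds, and the second formula follows
(`ImpliesNear.thens_models`).

*Computability.* All these data consist of finitely many elements of `R` subject to finitely many
identities, so they can be found by an unbounded search (`exists_search`). The remaining
requirement, a bound for valuations, is also witnessed by identities: `v(a) ≥ -β` if and only if
`b - b^d = X^(1 + d β) a^d` for some `b ∈ K` (`le_val_of_sub_pow_eq`, `exists_sub_pow_eq`), and
`v(a) ≤ β` if and only if `v(a⁻¹) ≥ -β`.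
-/

noncomputable section

namespace HenselMod

universe u

set_option linter.unusedSectionVars false

variable {F : Type u} [Field F] [Finite F]

/-! ### Coefficients in `R` -/

theorem R_ext {r s : R F} (h : ∀ i, coeff r i = coeff s i) : r = s :=
  MulOpposite.unop_injective (SkewPolynomial.ext h)

@[simp] theorem coeff_zero (i : ℕ) : coeff (0 : R F) i = 0 := rfl

@[simp] theorem coeff_add (r s : R F) (i : ℕ) : coeff (r + s) i = coeff r i + coeff s i :=
  SkewPolynomial.coeff_add _ _ _

@[simp] theorem coeff_neg (r : R F) (i : ℕ) : coeff (-r) i = -coeff r i :=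
  SkewPolynomial.coeff_neg _ _

@[simp] theorem coeff_sub (r s : R F) (i : ℕ) : coeff (r - s) i = coeff r i - coeff s i :=
  SkewPolynomial.coeff_sub _ _ _

theorem coeff_mono (n : ℕ) (a : K F) (i : ℕ) : coeff (mono n a : R F) i = if n = i then a else 0 :=
  SkewPolynomial.coeff_monomial

theorem mono_zero_one : (mono 0 1 : R F) = 1 := rfl

theorem coeff_one (i : ℕ) : coeff (1 : R F) i = if i = 0 then 1 else 0 := by
  rw [← mono_zero_one, coeff_mono]; simp [eq_comm]

@[simp] theorem mono_zero (n : ℕ) : (mono n 0 : R F) = 0 := by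
  simp [mono]

theorem mono_add (n : ℕ) (a b : K F) : (mono n (a + b) : R F) = mono n a + mono n b := by
  simp [mono]

theorem smul_K_def (n : ℕ) (a : K F) : (Multiplicative.ofAdd n) • a = a ^ (d F ^ n) := rfl

theorem mono_mul_mono (i j : ℕ) (a b : K F) :
    (mono i a * mono j b : R F) = mono (i + j) (a ^ (d F ^ j) * b) := by
  simp only [mono, ← MulOpposite.op_mul, SkewPolynomial.monomial_mul_monomial,
    SkewPolynomial.φ_iterate_apply]
  rw [smul_K_def, mul_comm b, add_comm j]

theorem mem_supp (r : R F) (i : ℕ) : i ∈ supp r ↔ coeff r i ≠ 0 := by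
  simp [supp, coeff]

theorem coeff_sum {ι : Type*} (s : Finset ι) (f : ι → R F) (i : ℕ) :
    coeff (∑ j ∈ s, f j) i = ∑ j ∈ s, coeff (f j) i := by
  classical
  induction s using Finset.induction_on with
  | empty => simp
  | insert a s ha ih => simp [Finset.sum_insert ha, ih]

/-- Additive induction on `R`: it is generated by the monomials. -/
theorem R_induction {P : R F → Prop} (r : R F) (h0 : P 0) (hadd : ∀ r s, P r → P s → P (r + s))
    (hm : ∀ i a, P (mono i a)) : P r := by
  rw [← sum_mono r]
  exact Finset.sum_induction _ P hadd h0 fun i _ => hm i _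

theorem d_pow_ne_zero (n : ℕ) : d F ^ n ≠ 0 := pow_ne_zero _ Nat.card_pos.ne'

theorem zero_pow_d (n : ℕ) : (0 : K F) ^ (d F ^ n) = 0 := zero_pow (d_pow_ne_zero n)

theorem coeff_mul (r s : R F) (e : ℕ) :
    coeff (r * s) e =
      ∑ i ∈ Finset.range (e + 1), coeff r i ^ (d F ^ (e - i)) * coeff s (e - i) := by
  induction r using R_induction with
  | h0 => simp only [zero_mul, coeff_zero, zero_pow_d, Finset.sum_const_zero]
  | hadd r r' h h' => simp only [add_mul, coeff_add, h, h', add_pow_card, Finset.sum_add_distrib]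
  | hm i a =>
    induction s using R_induction with
    | h0 => simp
    | hadd s s' h h' => simp only [mul_add, coeff_add, h, h', Finset.sum_add_distrib]
    | hm j b =>
      rw [mono_mul_mono]
      simp only [coeff_mono]
      split_ifs with h
      · rw [Finset.sum_eq_single i]
        · have : j = e - i := by omega
          simp [← this]
        · intro p _ hp
          rw [if_neg hp.symm, zero_pow_d, zero_mul]
        · intro hn
          exact absurd (Finset.mem_range.2 (by omega)) hn
      · symm
        apply Finset.sum_eq_zero
        intro p hp
        rw [Finset.mem_range] at hp
        by_cases hp' : i = p
        · rw [if_neg (c := j = e - p) (by omega), mul_zero]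
        · rw [if_neg hp', zero_pow_d, zero_mul]

theorem coeff_mul_K (r : R F) (a : K F) (i : ℕ) : coeff (r * mono 0 a) i = coeff r i * a := by
  induction r using R_induction with
  | h0 => simp
  | hadd r s h h' => simp [add_mul, h, h']
  | hm j b => rw [mono_mul_mono]; simp [coeff_mono]

theorem coeff_mul_zero (r s : R F) : coeff (r * s) 0 = coeff r 0 * coeff s 0 := by
  rw [coeff_mul]; simp

theorem coeff_mul_tX (r : R F) (a : K F) (i : ℕ) :
    coeff (r * mono 1 a) (i + 1) = coeff r i ^ d F * a := by
  induction r using R_induction with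
  | h0 => simp [Nat.card_pos.ne']
  | hadd r s h h' => 
    have := add_pow_card F 1 (coeff r i) (coeff s i)
    rw [pow_one] at this
    simp [add_mul, h, h', this]
  | hm j b =>
    rw [mono_mul_mono]; simp only [coeff_mono]
    by_cases h : j = i <;> simp [h, Nat.card_pos.ne']

theorem exists_coeff_bound (r : R F) : ∃ N, ∀ i, N ≤ i → coeff r i = 0 := by
  refine ⟨(supp r).sup id + 1, fun i hi => ?_⟩
  by_contra hc
  have := Finset.le_sup (f := id) ((mem_supp r i).2 hc)
  simp at this; omega

/-- The element `∑_{i < N} tⁱ fᵢ`. -/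
def ofFun (N : ℕ) (f : ℕ → K F) : R F := ∑ i ∈ Finset.range N, mono i (f i)

theorem coeff_ofFun (N : ℕ) (f : ℕ → K F) (i : ℕ) :
    coeff (ofFun N f) i = if i < N then f i else 0 := by
  simp [ofFun, coeff_sum, coeff_mono]

/-! ### Frobenius decompositions of fields -/

section Decomp

variable {E : Type*} [Field E] (q : ℕ) (X : E)

/-- `a = ∑_{i<q} c_i^q X^i` -/
def FrobDecomp (a : E) : Prop := ∃ c : Fin q → E, a = ∑ i, c i ^ q * X ^ (i : ℕ)

variable {q X}

theorem FrobDecomp.add (hq : ∀ a b : E, (a + b) ^ q = a ^ q + b ^ q) {a b : E}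
    (ha : FrobDecomp q X a) (hb : FrobDecomp q X b) : FrobDecomp q X (a + b) := by
  obtain ⟨c, rfl⟩ := ha
  obtain ⟨c', rfl⟩ := hb
  exact ⟨c + c', by simp [hq, add_mul, Finset.sum_add_distrib]⟩

theorem frobDecomp_monomial (hq0 : 0 < q) (c : E) (n : ℕ) : FrobDecomp q X (c ^ q * X ^ n) := by
  refine ⟨Pi.single ⟨n % q, Nat.mod_lt _ hq0⟩ (c * X ^ (n / q)), ?_⟩
  rw [Finset.sum_eq_single ⟨n % q, Nat.mod_lt _ hq0⟩]
  · rw [Pi.single_eq_same, mul_pow, mul_assoc, ← pow_mul, ← pow_add, Nat.div_add_mod']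
  · intro i _ hi
    rw [Pi.single_eq_of_ne hi, zero_pow hq0.ne', zero_mul]
  · simp

theorem frobDecomp_sum (hq0 : 0 < q) (hq : ∀ a b : E, (a + b) ^ q = a ^ q + b ^ q) {ι : Type*}
    (s : Finset ι) (f : ι → E) (hf : ∀ i ∈ s, FrobDecomp q X (f i)) :
    FrobDecomp q X (∑ i ∈ s, f i) := by
  refine Finset.sum_induction f (FrobDecomp q X) (fun a b => FrobDecomp.add hq) ?_ hf
  simpa [hq0.ne'] using frobDecomp_monomial (X := X) hq0 0 0

theorem FrobDecomp.mul (hq0 : 0 < q) (hq : ∀ a b : E, (a + b) ^ q = a ^ q + b ^ q) {a b : E}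
    (ha : FrobDecomp q X a) (hb : FrobDecomp q X b) : FrobDecomp q X (a * b) := by
  obtain ⟨c, rfl⟩ := ha
  obtain ⟨c', rfl⟩ := hb
  rw [Finset.sum_mul_sum]
  refine frobDecomp_sum hq0 hq _ _ fun i _ => frobDecomp_sum hq0 hq _ _ fun j _ => ?_
  convert frobDecomp_monomial (X := X) hq0 (c i * c' j) (i + j) using 1
  rw [mul_pow, pow_add]; ring

/-- A `q`-decomposition with respect to `x` in `k` gives one in a separable extension `E`, as
`E = k(E^q)`. -/
theorem frobDecomp_of_isSeparable {k : Type*} [Field k] [Algebra k E] [Algebra.IsSeparable k E]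
    (p : ℕ) [ExpChar k p] (n : ℕ) (hn : 0 < p ^ n) (x : k)
    (h : ∀ a : k, FrobDecomp (p ^ n) x a) (a : E) :
    FrobDecomp (p ^ n) (algebraMap k E x) a := by
  have := expChar_of_injective_algebraMap (algebraMap k E).injective p
  have hq : ∀ a b : E, (a + b) ^ (p ^ n) = a ^ (p ^ n) + b ^ (p ^ n) := fun a b =>
    add_pow_expChar_pow a b p n
  have h1 : a ∈ IntermediateField.adjoin k ((· ^ p ^ n) '' (Set.univ : Set E)) := by
    rw [← IntermediateField.adjoin_eq_adjoin_pow_expChar_pow_of_isSeparable']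
    exact IntermediateField.subset_adjoin _ _ trivial
  rw [← IntermediateField.mem_toSubalgebra, IntermediateField.adjoin_toSubalgebra] at h1
  induction h1 using Algebra.adjoin_induction with
  | mem z hz =>
    obtain ⟨y, -, rfl⟩ := hz
    simpa using frobDecomp_monomial (X := algebraMap k E x) hn y 0
  | algebraMap r =>
    obtain ⟨c, hc⟩ := h r
    refine ⟨fun i => algebraMap k E (c i), ?_⟩
    rw [hc]; simp
  | add x y _ _ hx hy => exact hx.add hq hy
  | mul x y _ _ hx hy => exact hx.mul hn hq hy

theorem frobDecomp_separableClosure {k L : Type*} [Field k] [Field L] [Algebra k L]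
    (p : ℕ) [ExpChar k p] (n : ℕ) (hn : 0 < p ^ n) (x : k)
    (h : ∀ a : k, FrobDecomp (p ^ n) x a) (a : separableClosure k L) :
    FrobDecomp (p ^ n) (algebraMap k (separableClosure k L) x) a :=
  frobDecomp_of_isSeparable p n hn x h a

theorem isSeparable_of_separableClosure {k L : Type*} [Field k] [Field L] [Algebra k L] {b : L}
    (h : _root_.IsSeparable (separableClosure k L) b) : b ∈ separableClosure k L :=
  mem_separableClosure_iff.2 (IsSeparable.of_algebra_isSeparable_of_isSeparable k h)

/-- The uniqueness of `q`-decompositions passes to a separable extension: the `q`-th powers of a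
`k`-basis of `E` stay linearly independent over `k`. -/
theorem frobDecomp_unique_of_isSeparable {k : Type*} [Field k] [Algebra k E]
    [Algebra.IsSeparable k E] (p : ℕ) [ExpChar k p] (n : ℕ) (x : k)
    (h : ∀ c : Fin (p ^ n) → k, ∑ i, c i ^ p ^ n * x ^ (i : ℕ) = 0 → c = 0)
    (c : Fin (p ^ n) → E) (hc : ∑ i, c i ^ p ^ n * algebraMap k E x ^ (i : ℕ) = 0) : c = 0 := by
  have := expChar_of_injective_algebraMap (algebraMap k E).injective p
  let u := Module.Basis.ofVectorSpace k E
  have hu := LinearIndependent.map_pow_expChar_pow_of_isSeparable p n u.linearIndependent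
  classical
  let s : Finset _ := Finset.univ.biUnion fun i => (u.repr (c i)).support
  have hci : ∀ i, c i = ∑ j ∈ s, (u.repr (c i) j) • u j := by
    intro i
    conv_lhs => rw [← u.linearCombination_repr (c i), Finsupp.linearCombination_apply, Finsupp.sum]
    refine Finset.sum_subset (fun j hj => Finset.mem_biUnion.2 ⟨i, Finset.mem_univ _, hj⟩) ?_
    intro j _ hj
    rw [Finsupp.notMem_support_iff.1 hj, zero_smul]
  have hpow : ∀ i, c i ^ p ^ n = ∑ j ∈ s, ((u.repr (c i) j) ^ p ^ n) • u j ^ p ^ n := by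
    intro i
    conv_lhs => rw [hci i, ← iterateFrobenius_def p n, map_sum]
    simp [iterateFrobenius_def, smul_pow]
  have h2 : ∑ j ∈ s, (∑ i, (u.repr (c i) j) ^ p ^ n * x ^ (i : ℕ)) • u j ^ p ^ n = 0 := by
    rw [← hc]
    simp only [hpow, Finset.sum_mul, Finset.sum_smul]
    rw [Finset.sum_comm]
    refine Finset.sum_congr rfl fun i _ => Finset.sum_congr rfl fun j _ => ?_
    simp only [Algebra.smul_def, map_mul, map_pow]; ring
  have h3 := fun j hj => linearIndependent_iff'.1 hu s _ h2 j hj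
  have h4 : ∀ j ∈ s, ∀ i, u.repr (c i) j = 0 := fun j hj i =>
    congrFun (h (fun i => u.repr (c i) j) (h3 j hj)) i
  funext i
  rw [hci i]
  exact Finset.sum_eq_zero fun j hj => by rw [h4 j hj i, zero_smul]

end Decomp


/-! ### The field `K` -/

section FieldK

variable {F : Type u} [Field F] [Finite F]

theorem exists_card_eq_pow : ∃ p n : ℕ, p.Prime ∧ CharP F p ∧ d F = p ^ n ∧ 0 < n := by
  have := Fintype.ofFinite F
  obtain ⟨p, hp⟩ := CharP.exists F
  obtain ⟨k, hpp, hk⟩ := FiniteField.card F p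
  exact ⟨p, k, hpp, hp, by rw [d, Nat.card_eq_fintype_card, hk], k.2⟩

theorem two_le_d : 2 ≤ d F := by
  have := Finite.one_lt_card (α := F)
  exact this

theorem d_pos : 0 < d F := Nat.card_pos

theorem pow_d_self (a : F) : a ^ d F = a := by
  have := Fintype.ofFinite F
  rw [d, Nat.card_eq_fintype_card, FiniteField.pow_card]

theorem add_pow_d {E : Type*} [Field E] [Algebra F E] (a b : E) :
    (a + b) ^ d F = a ^ d F + b ^ d F := by
  obtain ⟨p, n, hp, hc, hd, -⟩ := exists_card_eq_pow (F := F)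
  have : Fact p.Prime := ⟨hp⟩
  have := charP_of_injective_algebraMap (algebraMap F E).injective p
  rw [hd, add_pow_char_pow]

theorem coeff_powerSeries_pow_d (f : PowerSeries F) (m : ℕ) :
    PowerSeries.coeff m (f ^ d F) = if d F ∣ m then PowerSeries.coeff (m / d F) f else 0 := by
  obtain ⟨p, n, hp, hc, hd, -⟩ := exists_card_eq_pow (F := F)
  have : Fact p.Prime := ⟨hp⟩
  have : ExpChar F p := ExpChar.prime hp
  have h := MvPowerSeries.map_iterateFrobenius_expand p hp.ne_zero f n
  have hid : iterateFrobenius F p n = RingHom.id F := by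
    ext a; rw [iterateFrobenius_def, ← hd, pow_d_self]; rfl
  rw [hid, MvPowerSeries.map_id] at h
  have h' : PowerSeries.expand (p ^ n) (pow_ne_zero n hp.ne_zero) f = f ^ (p ^ n) := h
  rw [hd, ← h', PowerSeries.coeff_expand]

theorem coeff_laurent_pow_d (f : LaurentSeries F) (m : ℤ) :
    (f ^ d F).coeff m = if (d F : ℤ) ∣ m then f.coeff (m / d F) else 0 := by
  have hd := d_pos (F := F)
  have key : ∀ (g : PowerSeries F) (m : ℤ), ((HahnSeries.ofPowerSeries ℤ F g) ^ d F).coeff m =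
      if (d F : ℤ) ∣ m then (HahnSeries.ofPowerSeries ℤ F g).coeff (m / d F) else 0 := by
    intro g m
    rw [← map_pow, PowerSeries.coeff_coe, PowerSeries.coeff_coe]
    by_cases hm : m < 0
    · have : m / (d F : ℤ) < 0 := Int.ediv_neg_of_neg_of_pos hm (by exact_mod_cast hd)
      simp [hm, this]
    · obtain ⟨n, rfl⟩ := Int.eq_ofNat_of_zero_le (not_lt.1 hm)
      have : ¬ ((n : ℤ) / (d F : ℤ) < 0) := not_lt.2 (by positivity)
      rw [if_neg hm, if_neg this, coeff_powerSeries_pow_d]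
      simp only [Int.natCast_dvd_natCast, Int.natAbs_natCast]
      rfl
  set o := f.order
  have hf := LaurentSeries.single_order_mul_powerSeriesPart f
  set g := f.powerSeriesPart
  rw [← hf, mul_pow, HahnSeries.single_pow, one_pow, HahnSeries.coeff_single_mul, key,
    HahnSeries.coeff_single_mul, one_mul, one_mul]
  have h1 : (d F : ℤ) ∣ m - d F • o ↔ (d F : ℤ) ∣ m := by
    rw [nsmul_eq_mul]; exact dvd_sub_left (Dvd.intro _ rfl)
  refine if_congr h1 (congrArg _ ?_) rfl
  rw [nsmul_eq_mul, Int.sub_mul_ediv_left _ _ (by exact_mod_cast hd.ne')]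

/-- In `∑_j c_j(X^d) X^j`, the exponents congruent to `i` modulo `d` come from `c_i` only. -/
theorem coeff_sum_pow_d (c : Fin (d F) → LaurentSeries F) (n : ℤ) (i : Fin (d F)) :
    (∑ j, c j ^ d F * (HahnSeries.single 1 1 : LaurentSeries F) ^ (j : ℕ)).coeff
      (d F * n + (i : ℕ)) = (c i).coeff n := by
  have hd := d_pos (F := F)
  have h : ∀ j, (c j ^ d F * (HahnSeries.single 1 1 : LaurentSeries F) ^ (j : ℕ)).coeff
      (d F * n + (i : ℕ)) = if j = i then (c i).coeff n else 0 := by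
    intro j
    rw [HahnSeries.single_pow, one_pow, HahnSeries.coeff_mul_single, mul_one, coeff_laurent_pow_d]
    have hj := j.2
    have hi := i.2
    by_cases hij : j = i
    · subst hij
      have : (d F : ℤ) * n + (j : ℕ) - (j : ℕ) • 1 = d F * n := by simp
      rw [this, if_pos (Dvd.intro _ rfl), if_pos rfl, Int.mul_ediv_cancel_left _ (by omega)]
    · rw [if_neg hij, if_neg]
      intro hdv
      have hdv : (d F : ℤ) ∣ ((i : ℕ) : ℤ) - (j : ℕ) := by
        have h2 := dvd_sub hdv (Dvd.intro n rfl : (d F : ℤ) ∣ d F * n)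
        have e : (d F : ℤ) * n + (i : ℕ) - (j : ℕ) • 1 - d F * n = ((i : ℕ) : ℤ) - (j : ℕ) := by
          rw [nsmul_one]; ring
        rw [e] at h2; exact h2
      have := Int.eq_zero_of_abs_lt_dvd hdv (by rw [abs_lt]; omega)
      exact hij (Fin.ext (by omega))
  rw [HahnSeries.coeff_sum, Finset.sum_congr rfl fun j _ => h j]
  simp

theorem laurent_frobDecomp (f : LaurentSeries F) :
    FrobDecomp (d F) (HahnSeries.single 1 1 : LaurentSeries F) f := by
  have hd := d_pos (F := F)
  have hb : ∀ i : Fin (d F), BddBelow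
      (Function.support fun n : ℤ => f.coeff (d F * n + (i : ℕ))) := by
    intro i
    refine ⟨-|f.order| - 1, fun n hn => ?_⟩
    by_contra hlt
    refine hn (HahnSeries.coeff_eq_zero_of_lt_order ?_)
    have h1 := neg_abs_le f.order
    have hi := i.2
    have : (n + 1) * (d F : ℤ) ≤ (n + 1) * 1 :=
      mul_le_mul_of_nonpos_left (by omega) (by have := abs_nonneg f.order; omega)
    nlinarith
  refine ⟨fun i => HahnSeries.ofSuppBddBelow _ (hb i), ?_⟩
  ext m
  have h := coeff_sum_pow_d (fun i => HahnSeries.ofSuppBddBelow _ (hb i)) (m / d F)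
    ⟨(m % d F).toNat, by have := Int.emod_lt_of_pos m (show (0 : ℤ) < d F by omega); omega⟩
  have hm : (d F : ℤ) * (m / d F) + ((m % d F).toNat : ℕ) = m := by
    rw [Int.toNat_of_nonneg (Int.emod_nonneg _ (by omega))]
    exact Int.mul_ediv_add_emod m _
  simp only [hm] at h
  rw [h]
  change _ = f.coeff _
  simp only [hm]

theorem laurent_frobDecomp_unique (c : Fin (d F) → LaurentSeries F)
    (hc : ∑ i, c i ^ d F * (HahnSeries.single 1 1 : LaurentSeries F) ^ (i : ℕ) = 0) : c = 0 := by
  funext i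
  ext n
  rw [← coeff_sum_pow_d c n i, hc]
  rfl

/-- The coefficients of the solution `b` of `b - b^d = c`. -/
def subPowSol (c : ℕ → F) (n : ℕ) : F :=
  if h : d F ∣ n ∧ n ≠ 0 then
    have : n / d F < n := Nat.div_lt_self (Nat.pos_of_ne_zero h.2) (two_le_d (F := F))
    c n + subPowSol c (n / d F)
  else c n
termination_by n

/-- The Artin–Schreier type equation `b - b^d = c` is solvable in `F((X))` when `v(c) > 0`: the
coefficients of `b` are found one after the other since `b^d = b(X^d)`. -/
theorem laurent_exists_sub_pow_eq (c : LaurentSeries F) (hc : 0 < c.orderTop) :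
    ∃ b : LaurentSeries F, b - b ^ d F = c := by
  set b : ℕ → F := subPowSol fun n => c.coeff n with hb
  refine ⟨HahnSeries.ofPowerSeries ℤ F (PowerSeries.mk b), ?_⟩
  ext m
  rw [HahnSeries.coeff_sub, ← map_pow, PowerSeries.coeff_coe, PowerSeries.coeff_coe]
  by_cases hm : m < 0
  · rw [if_pos hm, if_pos hm, HahnSeries.coeff_eq_zero_of_lt_orderTop (lt_trans _ hc), sub_zero]
    exact_mod_cast hm
  · obtain ⟨n, rfl⟩ := Int.eq_ofNat_of_zero_le (not_lt.1 hm)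
    rw [if_neg hm, if_neg hm, coeff_powerSeries_pow_d]
    simp only [Int.natAbs_natCast, PowerSeries.coeff_mk]
    have hbn := subPowSol.eq_1 (fun n => c.coeff n) n
    by_cases h0 : n = 0
    · subst h0
      have : c.coeff 0 = 0 := HahnSeries.coeff_eq_zero_of_lt_orderTop hc
      simp [this]
    · rw [← hb] at hbn
      by_cases hd : d F ∣ n
      · rw [dif_pos ⟨hd, h0⟩] at hbn
        rw [if_pos hd, hbn, add_sub_cancel_right]
      · rw [dif_neg (fun h => hd h.1)] at hbn
        rw [if_neg hd, hbn, sub_zero]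


open scoped RatFunc in
theorem ratFunc_frobDecomp (a : RatFunc F) : FrobDecomp (d F) (RatFunc.X : RatFunc F) a := by
  have hd := d_pos (F := F)
  have hq : ∀ a b : RatFunc F, (a + b) ^ d F = a ^ d F + b ^ d F := add_pow_d
  have hpoly : ∀ f : Polynomial F,
      FrobDecomp (d F) (RatFunc.X : RatFunc F) (algebraMap (Polynomial F) (RatFunc F) f) := by
    intro f
    rw [f.as_sum_range, map_sum]
    refine frobDecomp_sum hd hq _ _ fun i _ => ?_
    convert frobDecomp_monomial (X := (RatFunc.X : RatFunc F)) hd (RatFunc.C (f.coeff i)) i using 1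
    rw [← Polynomial.C_mul_X_pow_eq_monomial, map_mul, map_pow, RatFunc.algebraMap_X,
      RatFunc.algebraMap_C, ← map_pow, pow_d_self]
  induction a using RatFunc.induction_on with
  | f p q hq0 =>
    have hq1 : algebraMap (Polynomial F) (RatFunc F) q ≠ 0 := by
      rwa [Ne, FaithfulSMul.algebraMap_eq_zero_iff]
    -- `p / q = p q^(d-1) (1/q)^d`
    convert (hpoly (p * q ^ (d F - 1))).mul hd hq (frobDecomp_monomial (X := RatFunc.X) hd
      (algebraMap (Polynomial F) (RatFunc F) q)⁻¹ 0) using 1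
    rw [map_mul, map_pow, pow_zero, mul_one, mul_assoc, inv_pow]
    have h1 : algebraMap (Polynomial F) (RatFunc F) q ^ d F =
        algebraMap (Polynomial F) (RatFunc F) q ^ (d F - 1) *
          algebraMap (Polynomial F) (RatFunc F) q := by
      rw [← pow_succ, Nat.sub_add_cancel hd]
    rw [h1, mul_inv, mul_inv_cancel_left₀ (pow_ne_zero _ hq1), div_eq_mul_inv]

open scoped RatFunc in
theorem unif_val : (unif F).1 = (HahnSeries.single 1 1 : LaurentSeries F) :=
  RatFunc.coe_X

theorem K_ext {a b : K F} (h : a.1 = b.1) : a = b := Subtype.ext h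

@[simp] theorem K_val_mul (a b : K F) : (a * b).1 = a.1 * b.1 := rfl
@[simp] theorem K_val_pow (a : K F) (n : ℕ) : (a ^ n).1 = a.1 ^ n := rfl
@[simp] theorem K_val_zero : (0 : K F).1 = 0 := rfl

theorem K_val_sum {ι : Type*} (s : Finset ι) (f : ι → K F) :
    (∑ i ∈ s, f i).1 = ∑ i ∈ s, (f i).1 := map_sum (henselization F).subtype f s

theorem add_pow_dK (a b : K F) : (a + b) ^ d F = a ^ d F + b ^ d F := by
  have := add_pow_card F 1 a b
  rwa [pow_one] at this

open scoped RatFunc in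
/-- `1, X, …, X^(d-1)` span `K` over `K^d`: this holds for `F(X)`, and `K` is separable over it. -/
theorem K_frobDecomp (a : K F) : FrobDecomp (d F) (unif F) a := by
  obtain ⟨p, n, hp, hc, hd, hn⟩ := exists_card_eq_pow (F := F)
  have : Fact p.Prime := ⟨hp⟩
  have : CharP (RatFunc F) p := charP_of_injective_algebraMap (algebraMap F (RatFunc F)).injective p
  have : ExpChar (RatFunc F) p := ExpChar.prime hp
  have h := frobDecomp_separableClosure (k := RatFunc F)
    (L := LaurentSeries F) p n (hd ▸ d_pos) RatFunc.X
    (fun a => hd ▸ ratFunc_frobDecomp a) a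
  rw [← hd] at h
  exact h

/-- `1, X, …, X^(d-1)` are independent over `K^d`, as they are in `F((X))`. -/
theorem K_frobDecomp_unique (c : Fin (d F) → K F)
    (hc : ∑ i, c i ^ d F * unif F ^ (i : ℕ) = 0) : c = 0 := by
  have h := laurent_frobDecomp_unique (fun i => (c i).1) (by
    have := congrArg Subtype.val hc
    rw [K_val_sum] at this
    simpa [unif_val] using this)
  funext i
  exact K_ext (congrFun h i)

/-! ### The valuation -/

theorem nsmul_coe (n : ℕ) (m : ℤ) : n • (m : WithTop ℤ) = ((n * m : ℤ) : WithTop ℤ) := by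
  rw [← WithTop.coe_nsmul, nsmul_eq_mul]

theorem val_mul (a b : K F) : val (a * b) = val a + val b := HahnSeries.orderTop_mul _ _

theorem val_add (a b : K F) : min (val a) (val b) ≤ val (a + b) :=
  HahnSeries.min_orderTop_le_orderTop_add

theorem val_neg (a : K F) : val (-a) = val a := HahnSeries.orderTop_neg

theorem val_eq_top {a : K F} : val a = ⊤ ↔ a = 0 := by
  rw [val, HahnSeries.orderTop_eq_top]
  exact ⟨fun h => K_ext h, fun h => by rw [h]; rfl⟩

theorem val_zero : val (0 : K F) = ⊤ := val_eq_top.2 rfl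

theorem val_one : val (1 : K F) = 0 := HahnSeries.orderTop_one

theorem val_pow (a : K F) (n : ℕ) : val (a ^ n) = n • val a := by
  induction n with
  | zero => simp [val_one]
  | succ n ih => rw [pow_succ, val_mul, ih, succ_nsmul]

theorem val_unif : val (unif F) = 1 := by
  rw [val, unif_val, HahnSeries.orderTop_single one_ne_zero]; rfl

theorem exists_val_eq {a : K F} (ha : a ≠ 0) : ∃ n : ℤ, val a = n := by
  have := mt val_eq_top.1 ha
  exact ⟨(val a).untop this, (WithTop.coe_untop _ _).symm⟩

/-- `v(a) ≥ -n` as soon as `b - b^d = X^{1+dn} a^d` has a solution: a negative value of the right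
hand side would be divisible by `d`, as it would be `d v(b)`, but it is `1` modulo `d`. -/
theorem le_val_of_sub_pow_eq {a b : K F} {n : ℕ}
    (h : b - b ^ d F = unif F ^ (1 + d F * n) * a ^ d F) : ((-n : ℤ) : WithTop ℤ) ≤ val a := by
  by_cases ha : a = 0
  · rw [ha, val_zero]; exact le_top
  obtain ⟨m, hm⟩ := exists_val_eq ha
  rw [hm]
  by_contra hlt
  have hlt : m < -n := by exact_mod_cast not_le.1 hlt
  have hd := two_le_d (F := F)
  have hv : val (b - b ^ d F) = ((1 + d F * (n + m) : ℤ) : WithTop ℤ) := by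
    rw [h, val_mul, val_pow, val_pow, val_unif, hm, ← WithTop.coe_one, nsmul_coe, nsmul_coe,
      ← WithTop.coe_add]
    congr 1; push_cast; ring
  have hneg : 1 + (d F : ℤ) * (n + m) < 0 := by nlinarith
  have hb0 : b ≠ 0 := by
    rintro rfl
    rw [zero_pow (by omega), sub_zero, val_zero] at hv
    exact absurd hv (WithTop.coe_ne_top).symm
  obtain ⟨k, hk⟩ := exists_val_eq hb0
  have hbd : val (b ^ d F) = ((d F * k : ℤ) : WithTop ℤ) := by
    rw [val_pow, hk, nsmul_coe]
  have hsub : min (val b) (val (b ^ d F)) ≤ val (b - b ^ d F) := by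
    rw [sub_eq_add_neg, ← val_neg (b ^ d F)]; exact val_add _ _
  have hk0 : k < 0 := by
    by_contra hk0
    push Not at hk0
    rw [hv, hk, hbd, ← WithTop.coe_min] at hsub
    have : min k (d F * k) ≤ 1 + (d F : ℤ) * (n + m) := by exact_mod_cast hsub
    have h2 : 0 ≤ (d F : ℤ) * k := by positivity
    have := le_min hk0 h2
    omega
  have hlt2 : val (-(b ^ d F)) < val b := by
    rw [val_neg, hbd, hk]
    have : (d F : ℤ) * k < k := by nlinarith
    exact_mod_cast this
  have : val (b - b ^ d F) = val (-(b ^ d F)) := by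
    rw [sub_eq_add_neg]; exact HahnSeries.orderTop_add_eq_right hlt2
  rw [hv, val_neg, hbd] at this
  have h3 : 1 + (d F : ℤ) * (n + m) = d F * k := by exact_mod_cast this
  have h4 : (d F : ℤ) ∣ 1 := ⟨k - (n + m), by linear_combination h3⟩
  have := Int.le_of_dvd one_pos h4
  omega

open scoped RatFunc in
/-- `Y - Y^d - a` has derivative `1`, hence its roots in `F((X))` are separable over `K`. -/
theorem mem_henselization_of_sub_pow_mem {b : LaurentSeries F}
    (h : b - b ^ d F ∈ henselization F) : b ∈ henselization F := by
  set E := separableClosure (RatFunc F) (LaurentSeries F) with hE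
  have hsep : _root_.IsSeparable E b := by
    let f : Polynomial E := Polynomial.X - Polynomial.X ^ d F - Polynomial.C ⟨b - b ^ d F, h⟩
    have hf : f.Separable := by
      obtain ⟨p, n, hp, hc, hd, hn⟩ := exists_card_eq_pow (F := F)
      have : CharP (LaurentSeries F) p :=
        charP_of_injective_algebraMap (algebraMap F (LaurentSeries F)).injective p
      have : CharP E p := (algebraMap E (LaurentSeries F)).charP
        (algebraMap E (LaurentSeries F)).injective p
      have hd0 : ((d F : ℕ) : E) = 0 := by
        rw [hd, Nat.cast_pow, CharP.cast_eq_zero, zero_pow hn.ne']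
      rw [Polynomial.separable_def]
      have : Polynomial.derivative f = 1 := by
        simp [f, Polynomial.derivative_X_pow, hd0]
      rw [this]
      exact isCoprime_one_right
    refine Polynomial.Separable.of_dvd hf (minpoly.dvd _ _ ?_)
    simp [f]
  exact isSeparable_of_separableClosure hsep

/-- The converse of `le_val_of_sub_pow_eq`: the right hand side has positive valuation, and the
solution in `F((X))` is in `K`. -/
theorem exists_sub_pow_eq {a : K F} {n : ℕ} (h : ((-n : ℤ) : WithTop ℤ) ≤ val a) :
    ∃ b : K F, b - b ^ d F = unif F ^ (1 + d F * n) * a ^ d F := by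
  have hc : 0 < val (unif F ^ (1 + d F * n) * a ^ d F) := by
    by_cases ha : a = 0
    · rw [ha, zero_pow d_pos.ne', mul_zero, val_zero]; exact WithTop.coe_lt_top 0
    obtain ⟨m, hm⟩ := exists_val_eq ha
    rw [hm] at h
    have h : -(n : ℤ) ≤ m := by exact_mod_cast h
    rw [val_mul, val_pow, val_pow, val_unif, hm, ← WithTop.coe_one, nsmul_coe, nsmul_coe,
      ← WithTop.coe_add]
    have : 0 < ((1 + d F * n : ℕ) : ℤ) * 1 + (d F : ℤ) * m := by
      push_cast; nlinarith [d_pos (F := F)]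
    exact_mod_cast this
  obtain ⟨b, hb⟩ := laurent_exists_sub_pow_eq _ hc
  have hm : b ∈ henselization F :=
    mem_henselization_of_sub_pow_mem (by rw [hb]; exact Subtype.prop _)
  exact ⟨⟨b, hm⟩, K_ext hb⟩

end FieldK

/-! ### `t`-division in `R` -/

/-- The coordinates `λ_i(a)` of `a ∈ K`, determined by `a = ∑_i λ_i(a)^d X^i`. -/
def klam (a : K F) : Fin (d F) → K F := (K_frobDecomp a).choose

theorem klam_spec (a : K F) : a = ∑ i, klam a i ^ d F * unif F ^ (i : ℕ) :=
  (K_frobDecomp a).choose_spec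

theorem sum_pow_d_injective {c c' : Fin (d F) → K F}
    (h : ∑ i, c i ^ d F * unif F ^ (i : ℕ) = ∑ i, c' i ^ d F * unif F ^ (i : ℕ)) : c = c' := by
  have := K_frobDecomp_unique (c - c') (by
    rw [← sub_eq_zero, ← Finset.sum_sub_distrib] at h
    rw [← h]
    refine Finset.sum_congr rfl fun i _ => ?_
    have e := add_pow_dK (c i - c' i) (c' i)
    rw [sub_add_cancel] at e
    rw [e, Pi.sub_apply]; ring)
  exact sub_eq_zero.1 this

theorem klam_zero : klam (0 : K F) = 0 := by
  apply sum_pow_d_injective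
  rw [← klam_spec]
  simp [d_pos.ne']

/-- The element `t X^e` of `R`. -/
def tE (e : Fin (d F)) : R F := mono 1 (unif F ^ (e : ℕ))

/-- `r ∈ R` has degree less than `N`. -/
def DegLT (r : R F) (N : ℕ) : Prop := ∀ i, N ≤ i → coeff r i = 0

theorem exists_degLT (r : R F) : ∃ N, DegLT r N := exists_coeff_bound r

theorem DegLT.mono {r : R F} {N N' : ℕ} (h : DegLT r N) (hN : N ≤ N') : DegLT r N' :=
  fun i hi => h i (hN.trans hi)

theorem DegLT.eq_zero {r : R F} (h : DegLT r 0) : r = 0 := R_ext fun i => h i (Nat.zero_le i)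

theorem degLT_ofFun (N : ℕ) (f : ℕ → K F) : DegLT (ofFun N f) N := fun i hi => by
  rw [coeff_ofFun, if_neg (not_lt.2 hi)]

theorem coeff_mul_tE (r : R F) (e : Fin (d F)) (i : ℕ) :
    coeff (r * tE e) i = if i = 0 then 0 else coeff r (i - 1) ^ d F * unif F ^ (e : ℕ) := by
  cases i with
  | zero => rw [coeff_mul_zero]; simp [tE, coeff_mono]
  | succ i => simp [tE, coeff_mul_tX]

/-- Division by `t`: an element of `R` without constant coefficient is `∑_e r_e t X^e`. -/
theorem exists_tdiv {r : R F} (h0 : coeff r 0 = 0) {N : ℕ} (hN : DegLT r (N + 1)) :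
    ∃ f : Fin (d F) → R F, r = ∑ e, f e * tE e ∧ ∀ e, DegLT (f e) N := by
  refine ⟨fun e => ofFun N fun i => klam (coeff r (i + 1)) e, ?_, fun e => degLT_ofFun _ _⟩
  apply R_ext
  intro i
  rw [coeff_sum]
  cases i with
  | zero => simp [coeff_mul_tE, h0]
  | succ i =>
    conv_lhs => rw [klam_spec (coeff r (i + 1))]
    refine Finset.sum_congr rfl fun e _ => ?_
    rw [coeff_mul_tE, if_neg (Nat.succ_ne_zero i), Nat.add_sub_cancel, coeff_ofFun]
    split_ifs with hi
    · rfl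
    · rw [hN (i + 1) (by omega), klam_zero]; rfl

theorem sum_tE_injective {f g : Fin (d F) → R F} (h : ∑ e, f e * tE e = ∑ e, g e * tE e) :
    f = g := by
  have : ∀ i, (fun e => coeff (f e) i) = fun e => coeff (g e) i := by
    intro i
    apply sum_pow_d_injective
    have := congrArg (fun r => coeff r (i + 1)) h
    simpa [coeff_sum, coeff_mul_tE] using this
  funext e
  exact R_ext fun i => congrFun (this i) e

theorem coeff_zero_sum_tE (f : Fin (d F) → R F) : coeff (∑ e, f e * tE e) 0 = 0 := by
  simp [coeff_sum, coeff_mul_tE]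

/-! ### Right `R`-modules -/

variable (F) in
/-- The opposite ring of `R`; right `R`-modules are left modules over it. -/
abbrev Rop : Type u := SkewPolynomial (K F)

section Module

variable {M : Type*} [AddCommGroup M] [Module (Rop F) M]

/-- The right action `x.r`. -/
def sm (x : M) (r : R F) : M := r.unop • x

theorem sm_def (x : M) (r : R F) : sm x r = r.unop • x := rfl
theorem add_sm (x y : M) (r : R F) : sm (x + y) r = sm x r + sm y r := smul_add _ _ _
theorem sm_add (x : M) (r s : R F) : sm x (r + s) = sm x r + sm x s := add_smul _ _ _
theorem sm_mul (x : M) (r s : R F) : sm x (r * s) = sm (sm x r) s := mul_smul _ _ _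
theorem sm_one (x : M) : sm x (1 : R F) = x := one_smul _ _
theorem sm_zero (x : M) : sm x (0 : R F) = 0 := zero_smul _ _
theorem zero_sm (r : R F) : sm (0 : M) r = 0 := smul_zero _
theorem neg_sm (x : M) (r : R F) : sm (-x) r = -sm x r := smul_neg _ _
theorem sm_neg (x : M) (r : R F) : sm x (-r) = -sm x r := neg_smul _ _
theorem sub_sm (x y : M) (r : R F) : sm (x - y) r = sm x r - sm y r := smul_sub _ _ _
theorem sm_sub (x : M) (r s : R F) : sm x (r - s) = sm x r - sm x s := sub_smul _ _ _

theorem sum_sm {ι : Type*} (s : Finset ι) (f : ι → M) (r : R F) :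
    sm (∑ i ∈ s, f i) r = ∑ i ∈ s, sm (f i) r := Finset.smul_sum

theorem sm_sum {ι : Type*} (s : Finset ι) (x : M) (f : ι → R F) :
    sm x (∑ i ∈ s, f i) = ∑ i ∈ s, sm x (f i) := by
  simp only [sm_def, Finset.unop_sum, Finset.sum_smul]

theorem sm_R (x r : R F) : sm x r = x * r := rfl

theorem sm_mono_zero_inv (x : M) {a : K F} (ha : a ≠ 0) :
    sm (sm x (mono 0 a)) (mono 0 a⁻¹) = x := by
  rw [← sm_mul, mono_mul_mono, pow_zero, pow_one, mul_inv_cancel₀ ha, add_zero, mono_zero_one,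
    sm_one]

theorem map_sm {N : Type*} [AddCommGroup N] [Module (Rop F) N] (f : M →ₗ[Rop F] N) (x : M)
    (r : R F) : f (sm x r) = sm (f x) r := map_smul f _ _

variable (F) in
/-- The map `(x_e)_e ↦ ∑ x_e.tX^e`. -/
def tsum (f : Fin (d F) → M) : M := ∑ e, sm (f e) (tE e)

variable (F M) in
/-- The map `tsum` is injective: the `t`-decomposition of an element is unique if it exists. -/
def TInj : Prop := ∀ f : Fin (d F) → M, tsum F f = 0 → f = 0

variable (F M) in
/-- `M` is `t`-decomposable. -/
def TDec : Prop := ∀ x : M, ∃! f : Fin (d F) → M, x = tsum F f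

theorem tsum_sub (f g : Fin (d F) → M) : tsum F (f - g) = tsum F f - tsum F g := by
  simp [tsum, sub_sm]

theorem tsum_zero : tsum F (0 : Fin (d F) → M) = 0 := by
  simp [tsum, zero_sm]

theorem map_tsum {N : Type*} [AddCommGroup N] [Module (Rop F) N] (g : M →ₗ[Rop F] N)
    (f : Fin (d F) → M) : g (tsum F f) = tsum F (g ∘ f) := by
  simp [tsum, map_sm]

theorem TDec.tInj (h : TDec F M) : TInj F M := fun _ hf =>
  (h 0).unique hf.symm (tsum_zero).symm

theorem TInj.eq (h : TInj F M) {f g : Fin (d F) → M} (hfg : tsum F f = tsum F g) : f = g :=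
  sub_eq_zero.1 (h _ (by rw [tsum_sub, hfg, sub_self]))

theorem tDec_of (h : TInj F M) (h' : ∀ x : M, ∃ f : Fin (d F) → M, x = tsum F f) : TDec F M := by
  intro x
  obtain ⟨f, hf⟩ := h' x
  exact ⟨f, hf, fun g hg => h.eq (by rw [← hf, ← hg])⟩

theorem tInj_R : TInj F (R F) := fun _ hf =>
  sum_tE_injective (g := 0) (hf.trans (by simp))

/-! ### Programs -/

/-- The sequence `W` of elements follows the program `a` with `n` inputs and `s` steps: in the
step `j` the combination `∑ W_i.a_{j,i}` of all former elements is `t`-decomposed, and its `d`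
coordinates are the next elements of the sequence. -/
def Run (n s : ℕ) (a : ℕ → ℕ → K F) (W : ℕ → M) : Prop :=
  ∀ j < s, ∑ i ∈ Finset.range (n + d F * j), sm (W i) (mono 0 (a j i)) =
    tsum F fun e => W (n + d F * j + e)

theorem Run.congr {n s : ℕ} {a : ℕ → ℕ → K F} {W W' : ℕ → M} (h : Run n s a W)
    (hW : ∀ i < n + d F * s, W i = W' i) : Run n s a W' := by
  intro j hj
  have hle : n + d F * j + d F ≤ n + d F * s := by
    have := Nat.mul_le_mul_left (d F) (Nat.succ_le_of_lt hj)
    rw [Nat.mul_succ] at this; omega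
  have e1 : ∑ i ∈ Finset.range (n + d F * j), sm (W' i) (mono 0 (a j i)) =
      ∑ i ∈ Finset.range (n + d F * j), sm (W i) (mono 0 (a j i)) :=
    Finset.sum_congr rfl fun i hi => by
      rw [hW i (by have := Finset.mem_range.1 hi; omega)]
  rw [e1, h j hj]
  congr 1
  funext e
  exact hW _ (by have := e.2; omega)

theorem exists_step_eq {c n s i : ℕ} (hc : 0 < c) (h : n ≤ i) (h' : i < n + c * s) :
    ∃ j < s, ∃ e : Fin c, i = n + c * j + e := by
  refine ⟨(i - n) / c, Nat.div_lt_of_lt_mul (by omega), ⟨(i - n) % c, Nat.mod_lt _ hc⟩, ?_⟩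
  have := Nat.div_add_mod (i - n) c
  simp only
  omega

/-- A run is determined by its inputs, since `t`-decompositions are unique. -/
theorem Run.unique (hM : TInj F M) {n s : ℕ} {a : ℕ → ℕ → K F} {W W' : ℕ → M}
    (h : Run n s a W) (h' : Run n s a W') (h0 : ∀ i < n, W i = W' i) :
    ∀ i < n + d F * s, W i = W' i := by
  intro i
  induction i using Nat.strong_induction_on with
  | _ i ih =>
    intro hi
    by_cases hin : i < n
    · exact h0 i hin
    · obtain ⟨j, hj, e, rfl⟩ := exists_step_eq (d_pos (F := F)) (not_lt.1 hin) hi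
      have e1 : (fun e : Fin (d F) => W (n + d F * j + e)) = fun e : Fin (d F) =>
          W' (n + d F * j + e) := by
        apply hM.eq
        rw [← h j hj, ← h' j hj]
        refine Finset.sum_congr rfl fun l hl => ?_
        have := Finset.mem_range.1 hl
        rw [ih l (by omega) (by omega)]
      exact congrFun e1 e

/-- Runs in `R` give runs in a module by linear combination. -/
theorem Run.linearComb {κ : Type*} (t : Finset κ) {n s : ℕ} {a : ℕ → ℕ → K F}
    {b : κ → ℕ → R F} (y : κ → M) (h : ∀ v ∈ t, Run n s a (b v)) :
    Run n s a fun i => ∑ v ∈ t, sm (y v) (b v i) := by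
  intro j hj
  simp only [tsum, sum_sm]
  rw [Finset.sum_comm, Finset.sum_comm (s := Finset.univ)]
  refine Finset.sum_congr rfl fun v hv => ?_
  have := congrArg (sm (y v)) (h v hv j hj)
  simpa [tsum, sm_sum, sm_mul, sm_R] using this

end Module

/-! ### Saturation of systems of columns -/

section Saturation

variable {k n : ℕ}

/-- The constant coefficients of a column over `R`. -/
def coef0 (C : Fin k → R F) : Fin k → K F := fun v => coeff (C v) 0

/-- Every `C l` is a `K`-linear combination of the elements of some run with inputs `b₀`. -/
def Derivable (n : ℕ) (b₀ : ℕ → Fin k → R F) {ι : Type} (C : ι → Fin k → R F) : Prop :=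
  ∃ (s : ℕ) (a : ℕ → ℕ → K F) (b : ℕ → Fin k → R F), (∀ i < n, b i = b₀ i) ∧ Run n s a b ∧
    ∃ h : ℕ → ι → K F, ∀ l, C l = ∑ i ∈ Finset.range (n + d F * s), sm (b i) (mono 0 (h i l))

theorem sm_mono_K {M : Type*} [AddCommGroup M] [Module (Rop F) M] (x : M) (a b : K F) :
    sm (sm x (mono 0 a)) (mono 0 b) = sm x (mono 0 (a * b)) := by
  rw [← sm_mul, mono_mul_mono, pow_zero, pow_one, add_zero]

theorem mono_sum {ι : Type*} (i : ℕ) (s : Finset ι) (f : ι → K F) :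
    (mono i (∑ j ∈ s, f j) : R F) = ∑ j ∈ s, mono i (f j) := by
  classical
  induction s using Finset.induction_on with
  | empty => simp
  | insert a s ha ih => rw [Finset.sum_insert ha, Finset.sum_insert ha, mono_add, ih]

theorem Derivable.comp {b₀ : ℕ → Fin k → R F} {ι κ : Type} {C : ι → Fin k → R F}
    (h : Derivable n b₀ C) (f : κ → ι) : Derivable n b₀ (C ∘ f) := by
  obtain ⟨s, a, b, h1, h2, h, h3⟩ := h
  exact ⟨s, a, b, h1, h2, fun i l => h i (f l), fun l => h3 (f l)⟩

/-- One more step of the program: a combination of the columns without constant coefficients is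
replaced by its `t`-coordinates `D`. -/
theorem Derivable.step {b₀ : ℕ → Fin k → R F} {ι : Type} [Fintype ι] {C : ι → Fin k → R F}
    (h : Derivable n b₀ C) (c : ι → K F) (D : Fin (d F) → Fin k → R F)
    (hD : ∑ l, sm (C l) (mono 0 (c l)) = tsum F D) : Derivable n b₀ (Sum.elim C D) := by
  classical
  obtain ⟨s, a, b, h1, h2, h, h3⟩ := h
  set q := n + d F * s with hq
  have hq' : n + d F * (s + 1) = q + d F := by rw [Nat.mul_succ]; omega
  let b' : ℕ → Fin k → R F := fun i => if hi : q ≤ i ∧ i < q + d F then D ⟨i - q, by omega⟩ else b i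
  have hb' : ∀ i < q, b' i = b i := fun i hi => dif_neg (by omega)
  have hbD : ∀ e : Fin (d F), b' (q + e) = D e := fun e => by
    have := e.2
    simp only [b']
    rw [dif_pos ⟨by omega, by omega⟩]
    congr 1
    exact Fin.ext (by simp)
  let a' : ℕ → ℕ → K F := fun j i => if j = s then ∑ l, h i l * c l else a j i
  refine ⟨s + 1, a', b', fun i hi => (hb' i (by omega)).trans (h1 i hi), ?_,
    fun i => Sum.elim (fun l => if i < q then h i l else 0) (fun e => if i = q + e then 1 else 0), ?_⟩
  · intro j hj
    rcases Nat.lt_succ_iff_lt_or_eq.1 hj with hj | rfl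
    · have := (h2.congr (W' := b') fun i hi => (hb' i hi).symm) j hj
      simp only [a', if_neg hj.ne]
      exact this
    · simp only [a', if_pos]
      rw [← hq]
      have e1 : (fun e : Fin (d F) => b' (q + e)) = D := funext hbD
      rw [e1, ← hD]
      simp only [h3, mono_sum, sm_sum, sum_sm, sm_mono_K]
      rw [Finset.sum_comm]
      refine Finset.sum_congr rfl fun l _ => Finset.sum_congr rfl fun i hi => ?_
      rw [hb' i (Finset.mem_range.1 hi)]
  · rw [hq']
    rintro (l | e)
    · simp only [Sum.elim_inl]
      rw [h3, ← Finset.sum_subset (Finset.range_mono (Nat.le_add_right q (d F)))]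
      · refine Finset.sum_congr rfl fun i hi => ?_
        have := Finset.mem_range.1 hi
        rw [if_pos this, hb' i this]
      · intro i _ hi
        rw [Finset.mem_range] at hi
        rw [if_neg hi, mono_zero, sm_zero]
    · simp only [Sum.elim_inr]
      rw [Finset.sum_eq_single (q + e)]
      · rw [if_pos rfl, mono_zero_one, sm_one, hbD]
      · intro i _ hi
        rw [if_neg hi, mono_zero, sm_zero]
      · intro hn
        exact absurd (Finset.mem_range.2 (by have := e.2; omega)) hn

theorem coeff_sm_mono (C : Fin k → R F) (c : K F) (v : Fin k) (i : ℕ) :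
    coeff (sm C (mono 0 c) v) i = coeff (C v) i * c := coeff_mul_K _ _ _

/-- The descent: as long as the constant coefficients are linearly dependent, one column is
replaced by `d` columns of smaller degree, and `∑ (d + 1)^(degree)` decreases. -/
theorem exists_saturation_aux (b₀ : ℕ → Fin k → R F) (m : ℕ) :
    ∀ (ι : Type) [Fintype ι] (C : ι → Fin k → R F) (w : ι → ℕ),
      (∀ l v, DegLT (C l v) (w l)) → ∑ l, (d F + 1) ^ w l ≤ m → Derivable n b₀ C →
      (∀ j < n, b₀ j ∈ Submodule.span (Rop F) (Set.range C)) →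
      ∃ (κ : Type) (_ : Fintype κ) (C' : κ → Fin k → R F), Derivable n b₀ C' ∧
        (∀ j < n, b₀ j ∈ Submodule.span (Rop F) (Set.range C')) ∧
        LinearIndependent (K F) fun l => coef0 (C' l) := by
  classical
  have hd := d_pos (F := F)
  induction m using Nat.strong_induction_on with
  | _ m ih =>
  intro ι _ C w hw hm hC hspan
  by_cases hli : LinearIndependent (K F) fun l => coef0 (C l)
  · exact ⟨ι, inferInstance, C, hC, hspan, hli⟩
  obtain ⟨c, hc0, l₁, hl₁⟩ := Fintype.not_linearIndependent_iff.1 hli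
  obtain ⟨l₀, hl₀, hmax⟩ := Finset.exists_max_image (Finset.univ.filter fun l => c l ≠ 0) w
    ⟨l₁, by simpa using hl₁⟩
  have hl₀ : c l₀ ≠ 0 := by simpa using hl₀
  have hmax : ∀ l, c l ≠ 0 → w l ≤ w l₀ := fun l hl => hmax l (by simpa using hl)
  -- the combination `T` of the columns has no constant coefficient
  set T : Fin k → R F := ∑ l, sm (C l) (mono 0 (c l)) with hT
  have hTc : ∀ v i, coeff (T v) i = ∑ l, coeff (C l v) i * c l := by
    intro v i
    rw [hT, Finset.sum_apply, coeff_sum]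
    simp only [coeff_sm_mono]
  have hT0 : ∀ v, coeff (T v) 0 = 0 := by
    intro v
    have := congrFun hc0 v
    rw [hTc]
    simpa [coef0, mul_comm] using this
  have hTd : ∀ v, DegLT (T v) (w l₀) := by
    intro v i hi
    rw [hTc]
    refine Finset.sum_eq_zero fun l _ => ?_
    by_cases hcl : c l = 0
    · rw [hcl, mul_zero]
    · rw [hw l v i ((hmax l hcl).trans hi), zero_mul]
  have hsum : ∑ l : {l // l ≠ l₀}, (d F + 1) ^ w l + (d F + 1) ^ w l₀ =
      ∑ l, (d F + 1) ^ w l := by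
    rw [← Finset.sum_erase_add _ _ (Finset.mem_univ l₀)]
    congr 1
    exact (Finset.sum_subtype _ (by simp) (fun l => (d F + 1) ^ w l)).symm
  -- the remaining columns together with `T` still span
  have hold : ∀ S : Submodule (Rop F) (Fin k → R F), (∀ l, l ≠ l₀ → C l ∈ S) → T ∈ S →
      C l₀ ∈ S := by
    intro S hS hTS
    have e1 : sm (C l₀) (mono 0 (c l₀)) =
        T - ∑ l ∈ Finset.univ.erase l₀, sm (C l) (mono 0 (c l)) := by
      rw [hT, ← Finset.sum_erase_add _ _ (Finset.mem_univ l₀), add_sub_cancel_left]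
    rw [← sm_mono_zero_inv (C l₀) hl₀, e1]
    refine S.smul_mem _ (S.sub_mem hTS (S.sum_mem fun l hl => S.smul_mem _ ?_))
    exact hS l (Finset.ne_of_mem_erase hl)
  rcases Nat.eq_zero_or_pos (w l₀) with hw0 | hwpos
  · have hT' : T = 0 := funext fun v => DegLT.eq_zero (by rw [← hw0]; exact hTd v)
    refine ih (∑ l : {l // l ≠ l₀}, (d F + 1) ^ w l) ?_ {l // l ≠ l₀} (fun l => C l)
      (fun l => w l) (fun l v => hw l v) le_rfl (hC.comp _) ?_
    · have : 0 < (d F + 1) ^ w l₀ := by positivity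
      omega
    · refine fun j hj => Submodule.span_le.2 ?_ (hspan j hj)
      rintro _ ⟨l, rfl⟩
      have hmem : ∀ l, l ≠ l₀ → C l ∈ Submodule.span (Rop F)
          (Set.range fun l : {l // l ≠ l₀} => C l) :=
        fun l hl => Submodule.subset_span ⟨⟨l, hl⟩, rfl⟩
      by_cases hl : l = l₀
      · rw [hl]; exact hold _ hmem (by rw [hT']; exact Submodule.zero_mem _)
      · exact hmem l hl
  · obtain ⟨N, hN⟩ : ∃ N, w l₀ = N + 1 := ⟨w l₀ - 1, by omega⟩
    choose D hD hDd using fun v => exists_tdiv (hT0 v) (N := N) (by rw [← hN]; exact hTd v)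
    have hTD : T = tsum F fun e v => D v e := by
      funext v
      rw [hD v, tsum, Finset.sum_apply]
      rfl
    refine ih (∑ l : {l // l ≠ l₀} ⊕ Fin (d F), (d F + 1) ^ (Sum.elim (fun l => w l.1)
      (fun _ => N) l)) ?_ ({l // l ≠ l₀} ⊕ Fin (d F)) (Sum.elim (fun l => C l.1) fun e v => D v e)
      (Sum.elim (fun l => w l.1) (fun _ => N)) ?_ le_rfl ?_ ?_
    · rw [Fintype.sum_sum_type]
      simp only [Sum.elim_inl, Sum.elim_inr, Finset.sum_const, Finset.card_univ, Fintype.card_fin,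
        smul_eq_mul]
      have : d F * (d F + 1) ^ N < (d F + 1) ^ (N + 1) := by
        rw [pow_succ', Nat.add_mul, one_mul]
        have : 0 < (d F + 1) ^ N := by positivity
        omega
      rw [hN] at hsum
      omega
    · rintro (l | e) v
      · exact hw l v
      · exact hDd v e
    · have := (hC.step c _ (hT.symm.trans hTD)).comp
        (Sum.map (Subtype.val : {l // l ≠ l₀} → ι) (id : Fin (d F) → Fin (d F)))
      convert this using 1
      funext l
      cases l <;> rfl
    · refine fun j hj => Submodule.span_le.2 ?_ (hspan j hj)
      rintro _ ⟨l, rfl⟩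
      set S := Submodule.span (Rop F) (Set.range (Sum.elim (fun l : {l // l ≠ l₀} => C l.1)
        fun e v => D v e))
      have hmem : ∀ l, l ≠ l₀ → C l ∈ S := fun l hl => Submodule.subset_span ⟨.inl ⟨l, hl⟩, rfl⟩
      by_cases hl : l = l₀
      · rw [hl]
        refine hold _ hmem ?_
        rw [hTD]
        exact S.sum_mem fun e _ => S.smul_mem _ (Submodule.subset_span ⟨.inr e, rfl⟩)
      · exact hmem l hl

/-- Saturation: by a run starting with given columns one finds columns with linearly independent
constant coefficients that span the given ones. -/
theorem exists_saturation (n : ℕ) (b₀ : ℕ → Fin k → R F) :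
    ∃ (n' : ℕ) (C : Fin n' → Fin k → R F), Derivable n b₀ C ∧
      (∀ j < n, ∃ G : Fin n' → R F, b₀ j = ∑ l, sm (C l) (G l)) ∧
      LinearIndependent (K F) fun l => coef0 (C l) := by
  classical
  choose N hN using fun (l : Fin n) (v : Fin k) => exists_degLT (b₀ l v)
  have hD : Derivable n b₀ (fun l : Fin n => b₀ l) := by
    refine ⟨0, 0, b₀, fun _ _ => rfl, fun j hj => absurd hj (Nat.not_lt_zero j),
      fun i l => if i = l then 1 else 0, fun l => ?_⟩
    rw [Finset.sum_eq_single (l : ℕ)]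
    · simp only [if_pos, mono_zero_one, sm_one]
    · intro i _ hi
      simp only [if_neg hi, mono_zero, sm_zero]
    · intro hn
      exact absurd (Finset.mem_range.2 (by have := l.2; omega)) hn
  obtain ⟨κ, _, C, h1, h2, h3⟩ := exists_saturation_aux b₀ _ (Fin n) (fun l => b₀ l)
    (fun l => ∑ v, N l v)
    (fun l v => (hN l v).mono (Finset.single_le_sum (f := fun v => N l v) (fun _ _ => Nat.zero_le _)
      (Finset.mem_univ v))) le_rfl hD
    (fun j hj => Submodule.subset_span ⟨⟨j, hj⟩, rfl⟩)
  let e := (Fintype.equivFin κ).symm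
  refine ⟨Fintype.card κ, C ∘ e, h1.comp e, fun j hj => ?_, h3.comp e e.injective⟩
  have := h2 j hj
  rw [← e.surjective.range_comp C, Submodule.mem_span_range_iff_exists_fun] at this
  obtain ⟨c, hc⟩ := this
  exact ⟨fun l => .op (c l), hc.symm⟩

end Saturation

/-! ### Square matrices with invertible constant part -/

section NonDeg

variable {k : ℕ}

/-- The square matrix with the columns `S l` has an invertible matrix of constant coefficients. -/
def NonDeg (S : Fin k → Fin k → R F) : Prop := LinearIndependent (K F) fun l => coef0 (S l)

/-- Linearly independent constant parts can be completed to an invertible constant part. -/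
theorem exists_nonDeg_extension {n' : ℕ} {C : Fin n' → Fin k → R F}
    (hC : LinearIndependent (K F) fun l => coef0 (C l)) :
    ∃ (hle : n' ≤ k) (S : Fin k → Fin k → R F), NonDeg S ∧ ∀ l, S (Fin.castLE hle l) = C l := by
  classical
  let b := Module.Basis.sumExtend hC
  have : Finite (Fin n' ⊕ Module.Basis.sumExtendIndex hC) := Module.Finite.finite_basis b
  have : Finite (Module.Basis.sumExtendIndex hC) := Finite.sum_right (Fin n')
  have := Fintype.ofFinite (Module.Basis.sumExtendIndex hC)
  have hcard := Module.finrank_eq_card_basis b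
  rw [Module.finrank_fin_fun, Fintype.card_sum, Fintype.card_fin] at hcard
  have hle : n' ≤ k := by omega
  let e : Fin k ≃ Fin n' ⊕ Module.Basis.sumExtendIndex hC :=
    (finCongr hcard).trans (finSumFinEquiv.symm.trans
      (Equiv.sumCongr (Equiv.refl _) (Fintype.equivFin _).symm))
  have he : ∀ l : Fin n', e (Fin.castLE hle l) = .inl l := by
    intro l
    have : finCongr hcard (Fin.castLE hle l) = Fin.castAdd _ l := Fin.ext rfl
    simp [e, this]
  refine ⟨hle, fun l => Sum.elim C (fun x v => mono 0 (b (.inr x) v)) (e l), ?_, fun l => ?_⟩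
  · have hb := b.linearIndependent.comp e e.injective
    have hbe : (fun l => coef0 (Sum.elim C (fun x v => mono 0 (b (.inr x) v)) (e l))) = b ∘ e := by
      funext l
      simp only [Function.comp]
      rcases e l with x | x
      · simp only [b, Module.Basis.sumExtend, Module.Basis.reindex_apply,
          Sum.elim_inl, Module.Basis.extend_apply_self]
        rfl
      · funext v
        simp [coef0, coeff_mono]
    unfold NonDeg
    rw [hbe]
    exact hb
  · simp only [he, Sum.elim_inl]

theorem coef0_sum_sm {κ : Type*} (t : Finset κ) (S : κ → Fin k → R F) (u : κ → R F) :
    coef0 (∑ l ∈ t, sm (S l) (u l)) = ∑ l ∈ t, coeff (u l) 0 • coef0 (S l) := by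
  funext v
  simp only [coef0, Finset.sum_apply, coeff_sum, Pi.smul_apply, smul_eq_mul]
  refine Finset.sum_congr rfl fun l _ => ?_
  rw [mul_comm, ← coeff_mul_zero]
  rfl

/-- A combination `S.u` without constant coefficients comes from `u` without constant
coefficients. -/
theorem NonDeg.coeff_eq_zero {S : Fin k → Fin k → R F} (hS : NonDeg S) {u : Fin k → R F}
    (h : coef0 (∑ l, sm (S l) (u l)) = 0) (l : Fin k) : coeff (u l) 0 = 0 := by
  rw [coef0_sum_sm] at h
  exact Fintype.linearIndependent_iff.1 hS _ h l

theorem NonDeg.exists_coef0_eq {S : Fin k → Fin k → R F} (hS : NonDeg S) (x : Fin k → K F) :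
    ∃ c : Fin k → K F, ∑ l, c l • coef0 (S l) = x := by
  have := hS.span_eq_top_of_card_eq_finrank' (by simp)
  have hx : x ∈ Submodule.span (K F) (Set.range fun l => coef0 (S l)) := by rw [this]; trivial
  exact (Submodule.mem_span_range_iff_exists_fun _).1 hx

theorem degLT_mul {r s : R F} {N N' : ℕ} (hr : DegLT r N) (hs : DegLT s N') :
    DegLT (r * s) (N + N') := by
  intro i hi
  rw [coeff_mul]
  refine Finset.sum_eq_zero fun j hj => ?_
  have := Finset.mem_range.1 hj
  by_cases hj' : N ≤ j
  · rw [hr j hj', zero_pow_d, zero_mul]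
  · rw [hs (i - j) (by omega), mul_zero]

theorem DegLT.sum {κ : Type*} {t : Finset κ} {f : κ → R F} {N : ℕ} (h : ∀ l ∈ t, DegLT (f l) N) :
    DegLT (∑ l ∈ t, f l) N := by
  intro i hi
  rw [coeff_sum]
  exact Finset.sum_eq_zero fun l hl => h l hl i hi

theorem DegLT.sub {r s : R F} {N : ℕ} (hr : DegLT r N) (hs : DegLT s N) : DegLT (r - s) N := by
  intro i hi
  rw [coeff_sub, hr i hi, hs i hi, sub_zero]

/-- The element of `R` of degree `< N` with given coefficients. -/
def ofVec {N : ℕ} (f : Fin N → K F) : R F := ∑ i : Fin N, mono (i : ℕ) (f i)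

theorem coeff_ofVec {N : ℕ} (f : Fin N → K F) (i : Fin N) : coeff (ofVec f) i = f i := by
  simp [ofVec, coeff_sum, coeff_mono, ← Fin.ext_iff]

theorem degLT_ofVec {N : ℕ} (f : Fin N → K F) : DegLT (ofVec f) N := by
  intro i hi
  simp only [ofVec, coeff_sum, coeff_mono]
  exact Finset.sum_eq_zero fun j _ => if_neg (by have := j.2; omega)

theorem ofVec_add {N : ℕ} (f g : Fin N → K F) : ofVec (f + g) = ofVec f + ofVec g := by
  simp [ofVec, mono_add, Finset.sum_add_distrib]

theorem ofVec_smul {N : ℕ} (a : K F) (f : Fin N → K F) :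
    ofVec (a • f) = ofVec f * mono 0 a := by
  simp [ofVec, Finset.sum_mul, mono_mul_mono, mul_comm]

/-- A nontrivial relation between `g` and the columns of `S`, by counting dimensions. -/
theorem exists_common_multiple (S : Fin k → Fin k → R F) (g : Fin k → R F) :
    ∃ (c : R F) (u : Fin k → R F), (c ≠ 0 ∨ ∃ l, u l ≠ 0) ∧ ∑ l, sm (S l) (u l) = sm g c := by
  choose NS hNS using fun l v => exists_degLT (S l v)
  choose Ng hNg using fun v => exists_degLT (g v)
  set E := (∑ l, ∑ v, NS l v) + ∑ v, Ng v with hE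
  have hS : ∀ l v, DegLT (S l v) E := by
    intro l v
    refine (hNS l v).mono ?_
    have h1 := Finset.single_le_sum (f := fun v => NS l v) (fun _ _ => Nat.zero_le _)
      (Finset.mem_univ v)
    have h2 := Finset.single_le_sum (f := fun l => ∑ v, NS l v) (fun _ _ => Nat.zero_le _)
      (Finset.mem_univ l)
    omega
  have hg : ∀ v, DegLT (g v) E := by
    intro v
    refine (hNg v).mono ?_
    have h1 := Finset.single_le_sum (f := fun v => Ng v) (fun _ _ => Nat.zero_le _)
      (Finset.mem_univ v)
    omega
  -- `k + 1` unknown elements of degree `< D` have more coefficients than the `k (E + D)` equations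
  set D := k * E + 1 with hD
  let Φ : ((Fin D → K F) × (Fin k → Fin D → K F)) →ₗ[K F] (Fin k → Fin (E + D) → K F) :=
    { toFun := fun p v i => coeff ((∑ l, sm (S l) (ofVec (p.2 l)) - sm g (ofVec p.1)) v) i
      map_add' := by
        intro p p'
        funext v i
        simp only [Prod.fst_add, Prod.snd_add, Pi.add_apply, ofVec_add, sm_add,
          Finset.sum_add_distrib, Pi.sub_apply, coeff_sub, coeff_add]
        ring
      map_smul' := by
        intro a p
        funext v i
        simp only [Prod.smul_fst, Prod.smul_snd, Pi.smul_apply, ofVec_smul, sm_mul,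
          RingHom.id_apply, ← sum_sm, ← sub_sm, coeff_sm_mono]
        rw [mul_comm]; rfl }
  have hker : LinearMap.ker Φ ≠ ⊥ := by
    apply LinearMap.ker_ne_bot_of_finrank_lt
    simp only [Module.finrank_prod, Module.finrank_pi_fintype, Module.finrank_self,
      Finset.sum_const, Finset.card_univ, Fintype.card_fin, smul_eq_mul, mul_one]
    rw [mul_add]; omega
  obtain ⟨p, hp, hp0⟩ := (Submodule.ne_bot_iff _).1 hker
  refine ⟨ofVec p.1, fun l => ofVec (p.2 l), ?_, ?_⟩
  · by_contra hcon
    push Not at hcon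
    apply hp0
    refine Prod.ext (funext fun i => ?_) (funext fun l => funext fun i => ?_)
    · rw [← coeff_ofVec p.1 i, hcon.1]; rfl
    · rw [← coeff_ofVec (p.2 l) i, hcon.2 l]; rfl
  · rw [← sub_eq_zero]
    funext v
    apply R_ext
    intro i
    by_cases hi : i < E + D
    · exact congrFun (congrFun (LinearMap.mem_ker.1 hp) v) ⟨i, hi⟩
    · have : DegLT ((∑ l, sm (S l) (ofVec (p.2 l)) - sm g (ofVec p.1)) v) (E + D) := by
        rw [Pi.sub_apply, Finset.sum_apply]
        exact DegLT.sub (DegLT.sum fun l _ => degLT_mul (hS l v) (degLT_ofVec _))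
          (degLT_mul (hg v) (degLT_ofVec _))
      exact this i (not_lt.1 hi)

theorem tsum_sm_comm {κ : Type*} (t : Finset κ) (S : κ → Fin k → R F)
    (f : κ → Fin (d F) → R F) :
    tsum F (fun e => ∑ l ∈ t, sm (S l) (f l e)) =
      ∑ l ∈ t, sm (S l) (∑ e, f l e * tE e) := by
  simp only [tsum, sum_sm, sm_sum, sm_mul]
  rw [Finset.sum_comm]

theorem tInj_fun : TInj F (Fin k → R F) := by
  intro f hf
  funext e v
  have : (fun e => f e v) = 0 := tInj_R _ (by
    have := congrFun hf v
    rw [tsum, Finset.sum_apply] at this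
    exact this)
  exact congrFun this e

/-- A common multiple can be divided by `t` until it is separable. -/
theorem NonDeg.exists_separable_multiple {S : Fin k → Fin k → R F} (hS : NonDeg S)
    (g : Fin k → R F) :
    ∃ (c : R F) (u : Fin k → R F), IsSeparable c ∧ ∑ l, sm (S l) (u l) = sm g c := by
  have key : ∀ (N : ℕ) (c : R F) (u : Fin k → R F), DegLT c N → (∀ l, DegLT (u l) N) →
      (c ≠ 0 ∨ ∃ l, u l ≠ 0) → ∑ l, sm (S l) (u l) = sm g c →
      ∃ (c : R F) (u : Fin k → R F), IsSeparable c ∧ ∑ l, sm (S l) (u l) = sm g c := by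
    intro N
    induction N with
    | zero =>
      rintro c u hc hu (h | ⟨l, h⟩) -
      · exact absurd hc.eq_zero h
      · exact absurd (hu l).eq_zero h
    | succ N ih =>
      intro c u hc hu hne h
      by_cases hc0 : coeff c 0 = 0
      · have hu0 : ∀ l, coeff (u l) 0 = 0 := by
          apply hS.coeff_eq_zero
          rw [h]
          funext v
          change coeff (g v * c) 0 = 0
          rw [coeff_mul_zero, hc0, mul_zero]
        obtain ⟨c', hc', hcd⟩ := exists_tdiv hc0 hc
        choose u' hu' hud using fun l => exists_tdiv (hu0 l) (hu l)
        have heq : ∀ e, ∑ l, sm (S l) (u' l e) = sm g (c' e) := by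
          have : tsum F (fun e => ∑ l, sm (S l) (u' l e)) = tsum F (fun e => sm g (c' e)) := by
            rw [tsum_sm_comm]
            simp only [← hu', h]
            rw [hc', sm_sum]
            simp only [tsum, sm_mul]
          exact congrFun (tInj_fun.eq this)
        have hne' : ∃ e, c' e ≠ 0 ∨ ∃ l, u' l e ≠ 0 := by
          by_contra hcon
          push Not at hcon
          rcases hne with hne | ⟨l, hne⟩
          · exact hne (by rw [hc']; simp [(hcon _).1])
          · exact hne (by rw [hu' l]; simp [(hcon _).2])
        obtain ⟨e, he⟩ := hne'
        exact ih (c' e) (fun l => u' l e) (hcd e) (fun l => hud l e) he (heq e)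
      · exact ⟨c, u, hc0, h⟩
  obtain ⟨c, u, hne, h⟩ := exists_common_multiple S g
  obtain ⟨N, hN⟩ := exists_degLT c
  choose Nu hNu using fun l => exists_degLT (u l)
  refine key (N + ∑ l, Nu l) c u (hN.mono (Nat.le_add_right _ _)) (fun l => (hNu l).mono ?_) hne h
  have h1 := Finset.single_le_sum (f := Nu) (fun _ _ => Nat.zero_le _) (Finset.mem_univ l)
  omega

end NonDeg

/-! ### Adjoining a solution of a square system -/

section Extension

variable {k : ℕ} {M : Type*} [AddCommGroup M] [Module (Rop F) M]

/-- The relations `(w.c, -S c)` that are divided out of `M ⊕ R^k` in order to adjoin the solution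
of `y.S = w`. -/
def adjoinRel (S : Fin k → Fin k → R F) (w : Fin k → M) :
    (Fin k → R F) →ₗ[Rop F] M × (Fin k → R F) where
  toFun c := (∑ l, sm (w l) (c l), -∑ l, sm (S l) (c l))
  map_add' c c' := by
    ext
    · simp [sm_add, Finset.sum_add_distrib]
    · simp [sm_add, Finset.sum_add_distrib, add_comm]
  map_smul' a c := by
    refine Prod.ext ?_ ?_
    · simp only [Pi.smul_apply, RingHom.id_apply, Prod.smul_fst, Finset.smul_sum]
      refine Finset.sum_congr rfl fun l _ => ?_
      exact sm_mul (w l) (c l) (.op a)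
    · change -∑ l, sm (S l) ((a • c) l) = a • -∑ l, sm (S l) (c l)
      rw [smul_neg, Finset.smul_sum]
      refine congrArg Neg.neg (Finset.sum_congr rfl fun l _ => ?_)
      exact sm_mul (S l) (c l) (.op a)

/-- The module generated by `M` and a solution `y` of `y.S = w`. -/
abbrev Adjoin (S : Fin k → Fin k → R F) (w : Fin k → M) : Type _ :=
  (M × (Fin k → R F)) ⧸ LinearMap.range (adjoinRel S w)

variable (S : Fin k → Fin k → R F) (w : Fin k → M)

/-- The embedding of `M`. -/
def toAdjoin : M →ₗ[Rop F] Adjoin S w :=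
  (LinearMap.range (adjoinRel S w)).mkQ ∘ₗ LinearMap.inl _ _ _

/-- The adjoined solution. -/
def adjoinSol (v : Fin k) : Adjoin S w :=
  (LinearMap.range (adjoinRel S w)).mkQ (0, Pi.single v 1)

variable {S w}

theorem sum_single_sm (r : Fin k → R F) :
    ∑ v, sm (Pi.single v (1 : R F) : Fin k → R F) (r v) = r := by
  funext i
  rw [Finset.sum_apply, Finset.sum_eq_single i]
  · change (Pi.single i (1 : R F) : Fin k → R F) i * r i = r i
    rw [Pi.single_eq_same, one_mul]
  · intro v _ hv
    change (Pi.single v (1 : R F) : Fin k → R F) i * r v = 0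
    rw [Pi.single_eq_of_ne hv.symm, zero_mul]
  · intro h
    exact absurd (Finset.mem_univ i) h

theorem sum_sm_single {N : Type*} [AddCommGroup N] [Module (Rop F) N] (f : Fin k → N)
    (l : Fin k) : ∑ i, sm (f i) ((Pi.single l (1 : R F) : Fin k → R F) i) = f l := by
  rw [Finset.sum_eq_single l]
  · rw [Pi.single_eq_same, sm_one]
  · intro i _ hi
    rw [Pi.single_eq_of_ne hi, sm_zero]
  · intro h
    exact absurd (Finset.mem_univ l) h

theorem adjoinSol_spec (l : Fin k) :
    ∑ v, sm (adjoinSol S w v) (S l v) = toAdjoin S w (w l) := by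
  have h1 : ∑ v, sm (adjoinSol S w v) (S l v) =
      (LinearMap.range (adjoinRel S w)).mkQ (0, S l) := by
    simp only [adjoinSol, ← map_sm, ← map_sum]
    congr 1
    ext1
    · simp only [Prod.fst_sum]
      exact Finset.sum_eq_zero fun v _ => zero_sm (M := M) (S l v)
    · simp only [Prod.snd_sum]
      exact sum_single_sm (S l)
  rw [h1, eq_comm]
  change Submodule.Quotient.mk (w l, 0) = Submodule.Quotient.mk (0, S l)
  rw [Submodule.Quotient.eq]
  refine ⟨Pi.single l 1, ?_⟩
  ext1
  · simpa [adjoinRel] using sum_sm_single w l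
  · simp [adjoinRel, sum_sm_single S l]

theorem exists_tsum_fun {r : Fin k → R F} (h : coef0 r = 0) :
    ∃ f : Fin (d F) → Fin k → R F, r = tsum F f := by
  have : ∀ v, ∃ f : Fin (d F) → R F, r v = ∑ e, f e * tE e := by
    intro v
    obtain ⟨N, hN⟩ := exists_degLT (r v)
    obtain ⟨f, hf, -⟩ := exists_tdiv (congrFun h v) (hN.mono (Nat.le_succ N))
    exact ⟨f, hf⟩
  choose f hf using this
  refine ⟨fun e v => f v e, funext fun v => ?_⟩
  rw [hf v, tsum, Finset.sum_apply]
  rfl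

theorem coef0_tsum (f : Fin (d F) → Fin k → R F) : coef0 (tsum F f) = 0 := by
  funext v
  rw [coef0, tsum, Finset.sum_apply]
  exact coeff_zero_sum_tE fun e => f e v

theorem coef0_neg (r : Fin k → R F) : coef0 (-r) = -coef0 r := by
  funext v; simp [coef0]

theorem coef0_add (r s : Fin k → R F) : coef0 (r + s) = coef0 r + coef0 s := by
  funext v; simp [coef0]

theorem tsum_prod {N : Type*} [AddCommGroup N] [Module (Rop F) N] (f : Fin (d F) → M × N) :
    tsum F f = (tsum F fun e => (f e).1, tsum F fun e => (f e).2) := by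
  ext
  · exact map_tsum (LinearMap.fst (Rop F) M N) f
  · exact map_tsum (LinearMap.snd (Rop F) M N) f

/-- The columns of a matrix with an invertible constant part are right linearly independent over
`R`: the coefficients of a relation can be divided by `t` again and again. -/
theorem NonDeg.eq_zero (hS : NonDeg S) {c : Fin k → R F} (hc : ∑ l, sm (S l) (c l) = 0) :
    c = 0 := by
  have h : ∀ (N : ℕ) (c : Fin k → R F), (∀ l, DegLT (c l) N) → ∑ l, sm (S l) (c l) = 0 →
      c = 0 := by
    intro N
    induction N with
    | zero => exact fun c hc _ => funext fun l => (hc l).eq_zero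
    | succ N ih =>
      intro c hc h
      have h0 := hS.coeff_eq_zero (u := c) (by rw [h]; rfl)
      choose c' hc' hcd using fun l => exists_tdiv (h0 l) (hc l)
      have hz : (fun e => ∑ l, sm (S l) (c' l e)) = 0 := by
        apply tInj_fun
        rw [tsum_sm_comm]
        simp only [← hc', h]
      have hc0 : ∀ e l, c' l e = 0 := fun e l =>
        congrFun (ih (fun l => c' l e) (fun l => hcd l e) (congrFun hz e)) l
      funext l
      rw [hc' l]
      simp [hc0]
  choose N hN using fun l => exists_degLT (c l)
  refine h (∑ l, N l) c (fun l => (hN l).mono ?_) hc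
  exact Finset.single_le_sum (f := N) (fun _ _ => Nat.zero_le _) (Finset.mem_univ l)

/-- `M` embeds into the extension, as the columns of `S` are independent. -/
theorem toAdjoin_injective (hS : NonDeg S) : Function.Injective (toAdjoin S w) := by
  rw [← LinearMap.ker_eq_bot, LinearMap.ker_eq_bot']
  intro m hm
  change Submodule.Quotient.mk (m, 0) = 0 at hm
  rw [Submodule.Quotient.mk_eq_zero] at hm
  obtain ⟨c, hc⟩ := hm
  have h2 : -∑ l, sm (S l) (c l) = 0 := congrArg Prod.snd hc
  have h1 : ∑ l, sm (w l) (c l) = m := congrArg Prod.fst hc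
  rw [← h1, hS.eq_zero (neg_eq_zero.1 h2)]
  simp [sm_zero]

/-- The extension is again `t`-decomposable. Since the constant part of `S` is invertible, the
relations can be used to remove the constant coefficients from the component in `R^k`, and
relations without constant coefficients are divisible by `t`. -/
theorem tDec_adjoin (hS : NonDeg S) (hM : TDec F M) : TDec F (Adjoin S w) := by
  set Q := LinearMap.range (adjoinRel S w)
  refine tDec_of ?_ ?_
  · intro f hf
    choose p hp using fun e => Q.mkQ_surjective (f e)
    have hfp : f = Q.mkQ ∘ p := funext fun e => (hp e).symm
    rw [hfp, ← map_tsum, Submodule.mkQ_apply, Submodule.Quotient.mk_eq_zero] at hf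
    obtain ⟨c, hc⟩ := hf
    rw [tsum_prod] at hc
    have h2 : -∑ l, sm (S l) (c l) = tsum F fun e => (p e).2 := congrArg Prod.snd hc
    have h1 : ∑ l, sm (w l) (c l) = tsum F fun e => (p e).1 := congrArg Prod.fst hc
    have hc0 := hS.coeff_eq_zero (u := c) (by
      rw [← neg_eq_zero, ← coef0_neg, h2, coef0_tsum])
    choose N hN using fun l => exists_degLT (c l)
    choose c' hc' hcd using fun l => exists_tdiv (hc0 l) ((hN l).mono (Nat.le_succ _))
    funext e
    rw [hfp, Function.comp, Submodule.mkQ_apply, Pi.zero_apply, Submodule.Quotient.mk_eq_zero]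
    refine ⟨fun l => c' l e, ?_⟩
    have e1 : (fun e => ∑ l, sm (w l) (c' l e)) = fun e => (p e).1 := by
      apply hM.tInj.eq
      rw [← h1]
      simp only [tsum, sum_sm]
      rw [Finset.sum_comm]
      refine Finset.sum_congr rfl fun l _ => ?_
      conv_rhs => rw [hc' l, sm_sum]
      simp only [sm_mul]
    have e2 : (fun e => -∑ l, sm (S l) (c' l e)) = fun e => (p e).2 := by
      apply tInj_fun.eq
      rw [← h2]
      have : (fun e => -∑ l, sm (S l) (c' l e)) = 0 - fun e => ∑ l, sm (S l) (c' l e) := by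
        funext e; simp
      rw [this, tsum_sub, tsum_zero, zero_sub, tsum_sm_comm]
      simp only [← hc']
    exact Prod.ext (congrFun e1 e) (congrFun e2 e)
  · intro x
    obtain ⟨⟨m, r⟩, rfl⟩ := Q.mkQ_surjective x
    obtain ⟨c, hc⟩ := hS.exists_coef0_eq (coef0 r)
    -- modulo the relations the constant coefficients of `r` can be removed
    set p := adjoinRel S w fun l => mono 0 (c l) with hp
    have hr : coef0 (r + p.2) = 0 := by
      rw [hp, coef0_add]
      change _ + coef0 (-∑ l, sm (S l) (mono 0 (c l))) = 0
      rw [coef0_neg, coef0_sum_sm, ← hc]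
      simp [coeff_mono]
    obtain ⟨f, hf⟩ := exists_tsum_fun hr
    obtain ⟨g, hg, -⟩ := hM (m + p.1)
    refine ⟨fun e => Q.mkQ (g e, f e), ?_⟩
    have : Q.mkQ (m, r) = Q.mkQ ((m, r) + p) := by
      rw [map_add, left_eq_add, Submodule.mkQ_apply, Submodule.Quotient.mk_eq_zero]
      exact ⟨_, rfl⟩
    rw [this]
    have h2 := map_tsum Q.mkQ fun e => (g e, f e)
    rw [tsum_prod] at h2
    simp only at h2
    rw [← hg, ← hf] at h2
    exact h2

end Extension

/-! ### A nonzero torsion-free model -/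

section TorsionFree

variable (F) in
/-- A separably closed field containing `K`, which is a right `R`-module through `x.t = x^d`. -/
def Om : Type u := SeparableClosure (LaurentSeries F)

instance : Field (Om F) := inferInstanceAs (Field (SeparableClosure (LaurentSeries F)))

instance : Algebra (LaurentSeries F) (Om F) :=
  inferInstanceAs (Algebra (LaurentSeries F) (SeparableClosure (LaurentSeries F)))

instance : IsSepClosed (Om F) :=
  inferInstanceAs (IsSepClosed (SeparableClosure (LaurentSeries F)))

instance : Algebra.IsSeparable (LaurentSeries F) (Om F) :=
  inferInstanceAs (Algebra.IsSeparable (LaurentSeries F) (SeparableClosure (LaurentSeries F)))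

variable (F) in
/-- The embedding of `K`. -/
def toOm : K F →+* Om F := (algebraMap (LaurentSeries F) (Om F)).comp (henselization F).subtype

theorem toOm_injective : Function.Injective (toOm F) := (toOm F).injective

theorem add_pow_dOm (n : ℕ) (a b : Om F) :
    (a + b) ^ (d F ^ n) = a ^ (d F ^ n) + b ^ (d F ^ n) := by
  obtain ⟨p, m, hp, hc, hd, -⟩ := exists_card_eq_pow (F := F)
  have : Fact p.Prime := ⟨hp⟩
  have : CharP (LaurentSeries F) p :=
    charP_of_injective_ringHom (f := (HahnSeries.C : F →+* HahnSeries ℤ F)) HahnSeries.C_injective p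
  have := charP_of_injective_algebraMap (algebraMap (LaurentSeries F) (Om F)).injective p
  rw [hd, ← pow_mul, add_pow_char_pow]

/-- The right action of `R` on the separably closed field, `x.(t^i a) = x^(d^i) a`. -/
def actOm (r : Rop F) (x : Om F) : Om F :=
  ∑ i ∈ supp (.op r), toOm F (coeff (.op r) i) * x ^ (d F ^ i)

theorem actOm_eq {r : R F} {N : ℕ} (h : DegLT r N) (x : Om F) :
    actOm r.unop x = ∑ i ∈ Finset.range N, toOm F (coeff r i) * x ^ (d F ^ i) := by
  refine Finset.sum_subset (fun i hi => ?_) fun i _ hi => ?_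
  · rw [Finset.mem_range]
    by_contra hc
    exact (mem_supp r i).1 hi (h i (not_lt.1 hc))
  · have : coeff r i = 0 := not_not.1 (mt (mem_supp r i).2 hi)
    exact (congrArg (fun a => toOm F a * x ^ (d F ^ i)) this).trans (by simp)

theorem actOm_add (r s : R F) (x : Om F) :
    actOm (r + s).unop x = actOm r.unop x + actOm s.unop x := by
  obtain ⟨N, hN⟩ := exists_degLT r
  obtain ⟨N', hN'⟩ := exists_degLT s
  have h1 := hN.mono (Nat.le_add_right N N')
  have h2 := hN'.mono (Nat.le_add_left N' N)
  rw [actOm_eq h1, actOm_eq h2, actOm_eq (N := N + N') fun i hi => by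
    rw [coeff_add, h1 i hi, h2 i hi, add_zero], ← Finset.sum_add_distrib]
  simp [add_mul]

theorem actOm_mono (i : ℕ) (a : K F) (x : Om F) :
    actOm (mono i a : R F).unop x = toOm F a * x ^ (d F ^ i) := by
  have h : DegLT (mono i a : R F) (i + 1) := fun j hj => by
    rw [coeff_mono, if_neg (by omega)]
  rw [actOm_eq h, Finset.sum_eq_single i]
  · rw [coeff_mono, if_pos rfl]
  · intro j _ hj
    rw [coeff_mono, if_neg hj.symm, map_zero, zero_mul]
  · intro hn
    exact absurd (Finset.self_mem_range_succ i) hn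

theorem actOm_zero (x : Om F) : actOm (0 : R F).unop x = 0 := by
  simpa using actOm_mono 0 (0 : K F) x

theorem actOm_add_right (r : R F) (x y : Om F) :
    actOm r.unop (x + y) = actOm r.unop x + actOm r.unop y := by
  obtain ⟨N, hN⟩ := exists_degLT r
  rw [actOm_eq hN, actOm_eq hN, actOm_eq hN, ← Finset.sum_add_distrib]
  simp [add_pow_dOm, mul_add]

theorem actOm_mul (r s : R F) (x : Om F) :
    actOm (r * s).unop x = actOm s.unop (actOm r.unop x) := by
  induction s using R_induction with
  | h0 => rw [mul_zero, actOm_zero, actOm_zero]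
  | hadd s s' h h' => rw [mul_add, actOm_add, actOm_add, h, h']
  | hm j b =>
    induction r using R_induction with
    | h0 => rw [zero_mul, actOm_zero, actOm_mono, zero_pow (d_pow_ne_zero j), mul_zero]
    | hadd r r' h h' => rw [add_mul, actOm_add, actOm_add, actOm_add_right, h, h']
    | hm i a =>
      rw [mono_mul_mono, actOm_mono, actOm_mono, actOm_mono, map_mul, map_pow, mul_pow, ← pow_mul,
        ← pow_add]
      ring

instance : Module (Rop F) (Om F) where
  smul r x := actOm r x
  one_smul x := by
    refine (actOm_mono 0 (1 : K F) x).trans ?_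
    simp
  mul_smul r s x := actOm_mul (.op s) (.op r) x
  smul_zero r := by
    have := actOm_add_right (.op r) (0 : Om F) 0
    rw [add_zero] at this
    exact left_eq_add.1 this
  smul_add r x y := actOm_add_right (.op r) x y
  add_smul r s x := actOm_add (.op r) (.op s) x
  zero_smul x := actOm_zero x

theorem sm_Om {r : R F} {N : ℕ} (h : DegLT r N) (x : Om F) :
    sm x r = ∑ i ∈ Finset.range N, toOm F (coeff r i) * x ^ (d F ^ i) := actOm_eq h x

theorem toOm_unif : toOm F (unif F) =
    algebraMap (LaurentSeries F) (Om F) (HahnSeries.single 1 1) := by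
  rw [← unif_val]; rfl

theorem tsum_Om (f : Fin (d F) → Om F) : tsum F f =
    ∑ e, f e ^ d F * algebraMap (LaurentSeries F) (Om F) (HahnSeries.single 1 1) ^ (e : ℕ) := by
  refine Finset.sum_congr rfl fun e _ => (actOm_mono 1 _ _).trans ?_
  rw [map_pow, toOm_unif, pow_one, mul_comm]

/-- `1, X, …, X^(d-1)` are a basis of the separable closure of `F((X))` over its `d`-th powers. -/
theorem tDec_Om : TDec F (Om F) := by
  obtain ⟨p, n, hp, hc, hd, hn⟩ := exists_card_eq_pow (F := F)
  have : Fact p.Prime := ⟨hp⟩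
  have : CharP (LaurentSeries F) p :=
    charP_of_injective_ringHom (f := (HahnSeries.C : F →+* HahnSeries ℤ F)) HahnSeries.C_injective p
  have : ExpChar (LaurentSeries F) p := ExpChar.prime hp
  refine tDec_of ?_ ?_
  · intro f hf
    rw [tsum_Om] at hf
    have := frobDecomp_unique_of_isSeparable (E := Om F) p n
      (HahnSeries.single 1 1 : LaurentSeries F) (hd ▸ laurent_frobDecomp_unique)
    rw [← hd] at this
    exact this f hf
  · intro x
    have := frobDecomp_of_isSeparable (E := Om F) p n (hd ▸ d_pos)
      (HahnSeries.single 1 1 : LaurentSeries F) (hd ▸ laurent_frobDecomp) x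
    rw [← hd] at this
    obtain ⟨c, hc⟩ := this
    exact ⟨c, by rw [tsum_Om]; exact hc⟩

/-- The additive polynomial `∑ a_i Y^(d^i)`. -/
def addPoly (N : ℕ) (r : R F) : Polynomial (Om F) :=
  ∑ i ∈ Finset.range N, Polynomial.C (toOm F (coeff r i)) * Polynomial.X ^ (d F ^ i)

theorem eval_addPoly {N : ℕ} {r : R F} (h : DegLT r N) (x : Om F) :
    (addPoly N r).eval x = sm x r := by
  rw [sm_Om h, addPoly, Polynomial.eval_finsetSum]
  simp

theorem natCast_d_Om : ((d F : ℕ) : Om F) = 0 := by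
  obtain ⟨p, m, hp, hc, hd, hm⟩ := exists_card_eq_pow (F := F)
  have : Fact p.Prime := ⟨hp⟩
  have : CharP (LaurentSeries F) p :=
    charP_of_injective_ringHom (f := (HahnSeries.C : F →+* HahnSeries ℤ F)) HahnSeries.C_injective p
  have := charP_of_injective_algebraMap (algebraMap (LaurentSeries F) (Om F)).injective p
  rw [hd, Nat.cast_pow, CharP.cast_eq_zero, zero_pow hm.ne']

theorem derivative_addPoly (N : ℕ) (r : R F) :
    (addPoly (N + 1) r).derivative = Polynomial.C (toOm F (coeff r 0)) := by
  rw [addPoly, Polynomial.derivative_sum, Finset.sum_range_succ']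
  have : ∀ i ∈ Finset.range N, Polynomial.derivative
      (Polynomial.C (toOm F (coeff r (i + 1))) * Polynomial.X ^ d F ^ (i + 1)) = 0 := by
    intro i _
    rw [Polynomial.derivative_C_mul_X_pow, Nat.cast_pow, natCast_d_Om,
      zero_pow (Nat.succ_ne_zero i),
      mul_zero, Polynomial.C_0, zero_mul]
  rw [Finset.sum_eq_zero this]
  simp

/-- For separable `s` the polynomial `∑ a_i Y^(d^i) - x` has the nonzero constant `a_0` as its
derivative, hence it has a root in a separably closed field. -/
theorem exists_sm_eq_Om {s : R F} (hs : IsSeparable s) (x : Om F) : ∃ y : Om F, sm y s = x := by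
  obtain ⟨N, hN⟩ := exists_degLT s
  have hN := hN.mono (Nat.le_succ N)
  set f := addPoly (N + 1) s - Polynomial.C x with hf
  have hd : f.derivative = Polynomial.C (toOm F (coeff s 0)) := by
    rw [hf, Polynomial.derivative_sub, derivative_addPoly, Polynomial.derivative_C, sub_zero]
  have h0 : toOm F (coeff s 0) ≠ 0 := fun h => hs (toOm_injective (h.trans (map_zero _).symm))
  have hsep : f.Separable := by
    rw [Polynomial.Separable, hd]
    refine ⟨0, Polynomial.C (toOm F (coeff s 0))⁻¹, ?_⟩
    rw [← Polynomial.C_mul, inv_mul_cancel₀ h0, zero_mul, zero_add, Polynomial.C_1]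
  have hdeg : f.degree ≠ 0 := by
    intro h
    rw [Polynomial.eq_C_of_degree_eq_zero h, Polynomial.derivative_C] at hd
    exact h0 (Polynomial.C_eq_zero.1 hd.symm)
  obtain ⟨y, hy⟩ := IsSepClosed.exists_root f hdeg hsep
  refine ⟨y, ?_⟩
  rwa [Polynomial.IsRoot, hf, Polynomial.eval_sub, Polynomial.eval_C, eval_addPoly hN,
    sub_eq_zero] at hy

theorem IsSeparable.mul {r s : R F} (hr : IsSeparable r) (hs : IsSeparable s) :
    IsSeparable (r * s) := by
  rw [IsSeparable, coeff_mul_zero]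
  exact mul_ne_zero hr hs

/-- The right Ore condition: `r.c ∈ s.R` for a separable `c`, for every separable `s`. -/
theorem exists_separable_ore {s : R F} (hs : IsSeparable s) (r : R F) :
    ∃ c u : R F, IsSeparable c ∧ s * u = r * c := by
  have hS : NonDeg fun (_ _ : Fin 1) => s := by
    refine LinearIndependent.of_subsingleton (0 : Fin 1) fun h => hs (congrFun h 0)
  obtain ⟨c, u, hc, h⟩ := hS.exists_separable_multiple fun _ => r
  refine ⟨c, u 0, hc, ?_⟩
  have h1 := congrFun h 0
  rw [Fin.sum_univ_one] at h1
  exact h1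

section Torsion

variable (F) (M : Type u) [AddCommGroup M] [Module (Rop F) M]

/-- The elements annihilated by a separable element of `R`. -/
def sepTorsion : Submodule (Rop F) M where
  carrier := {x | ∃ s : R F, IsSeparable s ∧ sm x s = 0}
  zero_mem' := ⟨1, by rw [IsSeparable, coeff_one, if_pos rfl]; exact one_ne_zero, zero_sm _⟩
  add_mem' := by
    rintro x y ⟨s, hs, hx⟩ ⟨s', hs', hy⟩
    obtain ⟨c, u, hc, h⟩ := exists_separable_ore hs s'
    refine ⟨s' * c, hs'.mul hc, ?_⟩
    rw [add_sm, sm_mul y, hy, ← h, sm_mul, hx, zero_sm, zero_sm, add_zero]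
  smul_mem' := by
    rintro r x ⟨s, hs, hx⟩
    obtain ⟨c, u, hc, h⟩ := exists_separable_ore hs (.op r)
    refine ⟨c, hc, ?_⟩
    change sm (sm x (.op r)) c = 0
    rw [← sm_mul, ← h, sm_mul, hx, zero_sm]

variable {F M}

theorem exists_mul_tE {r : R F} (h : coeff r 0 = 0) :
    ∃ f : Fin (d F) → R F, r = ∑ e, f e * tE e := by
  obtain ⟨N, hN⟩ := exists_degLT r
  obtain ⟨f, hf, -⟩ := exists_tdiv h (hN.mono (Nat.le_succ N))
  exact ⟨f, hf⟩

/-- The `t`-coordinates of an element `x` with `x.s = 0`, `s` separable, are in `x.R`. -/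
theorem mem_sepTorsion_of_tsum (hM : TInj F M) {f : Fin (d F) → M}
    (h : tsum F f ∈ sepTorsion F M) (e : Fin (d F)) : f e ∈ sepTorsion F M := by
  obtain ⟨s, hs, hx⟩ := id h
  obtain ⟨g, hg⟩ := exists_mul_tE (r := 1 - s * mono 0 (coeff s 0)⁻¹) (by
    rw [coeff_sub, coeff_mul_zero, coeff_one, coeff_mono, if_pos rfl, if_pos rfl,
      mul_inv_cancel₀ hs, sub_self])
  have h1 : sm (tsum F f) (1 - s * mono 0 (coeff s 0)⁻¹) = tsum F f := by
    rw [sm_sub, sm_one, sm_mul, hx, zero_sm, sub_zero]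
  rw [hg, sm_sum] at h1
  have h2 : f = fun e => sm (tsum F f) (g e) := by
    apply hM.eq
    refine h1.symm.trans ?_
    simp only [sm_mul]
    rfl
  rw [h2]
  exact Submodule.smul_mem _ _ h

/-- In a module with unique `t`-decompositions all torsion is separable: an annihilator without
constant coefficient can be divided by `t`. -/
theorem mem_sepTorsion_of_sm_eq_zero (hM : TInj F M) {x : M} {r : R F} (hr : r ≠ 0)
    (h : sm x r = 0) : x ∈ sepTorsion F M := by
  obtain ⟨N, hN⟩ := exists_degLT r
  induction N generalizing r with
  | zero => exact absurd hN.eq_zero hr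
  | succ N ih =>
    by_cases h0 : coeff r 0 = 0
    · obtain ⟨f, hf, hfN⟩ := exists_tdiv h0 hN
      have hz : (fun e => sm x (f e)) = 0 := hM _ (by
        rw [hf, sm_sum] at h
        simpa [tsum, sm_mul] using h)
      obtain ⟨e, he⟩ : ∃ e, f e ≠ 0 := by
        by_contra hc
        push Not at hc
        exact hr (by rw [hf]; simp [hc])
      exact ih he (congrFun hz e) (hfN e)
    · exact ⟨r, h0, h⟩

/-- The quotient by the separable torsion stays `t`-decomposable, as the `t`-coordinates of a
torsion element are torsion elements. -/
theorem tDec_quotient (hM : TDec F M) : TDec F (M ⧸ sepTorsion F M) := by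
  set Q := sepTorsion F M
  refine tDec_of ?_ ?_
  · intro f hf
    choose p hp using fun e => Q.mkQ_surjective (f e)
    have hfp : f = Q.mkQ ∘ p := funext fun e => (hp e).symm
    rw [hfp, ← map_tsum, Submodule.mkQ_apply, Submodule.Quotient.mk_eq_zero] at hf
    funext e
    rw [hfp, Function.comp, Submodule.mkQ_apply, Pi.zero_apply, Submodule.Quotient.mk_eq_zero]
    exact mem_sepTorsion_of_tsum hM.tInj hf e
  · intro x
    obtain ⟨m, rfl⟩ := Q.mkQ_surjective x
    obtain ⟨f, hf, -⟩ := hM m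
    refine ⟨Q.mkQ ∘ f, ?_⟩
    rw [← map_tsum, ← hf]

theorem R_mul_ne_zero {r s : R F} (hr : r ≠ 0) (hs : IsSeparable s) : r * s ≠ 0 := by
  intro h
  have : ∃ i, coeff r i ≠ 0 := by
    by_contra hc
    push Not at hc
    exact hr (R_ext hc)
  classical
  have h1 := congrArg (fun q => coeff q (Nat.find this)) h
  simp only [coeff_mul, coeff_zero] at h1
  rw [Finset.sum_eq_single (Nat.find this)] at h1
  · rw [Nat.sub_self, pow_zero, pow_one] at h1
    exact mul_ne_zero (Nat.find_spec this) hs h1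
  · intro i hi hne
    have : i < Nat.find this := by have := Finset.mem_range.1 hi; omega
    rw [not_not.1 (Nat.find_min _ this), zero_pow_d, zero_mul]
  · intro hn
    exact absurd (Finset.self_mem_range_succ _) hn

end Torsion

theorem not_countable_laurentSeries : ¬ Countable (LaurentSeries F) := by
  intro h
  have hinj : Function.Injective fun f : ℕ → F =>
      HahnSeries.ofPowerSeries ℤ F (PowerSeries.mk f) := by
    intro f g hfg
    have := HahnSeries.ofPowerSeries_injective hfg
    funext n
    rw [← PowerSeries.coeff_mk n f, this, PowerSeries.coeff_mk]
  have := hinj.countable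
  obtain ⟨e, he⟩ := exists_surjective_nat (ℕ → F)
  refine Function.cantor_surjective (fun n => {i | e n i = 0}) fun S => ?_
  classical
  obtain ⟨n, hn⟩ := he fun i => if i ∈ S then 0 else 1
  refine ⟨n, Set.ext fun i => ?_⟩
  by_cases hi : i ∈ S <;> simp [hn, hi]

theorem countable_ratFunc : Countable (RatFunc F) := by
  have : Countable (Polynomial F) := by
    rw [← Cardinal.mk_le_aleph0_iff]
    exact Polynomial.cardinalMk_le_max.trans (max_le Cardinal.mk_le_aleph0 le_rfl)
  refine Function.Surjective.countable (f := fun p : Polynomial F × Polynomial F =>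
    algebraMap (Polynomial F) (RatFunc F) p.1 / algebraMap (Polynomial F) (RatFunc F) p.2) ?_
  intro x
  exact ⟨(x.num, x.denom), RatFunc.num_div_denom x⟩

open scoped RatFunc in
theorem countable_K : Countable (K F) := by
  have := countable_ratFunc (F := F)
  have h := Algebraic.countable (RatFunc F) (LaurentSeries F)
  have := h.to_subtype
  exact Function.Injective.countable (f := fun a : K F => (⟨a.1,
    (mem_separableClosure_iff.1 a.2).isIntegral.isAlgebraic⟩ :
      {x : LaurentSeries F | IsAlgebraic (RatFunc F) x}))
    fun a b h => K_ext (Subtype.mk.inj h)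

/-- The torsion elements are algebraic over the countable field `K`, but `F((X))` is uncountable. -/
theorem exists_not_mem_sepTorsion : ∃ x : Om F, x ∉ sepTorsion F (Om F) := by
  by_contra hcon
  push Not at hcon
  let _ : Algebra (K F) (Om F) := (toOm F).toAlgebra
  have := countable_K (F := F)
  have h : {x : Om F | IsAlgebraic (K F) x} = Set.univ := by
    refine Set.eq_univ_of_forall fun x => ?_
    obtain ⟨s, hs, hx⟩ := hcon x
    obtain ⟨N, hN⟩ := exists_degLT s
    refine ⟨∑ i ∈ Finset.range (N + 1), Polynomial.C (coeff s i) * Polynomial.X ^ (d F ^ i),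
      fun h0 => hs ?_, ?_⟩
    · have h1 := congrArg (fun p => Polynomial.coeff p 1) h0
      simp only [Polynomial.finsetSum_coeff, Polynomial.coeff_C_mul_X_pow,
        Polynomial.coeff_zero] at h1
      rw [Finset.sum_eq_single 0] at h1
      · simpa using h1
      · intro i _ hi
        rw [if_neg]
        have := Nat.one_lt_pow hi (two_le_d (F := F))
        omega
      · simp
    · rw [map_sum]
      simp only [map_mul, map_pow, Polynomial.aeval_C, Polynomial.aeval_X]
      rw [← hx, sm_Om (hN.mono (Nat.le_succ N))]
      rfl
  have hc := Algebraic.countable (K F) (Om F)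
  rw [h, Set.countable_univ_iff] at hc
  exact not_countable_laurentSeries
    ((algebraMap (LaurentSeries F) (Om F)).injective.countable)

variable (F) in
/-- There is a nonzero torsion-free `t`-decomposable module that is divisible by all separable
elements of `R`. -/
theorem exists_torsionFree_model : ∃ (N : Type u) (_ : AddCommGroup N) (_ : Module (Rop F) N),
    TDec F N ∧ (∀ s : R F, IsSeparable s → ∀ x : N, ∃ y, sm y s = x) ∧
      (∀ r : R F, r ≠ 0 → ∀ x : N, sm x r = 0 → x = 0) ∧ ∃ x : N, x ≠ 0 := by
  set Q := sepTorsion F (Om F) with hQ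
  refine ⟨Om F ⧸ Q, inferInstance, inferInstance, tDec_quotient tDec_Om, ?_, ?_, ?_⟩
  · intro s hs x
    obtain ⟨m, rfl⟩ := Q.mkQ_surjective x
    obtain ⟨y, rfl⟩ := exists_sm_eq_Om hs m
    exact ⟨Q.mkQ y, (map_sm _ _ _).symm⟩
  · intro r hr x hx
    obtain ⟨m, rfl⟩ := Q.mkQ_surjective x
    rw [← map_sm, Submodule.mkQ_apply, Submodule.Quotient.mk_eq_zero] at hx
    obtain ⟨s, hs, hx⟩ := hx
    rw [← sm_mul] at hx
    rw [Submodule.mkQ_apply, Submodule.Quotient.mk_eq_zero]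
    exact mem_sepTorsion_of_sm_eq_zero tDec_Om.tInj (R_mul_ne_zero hr hs) hx
  · obtain ⟨x, hx⟩ := exists_not_mem_sepTorsion (F := F)
    exact ⟨Q.mkQ x, fun h => hx ((Submodule.Quotient.mk_eq_zero _).1 h)⟩

end TorsionFree

/-! ### Henselian filtrations -/

section Hensel

/-- All coefficients of `r` have valuation at least `-β`. -/
def ValGe (β : ℕ) (r : R F) : Prop := ∀ i, ((-β : ℤ) : WithTop ℤ) ≤ val (coeff r i)

variable (F) in
/-- The consequences of the axioms of `T_hens` that are used for the filtration `P` of a right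
`R`-module, `⊤` being avoided as an index. -/
structure IsHens {M : Type*} [AddCommGroup M] [Module (Rop F) M] (P : ℤ → Set M) : Prop where
  zero_mem : ∀ γ, 0 ∈ P γ
  sub_mem : ∀ γ x y, x ∈ P γ → y ∈ P γ → x - y ∈ P γ
  anti : ∀ γ δ, γ ≤ δ → P δ ⊆ P γ
  exists_ne : ∀ γ, ∃ x ∈ P γ, x ≠ 0
  sm_mem : ∀ (γ δ : ℤ) (r : R F) (x : M), x ∈ P γ → (δ : WithTop ℤ) ≤ trop γ r → sm x r ∈ P δ
  regular : ∀ (γ δ : ℤ) (r : R F) (x : M), r ≠ 0 → ¬ IsJump γ r → x ∈ P γ → x ∉ P (γ + 1) →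
    trop γ r < δ → sm x r ∉ P δ
  coord_mem : ∀ (γ δ : ℤ) (f : Fin (d F) → M) (e : Fin (d F)), tsum F f ∈ P γ →
    d F * δ ≤ γ - (e : ℕ) → f e ∈ P δ
  hensel : ∀ (s : R F) (h v : ℤ) (x : M), IsSeparable s → IsH s h → val (coeff s 0) = v →
    x ∈ P (h + v) → x ≠ 0 → ∃! y, y ∈ P h ∧ sm y s = x

section Trop

theorem le_trop {γ δ : WithTop ℤ} {r : R F} :
    δ ≤ trop γ r ↔ ∀ i, coeff r i ≠ 0 → δ ≤ (d F ^ i) • γ + val (coeff r i) := by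
  simp only [trop, Finset.le_inf_iff, mem_supp]

theorem coeff_sub_coeff_zero (s : R F) (i : ℕ) :
    coeff (s - mono 0 (coeff s 0)) i = if i = 0 then 0 else coeff s i := by
  rw [coeff_sub, coeff_mono]
  split_ifs with h h' h'
  · rw [← h, sub_self]
  · exact absurd h.symm h'
  · exact absurd h'.symm h
  · rw [sub_zero]

/-- The condition defining `h(s)`: the constant term of `s` dominates strictly. -/
theorem trop_lt_iff {s : R F} {v : ℤ} (hv : val (coeff s 0) = v) (γ : ℤ) :
    trop γ s < trop γ (s - mono 0 (coeff s 0)) ↔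
      ∀ i ≠ 0, coeff s i ≠ 0 → ((γ + v : ℤ) : WithTop ℤ) <
        ((d F ^ i * γ : ℤ) : WithTop ℤ) + val (coeff s i) := by
  have h0 : coeff s 0 ≠ 0 := fun h => by rw [h, val_zero] at hv; exact absurd hv (by simp)
  have hle : trop γ s ≤ ((γ + v : ℤ) : WithTop ℤ) := by
    have := (le_trop (γ := γ) (r := s)).1 le_rfl 0 h0
    rwa [pow_zero, one_nsmul, hv, ← WithTop.coe_add] at this
  have hnsmul : ∀ i, (d F ^ i) • (γ : WithTop ℤ) = ((d F ^ i * γ : ℤ) : WithTop ℤ) := fun i => by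
    rw [nsmul_coe]; push_cast; rfl
  constructor
  · intro h i hi hc
    have h1 : trop γ (s - mono 0 (coeff s 0)) ≤ (d F ^ i) • (γ : WithTop ℤ) + val (coeff s i) := by
      have := (le_trop (γ := γ) (r := s - mono 0 (coeff s 0))).1 le_rfl i
      rw [coeff_sub_coeff_zero, if_neg hi] at this
      exact this hc
    rw [hnsmul] at h1
    -- the minimum defining `γ · s` is not attained at an `i > 0`
    have h2 : trop γ s = ((γ + v : ℤ) : WithTop ℤ) := by
      obtain ⟨j, hj, hje⟩ := Finset.exists_mem_eq_inf (supp s) ⟨0, (mem_supp s 0).2 h0⟩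
        fun i => (d F ^ i) • (γ : WithTop ℤ) + val (coeff s i)
      by_cases hj0 : j = 0
      · rw [trop, hje, hj0, pow_zero, one_nsmul, hv, ← WithTop.coe_add]
      · exfalso
        have := (le_trop (γ := γ) (r := s - mono 0 (coeff s 0))).1 le_rfl j
        rw [coeff_sub_coeff_zero, if_neg hj0] at this
        exact absurd (this ((mem_supp s j).1 hj)) (not_le.2 (by
          rw [← hje]; exact h))
    rw [h2] at h
    exact h.trans_le h1
  · intro h
    refine hle.trans_lt ?_
    rw [trop, Finset.lt_inf_iff (WithTop.coe_lt_top _)]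
    intro i hi
    rw [mem_supp, coeff_sub_coeff_zero] at hi
    rw [coeff_sub_coeff_zero, hnsmul]
    split_ifs at hi ⊢ with hi0
    · exact absurd rfl hi
    · exact h i hi0 hi

theorem not_isJump_of_trop_lt {s : R F} {γ : ℤ}
    (h : trop γ s < trop γ (s - mono 0 (coeff s 0))) : ¬ IsJump γ s := by
  rintro ⟨i, hi, j, hj, hij, h1, h2⟩
  have key : ∀ i ∈ supp s, i ≠ 0 → (d F ^ i) • (γ : WithTop ℤ) + val (coeff s i) ≠ trop γ s := by
    intro i hi hi0 he
    have := (le_trop (γ := γ) (r := s - mono 0 (coeff s 0))).1 le_rfl i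
    rw [coeff_sub_coeff_zero, if_neg hi0] at this
    exact absurd (this ((mem_supp s i).1 hi)) (not_le.2 (by rw [he]; exact h))
  rcases eq_or_ne i 0 with rfl | hi0
  · exact key j hj hij.symm h2
  · exact key i hi hi0 h1

theorem trop_lt_mono {s : R F} (hs : IsSeparable s) {γ γ' : ℤ} (hle : γ ≤ γ')
    (h : trop γ s < trop γ (s - mono 0 (coeff s 0))) :
    trop γ' s < trop γ' (s - mono 0 (coeff s 0)) := by
  obtain ⟨v, hv⟩ := exists_val_eq hs
  rw [trop_lt_iff hv] at h ⊢
  intro i hi hc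
  have := h i hi hc
  obtain ⟨w, hw⟩ := exists_val_eq hc
  rw [hw, ← WithTop.coe_add, WithTop.coe_lt_coe] at this ⊢
  have h1 : (1 : ℤ) ≤ d F ^ i := by exact_mod_cast Nat.one_le_pow i _ d_pos
  nlinarith

theorem trop_le_add {s : R F} {v γ : ℤ} (hv : val (coeff s 0) = v) :
    trop γ s ≤ ((γ + v : ℤ) : WithTop ℤ) := by
  have h0 : coeff s 0 ≠ 0 := fun h => by rw [h, val_zero] at hv; exact absurd hv (by simp)
  have := (le_trop (γ := γ) (r := s)).1 le_rfl 0 h0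
  rwa [pow_zero, one_nsmul, hv, ← WithTop.coe_add] at this

/-- `h(s)` exists for separable `s` of positive degree, and it is bounded in terms of the
valuations of the coefficients. -/
theorem exists_isH {s : R F} (hs : IsSeparable s) {β : ℕ} (hβ : ValGe β s)
    (h0 : val (coeff s 0) ≤ β) {i : ℕ} (hi : i ≠ 0) (hc : coeff s i ≠ 0) :
    ∃ h : ℤ, IsH s h ∧ h ≤ 2 * β + 1 := by
  obtain ⟨v, hv⟩ := exists_val_eq hs
  obtain ⟨w, hw⟩ := exists_val_eq hc
  have hvβ : v ≤ β := by rw [hv] at h0; exact_mod_cast h0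
  have hmem : trop (2 * β + 1 : ℤ) s < trop (2 * β + 1 : ℤ) (s - mono 0 (coeff s 0)) := by
    rw [trop_lt_iff hv]
    intro j hj hcj
    obtain ⟨u, hu⟩ := exists_val_eq hcj
    have := hβ j
    rw [hu] at this ⊢
    have hu : -(β : ℤ) ≤ u := by exact_mod_cast this
    rw [← WithTop.coe_add, WithTop.coe_lt_coe]
    have h2 : (2 : ℤ) ≤ d F ^ j := by
      have h3 : d F ^ 1 ≤ d F ^ j := Nat.pow_le_pow_right d_pos (Nat.one_le_iff_ne_zero.2 hj)
      have := two_le_d (F := F)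
      rw [pow_one] at h3
      exact_mod_cast this.trans h3
    nlinarith
  obtain ⟨h, hh, hmin⟩ := Int.exists_least_of_bdd
    (P := fun γ : ℤ => trop γ s < trop γ (s - mono 0 (coeff s 0))) ⟨-|v - w|, fun γ hγ => by
      rw [trop_lt_iff hv] at hγ
      have := hγ i hi hc
      rw [hw, ← WithTop.coe_add, WithTop.coe_lt_coe] at this
      have h2 : (2 : ℤ) ≤ d F ^ i := by
        have h3 : d F ^ 1 ≤ d F ^ i := Nat.pow_le_pow_right d_pos (Nat.one_le_iff_ne_zero.2 hi)
        have := two_le_d (F := F)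
        rw [pow_one] at h3
        exact_mod_cast this.trans h3
      by_contra hlt
      have h4 := le_abs_self (v - w)
      have h5 := neg_abs_le (v - w)
      nlinarith [abs_nonneg (v - w)]⟩ ⟨_, hmem⟩
  exact ⟨h, ⟨hh, fun γ hγ => hmin γ hγ⟩, hmin _ hmem⟩

end Trop

variable {M : Type*} [AddCommGroup M] [Module (Rop F) M] {P : ℤ → Set M}

namespace IsHens

variable (hP : IsHens F P)
include hP

theorem neg_mem {γ : ℤ} {x : M} (hx : x ∈ P γ) : -x ∈ P γ := by
  rw [← zero_sub]; exact hP.sub_mem _ _ _ (hP.zero_mem _) hx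

theorem add_mem {γ : ℤ} {x y : M} (hx : x ∈ P γ) (hy : y ∈ P γ) : x + y ∈ P γ := by
  rw [← sub_neg_eq_add]; exact hP.sub_mem _ _ _ hx (hP.neg_mem hy)

theorem sum_mem {ι : Type*} {t : Finset ι} {f : ι → M} {γ : ℤ} (h : ∀ i ∈ t, f i ∈ P γ) :
    ∑ i ∈ t, f i ∈ P γ :=
  Finset.sum_induction f (· ∈ P γ) (fun _ _ => hP.add_mem) (hP.zero_mem γ) h

/-- Multiplication by scalars with coefficients of valuation `≥ -β` loses at most `β`. -/
theorem sm_mem_of_valGe {β : ℕ} {r : R F} (hr : ValGe β r) {ε : ℤ} (hε : 0 ≤ ε) {x : M}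
    (hx : x ∈ P (ε + β)) : sm x r ∈ P ε := by
  refine hP.sm_mem _ _ r x hx (le_trop.2 fun i hi => ?_)
  obtain ⟨v, hv⟩ := exists_val_eq hi
  have := hr i
  rw [hv] at this
  have hvβ : -(β : ℤ) ≤ v := by exact_mod_cast this
  rw [hv, nsmul_coe, ← WithTop.coe_add, WithTop.coe_le_coe]
  have h1 : (1 : ℤ) ≤ d F ^ i := by exact_mod_cast Nat.one_le_pow i _ d_pos
  push_cast
  nlinarith

theorem coord_mem' {ε : ℤ} {f : Fin (d F) → M} (h : tsum F f ∈ P (d F * (ε + 1)))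
    (e : Fin (d F)) : f e ∈ P ε := by
  refine hP.coord_mem _ _ f e h ?_
  have : ((e : ℕ) : ℤ) < d F := by exact_mod_cast e.2
  linarith

/-- Uniqueness in the Hensel property also holds for the zero element. -/
theorem eq_zero_of_isH {s : R F} (hs : IsSeparable s) {h : ℤ} (hh : IsH s h) {y : M}
    (hy : y ∈ P h) (hys : sm y s = 0) : y = 0 := by
  obtain ⟨v, hv⟩ := exists_val_eq hs
  obtain ⟨x, hx, hx0⟩ := hP.exists_ne (h + v)
  obtain ⟨z, ⟨hz, hzs⟩, huniq⟩ := hP.hensel s h v x hs hh hv hx hx0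
  have := huniq (z + y) ⟨hP.add_mem hz hy, by rw [add_sm, hzs, hys, add_zero]⟩
  exact left_eq_add.1 this.symm

section Separable

variable {s : R F} {β : ℕ} (hs : IsSeparable s) (hβ : ValGe β s) (h0 : val (coeff s 0) ≤ β)
include hs hβ h0

/-- A separable `s` is injective on the ball of a radius that is explicit in the bound `β`. -/
theorem eq_zero_of_sm_eq_zero {y : M} (hy : y ∈ P (2 * β + 1)) (hys : sm y s = 0) : y = 0 := by
  by_cases h : ∃ i ≠ 0, coeff s i ≠ 0
  · obtain ⟨i, hi, hc⟩ := h
    obtain ⟨h, hh, hle⟩ := exists_isH hs hβ h0 hi hc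
    exact hP.eq_zero_of_isH hs hh (hP.anti _ _ hle hy) hys
  · push Not at h
    have e : s = mono 0 (coeff s 0) := R_ext fun i => by
      rw [coeff_mono]
      split_ifs with hi
      · rw [hi]
      · exact h i (Ne.symm hi)
    rw [e] at hys
    rw [← sm_mono_zero_inv y hs, hys, zero_sm]

/-- Near zero one can divide by a separable `s`, losing at most `β`. -/
theorem exists_sm_eq {ε : ℤ} (hε : 2 * β + 1 ≤ ε) {w : M} (hw : w ∈ P (ε + β)) :
    ∃ y ∈ P ε, sm y s = w := by
  obtain ⟨v, hv⟩ := exists_val_eq hs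
  have hvβ : v ≤ β := by rw [hv] at h0; exact_mod_cast h0
  by_cases h : ∃ i ≠ 0, coeff s i ≠ 0
  · obtain ⟨i, hi, hc⟩ := h
    obtain ⟨h, hh, hle⟩ := exists_isH hs hβ h0 hi hc
    by_cases hw0 : w = 0
    · exact ⟨0, hP.zero_mem _, by rw [zero_sm, hw0]⟩
    obtain ⟨y, ⟨hy, hys⟩, -⟩ := hP.hensel s h v w hs hh hv (hP.anti _ _ (by omega) hw) hw0
    refine ⟨y, ?_, hys⟩
    -- as long as `y ∈ P γ` with `h ≤ γ < ε`, the value of `y.s` shows that `y ∈ P (γ + 1)`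
    have key : ∀ n : ℕ, h + n ≤ ε → y ∈ P (h + n) := by
      intro n
      induction n with
      | zero => intro _; simpa using hy
      | succ n ih =>
        intro hn
        push_cast at hn ⊢
        have hyn := ih (by omega)
        by_contra hcon
        have htrop : trop (h + n : ℤ) s < trop (h + n : ℤ) (s - mono 0 (coeff s 0)) :=
          trop_lt_mono hs (by omega) hh.1
        refine hP.regular (h + n) (ε + β) s y (fun h => hs (by rw [h, coeff_zero]))
          (not_isJump_of_trop_lt htrop) hyn (by rwa [add_assoc]) ?_ (by rw [hys]; exact hw)
        refine (trop_le_add hv).trans_lt (WithTop.coe_lt_coe.2 ?_)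
        omega
    have := key (ε - h).toNat (by omega)
    rwa [Int.toNat_of_nonneg (by omega), add_sub_cancel] at this
  · push Not at h
    have e : s = mono 0 (coeff s 0) := R_ext fun i => by
      rw [coeff_mono]
      split_ifs with hi
      · rw [hi]
      · exact h i (Ne.symm hi)
    refine ⟨sm w (mono 0 (coeff s 0)⁻¹), hP.sm_mem _ _ _ _ hw (le_trop.2 fun i hi => ?_), ?_⟩
    · rw [coeff_mono] at hi ⊢
      split_ifs at hi ⊢ with hi0
      · subst hi0
        have h1 : val (coeff s 0) + val (coeff s 0)⁻¹ = 0 := by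
          rw [← val_mul, mul_inv_cancel₀ hs, val_one]
        obtain ⟨v', hv'⟩ := exists_val_eq (inv_ne_zero hs)
        rw [hv, hv', ← WithTop.coe_add] at h1
        have h1 : v + v' = 0 := by exact_mod_cast h1
        rw [pow_zero, one_nsmul, hv', ← WithTop.coe_add, WithTop.coe_le_coe]
        omega
      · exact absurd rfl hi
    · have := sm_mono_zero_inv w (inv_ne_zero hs)
      rw [inv_inv] at this
      exact (congrArg (sm _) e).trans this

end Separable

end IsHens

/-! ### Square systems -/

/-- If `S U` and `U V` are diagonal and `y.(S U) = w.U`, then `y.S - w` is annihilated by the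
diagonal of `U V`. -/
theorem sm_sub_eq_zero_of_diag {k : ℕ} {S U V : Fin k → Fin k → R F} {sd sd' : Fin k → R F}
    (hSU : ∀ w v : Fin k, ∑ l : Fin k, S l v * U w l = if v = w then sd w else 0)
    (hUV : ∀ w l : Fin k, ∑ v : Fin k, U v l * V w v = if l = w then sd' w else 0)
    {y w : Fin k → M} (hy : ∀ v : Fin k, sm (y v) (sd v) = ∑ l : Fin k, sm (w l) (U v l))
    (l : Fin k) : sm (∑ v : Fin k, sm (y v) (S l v) - w l) (sd' l) = 0 := by
  set z : Fin k → M := fun l => ∑ v : Fin k, sm (y v) (S l v) - w l with hz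
  have h1 : ∀ v : Fin k, ∑ l, sm (z l) (U v l) = 0 := by
    intro v
    simp only [hz, sub_sm, Finset.sum_sub_distrib, sum_sm, ← sm_mul]
    rw [Finset.sum_comm, ← hy v, sub_eq_zero]
    simp only [← sm_sum, hSU]
    rw [Finset.sum_eq_single v]
    · rw [if_pos rfl]
    · intro j _ hj
      rw [if_neg hj, sm_zero]
    · intro h; exact absurd (Finset.mem_univ v) h
  have h2 : ∑ j, sm (z j) (∑ v : Fin k, U v j * V l v) = 0 := by
    simp only [sm_sum, sm_mul]
    rw [Finset.sum_comm]
    exact Finset.sum_eq_zero fun v _ => by rw [← sum_sm, h1, zero_sm]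
  simp only [hUV] at h2
  rw [Finset.sum_eq_single l] at h2
  · rwa [if_pos rfl] at h2
  · intro j _ hj
    rw [if_neg hj, sm_zero]
  · intro h; exact absurd (Finset.mem_univ l) h

theorem nonDeg_of_diag {k : ℕ} {S U : Fin k → Fin k → R F} {sd : Fin k → R F}
    (hSU : ∀ w v : Fin k, ∑ l : Fin k, S l v * U w l = if v = w then sd w else 0)
    (hsd : ∀ v : Fin k, IsSeparable (sd v)) : NonDeg S := by
  -- the constant part of `S` has a right inverse, which is also a left inverse
  let A : Matrix (Fin k) (Fin k) (K F) := fun v l => coeff (S l v) 0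
  let B : Matrix (Fin k) (Fin k) (K F) := fun l w => coeff (U w l) 0 * (coeff (sd w) 0)⁻¹
  have hAB : A * B = 1 := by
    ext v w
    have h := congrArg (fun r => coeff r 0) (hSU w v)
    simp only [coeff_sum, coeff_mul_zero] at h
    rw [Matrix.mul_apply]
    simp only [A, B, ← mul_assoc, ← Finset.sum_mul]
    rw [h, Matrix.one_apply]
    split_ifs
    · exact mul_inv_cancel₀ (hsd w)
    · rw [coeff_zero, zero_mul]
  have hBA := mul_eq_one_comm.1 hAB
  refine Fintype.linearIndependent_iff.2 fun c hc l => ?_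
  have h1 : A.mulVec c = 0 := by
    funext v
    have := congrFun hc v
    simp only [Finset.sum_apply, Pi.smul_apply, smul_eq_mul, coef0] at this
    simpa [Matrix.mulVec, dotProduct, A, mul_comm] using this
  have h2 : B.mulVec (A.mulVec c) = c := by
    rw [Matrix.mulVec_mulVec, hBA, Matrix.one_mulVec]
  rw [← h2, h1, Matrix.mulVec_zero]
  rfl

/-- Hensel's lemma for square systems. -/
theorem IsHens.exists_solution (hP : IsHens F P) {k β : ℕ} {S U V : Fin k → Fin k → R F}
    {sd sd' : Fin k → R F}
    (hSU : ∀ w v : Fin k, ∑ l : Fin k, S l v * U w l = if v = w then sd w else 0)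
    (hUV : ∀ w l : Fin k, ∑ v : Fin k, U v l * V w v = if l = w then sd' w else 0)
    (hsd : ∀ v : Fin k, IsSeparable (sd v)) (hsd' : ∀ v : Fin k, IsSeparable (sd' v))
    (hSβ : ∀ l v : Fin k, ValGe β (S l v)) (hUβ : ∀ l v : Fin k, ValGe β (U l v))
    (hdβ : ∀ v : Fin k, ValGe β (sd v) ∧ val (coeff (sd v) 0) ≤ β)
    (hdβ' : ∀ v : Fin k, ValGe β (sd' v) ∧ val (coeff (sd' v) 0) ≤ β)
    {w : Fin k → M} (hw : ∀ l, w l ∈ P (5 * β + 1)) :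
    ∃ y : Fin k → M, (∀ v, y v ∈ P (3 * β + 1)) ∧
      ∀ l : Fin k, ∑ v : Fin k, sm (y v) (S l v) = w l := by
  have h1 : ∀ v : Fin k, ∃ y ∈ P (3 * β + 1), sm y (sd v) = ∑ l : Fin k, sm (w l) (U v l) := by
    intro v
    refine hP.exists_sm_eq (hsd v) (hdβ v).1 (hdβ v).2 (by omega) (hP.sum_mem fun l _ => ?_)
    exact hP.sm_mem_of_valGe (hUβ v l) (by positivity) (hP.anti _ _ (by omega) (hw l))
  choose y hy hys using h1
  refine ⟨y, hy, fun l => sub_eq_zero.1 ?_⟩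
  refine hP.eq_zero_of_sm_eq_zero (hsd' l) (hdβ' l).1 (hdβ' l).2 (hP.sub_mem _ _ _ ?_ ?_)
    (sm_sub_eq_zero_of_diag hSU hUV hys l)
  · exact hP.sum_mem fun v _ => hP.sm_mem_of_valGe (hSβ l v) (by positivity)
      (hP.anti _ _ (by omega) (hy v))
  · exact hP.anti _ _ (by omega) (hw l)

/-- The loss of precision in a run: each step divides the radius by `2d + 1`. Of
`(2d + 1) δ`, the scalars use up `β ≤ δ`, and the division by `t` needs `d (δ + 1) ≤ 2 d δ`. -/
theorem IsHens.run_mem (hP : IsHens F P) {n s β : ℕ} {a : ℕ → ℕ → K F} {W : ℕ → M}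
    (hW : Run n s a W) (ha : ∀ j i, ValGe β (mono 0 (a j i) : R F)) {ε : ℤ} (hβ : (β : ℤ) ≤ ε)
    (h1 : 1 ≤ ε) (h : ∀ i < n, W i ∈ P ((2 * d F + 1) ^ s * ε)) :
    ∀ i < n + d F * s, W i ∈ P ε := by
  have hd : (0 : ℤ) ≤ d F := Int.natCast_nonneg _
  have key : ∀ j ≤ s, ∀ i < n + d F * j, W i ∈ P ((2 * d F + 1) ^ (s - j) * ε) := by
    intro j
    induction j with
    | zero => simpa using h
    | succ j ih =>
      intro hj i hi
      have ih := ih (by omega)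
      set δ : ℤ := (2 * d F + 1) ^ (s - (j + 1)) * ε with hδ
      have hp : (1 : ℤ) ≤ (2 * d F + 1) ^ (s - (j + 1)) := one_le_pow₀ (by omega)
      have hδε : ε ≤ δ := by nlinarith
      have e : (2 * d F + 1 : ℤ) ^ (s - j) * ε = (2 * d F + 1) * δ := by
        rw [hδ, show s - j = (s - (j + 1)) + 1 by omega, pow_succ]; ring
      rw [e] at ih
      by_cases hin : i < n + d F * j
      · exact hP.anti _ _ (by nlinarith) (ih i hin)
      · rw [Nat.mul_succ] at hi
        have := hP.coord_mem' (ε := δ) (f := fun e => W (n + d F * j + e)) (by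
          rw [← hW j (by omega)]
          refine hP.sum_mem fun i hi => hP.sm_mem_of_valGe (ha j i) (by positivity) ?_
          exact hP.anti _ _ (by nlinarith) (ih i (Finset.mem_range.1 hi)))
          ⟨i - (n + d F * j), by omega⟩
        simpa [Nat.add_sub_cancel' (not_lt.1 hin)] using this
  simpa using key s le_rfl

end Hensel

/-! ### Elimination data -/

section Elim

variable (F) in
/-- A program together with linear combinations of the elements of its runs: `a` holds the
coefficients of the `s` steps, `b` the run on given columns, `h` the coefficients of the
combinations and `C` their values. -/
structure Sat where
  s : ℕ
  n' : ℕ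
  a : ℕ → ℕ → K F
  b : ℕ → ℕ → R F
  h : ℕ → ℕ → K F
  C : ℕ → ℕ → R F

/-- The columns `b` are the run on the `n` columns `B` of height `k`, and the columns `C` are the
combinations `h` of the columns `b`. -/
structure Sat.Valid (E : Sat F) (k n : ℕ) (B : ℕ → ℕ → R F) : Prop where
  init : ∀ i < n, ∀ v < k, E.b i v = B i v
  run : ∀ j < E.s, ∀ v < k, ∑ i ∈ Finset.range (n + d F * j), E.b i v * mono 0 (E.a j i) =
    ∑ e : Fin (d F), E.b (n + d F * j + e) v * tE e
  col : ∀ l < E.n', ∀ v < k,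
    E.C l v = ∑ i ∈ Finset.range (n + d F * E.s), E.b i v * mono 0 (E.h i l)

variable {M : Type*} [AddCommGroup M] [Module (Rop F) M]

/-- The `l`-th combination of the elements of a run in a module. -/
def Sat.comb (E : Sat F) (n : ℕ) (W : ℕ → M) (l : ℕ) : M :=
  ∑ i ∈ Finset.range (n + d F * E.s), sm (W i) (mono 0 (E.h i l))

theorem Sat.map_comb {N : Type*} [AddCommGroup N] [Module (Rop F) N] (f : M →ₗ[Rop F] N)
    (E : Sat F) (n : ℕ) (W : ℕ → M) (l : ℕ) : f (E.comb n W l) = E.comb n (fun i => f (W i)) l := by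
  simp only [Sat.comb, map_sm, map_sum]

theorem Sat.Valid.run_fun {E : Sat F} {k n : ℕ} {B : ℕ → ℕ → R F} (hE : E.Valid k n B)
    (y : Fin k → M) : Run n E.s E.a fun i => ∑ v : Fin k, sm (y v) (E.b i v) :=
  Run.linearComb Finset.univ (b := fun (v : Fin k) i => E.b i v) y fun v _ j hj =>
    hE.run j hj v v.2

/-- In a `t`-decomposable module, a linear combination of the columns `B` that starts a run
determines the run. -/
theorem Sat.Valid.run_eq {E : Sat F} {k n : ℕ} {B : ℕ → ℕ → R F} (hE : E.Valid k n B)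
    (hM : TInj F M) {y : Fin k → M} {W : ℕ → M} (hW : Run n E.s E.a W)
    (h : ∀ j < n, W j = ∑ v : Fin k, sm (y v) (B j v)) :
    ∀ i < n + d F * E.s, W i = ∑ v : Fin k, sm (y v) (E.b i v) :=
  hW.unique hM (hE.run_fun y) fun j hj => by
    rw [h j hj]
    exact Finset.sum_congr rfl fun v _ => by rw [hE.init j hj v v.2]

/-- The combinations of the elements of the run started by `y.B` are the values `y.C`. -/
theorem Sat.Valid.comb_eq {E : Sat F} {k n : ℕ} {B : ℕ → ℕ → R F} (hE : E.Valid k n B)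
    (hM : TInj F M) {y : Fin k → M} {W : ℕ → M} (hW : Run n E.s E.a W)
    (h : ∀ j < n, W j = ∑ v : Fin k, sm (y v) (B j v)) {l : ℕ} (hl : l < E.n') :
    E.comb n W l = ∑ v : Fin k, sm (y v) (E.C l v) := by
  rw [Sat.comb, Finset.sum_congr rfl fun i hi => by
    rw [hE.run_eq hM hW h i (Finset.mem_range.1 hi)] ]
  simp only [sum_sm]
  rw [Finset.sum_comm]
  refine Finset.sum_congr rfl fun v _ => ?_
  rw [hE.col l hl v v.2, sm_sum]
  exact Finset.sum_congr rfl fun i _ => (sm_mul _ _ _).symm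

theorem run_zero (n s : ℕ) (a : ℕ → ℕ → K F) : Run n s a fun _ => (0 : M) := by
  intro j _
  rw [Finset.sum_eq_zero fun i _ => zero_sm _]
  exact (tsum_zero).symm

/-- In a `t`-decomposable module every input starts a run. -/
theorem exists_run (hM : TDec F M) (n s : ℕ) (a : ℕ → ℕ → K F) (W₀ : ℕ → M) :
    ∃ W, (∀ i < n, W i = W₀ i) ∧ Run n s a W := by
  induction s with
  | zero => exact ⟨W₀, fun _ _ => rfl, fun j hj => absurd hj (Nat.not_lt_zero j)⟩
  | succ s ih =>
    obtain ⟨W, h0, hW⟩ := ih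
    set q := n + d F * s with hq
    obtain ⟨f, hf, -⟩ := hM (∑ i ∈ Finset.range q, sm (W i) (mono 0 (a s i)))
    let W' : ℕ → M := fun i => if hi : q ≤ i ∧ i < q + d F then f ⟨i - q, by omega⟩ else W i
    have hW' : ∀ i < q, W' i = W i := fun i hi => dif_neg (by omega)
    refine ⟨W', fun i hi => (hW' i (by omega)).trans (h0 i hi), fun j hj => ?_⟩
    rcases Nat.lt_succ_iff_lt_or_eq.1 hj with hj | rfl
    · exact hW.congr (fun i hi => (hW' i hi).symm) j hj
    · rw [← hq, Finset.sum_congr rfl fun i hi => by rw [hW' i (Finset.mem_range.1 hi)], hf]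
      congr 1
      funext e
      have := e.2
      simp only [W']
      rw [dif_pos ⟨by omega, by omega⟩]
      congr 1
      exact Fin.ext (by simp)

/-- Saturation, in terms of the data `Sat`. -/
theorem exists_sat (k n : ℕ) (B : ℕ → ℕ → R F) : ∃ E : Sat F, E.Valid k n B ∧
    (LinearIndependent (K F) fun l : Fin E.n' => coef0 fun v : Fin k => E.C l v) ∧
    ∃ G : ℕ → ℕ → R F, ∀ j < n, ∀ v < k,
      B j v = ∑ l ∈ Finset.range E.n', E.C l v * G l j := by
  obtain ⟨n', C, ⟨s, a, b, hb, hrun, h, hC⟩, hG, hli⟩ :=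
    exists_saturation n fun j (v : Fin k) => B j v
  choose G hG using hG
  let E : Sat F :=
    { s := s
      n' := n'
      a := a
      b := fun i v => if hv : v < k then b i ⟨v, hv⟩ else 0
      h := fun i l => if hl : l < n' then h i ⟨l, hl⟩ else 0
      C := fun l v => if hlv : l < n' ∧ v < k then C ⟨l, hlv.1⟩ ⟨v, hlv.2⟩ else 0 }
  refine ⟨E, ⟨fun i hi v hv => ?_, fun j hj v hv => ?_, fun l hl v hv => ?_⟩, ?_,
    fun l j => if hlj : l < n' ∧ j < n then G j hlj.2 ⟨l, hlj.1⟩ else 0, fun j hj v hv => ?_⟩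
  · simp only [E, dif_pos hv, hb i hi]
  · have := congrFun (hrun j hj) ⟨v, hv⟩
    rw [Finset.sum_apply, tsum, Finset.sum_apply] at this
    simp only [E, dif_pos hv]
    exact this
  · have := congrFun (hC ⟨l, hl⟩) ⟨v, hv⟩
    rw [Finset.sum_apply] at this
    have hl' : l < n' := hl
    simp only [E, dif_pos hv, dif_pos (And.intro hl' hv), dif_pos hl']
    exact this
  · have : (fun l : Fin E.n' => coef0 fun v : Fin k => E.C l v) = fun l => coef0 (C l) := by
      funext l
      congr 1
      funext v
      exact dif_pos ⟨l.2, v.2⟩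
    rw [this]
    exact hli
  · have := congrFun (hG j hj) ⟨v, hv⟩
    rw [Finset.sum_apply] at this
    rw [Finset.sum_range]
    refine this.trans (Finset.sum_congr rfl fun l _ => ?_)
    have h1 : E.C l v = C l ⟨v, hv⟩ := dif_pos ⟨l.2, hv⟩
    simp only [h1, dif_pos (And.intro l.2 hj)]
    rfl

variable (F) in
/-- The data for the elimination of the variables `y` from a system `w + y.B = 0`: the saturation
`C` of the columns `B`, completed to a square matrix with an invertible constant part, and
matrices `G`, `U`, `V` with `B = C G`, `C U` and `U V` diagonal. -/
structure Elim extends Sat F where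
  G : ℕ → ℕ → R F
  U : ℕ → ℕ → R F
  V : ℕ → ℕ → R F
  sd : ℕ → R F
  sd' : ℕ → R F

/-- The relations between the data. The diagonal entries are separable, so that `C` and `U` have
invertible constant parts. -/
structure Elim.Valid (E : Elim F) (k n : ℕ) (B : ℕ → ℕ → R F) : Prop
    extends E.toSat.Valid k n B where
  le : E.n' ≤ k
  span : ∀ j < n, ∀ v < k, B j v = ∑ l ∈ Finset.range E.n', E.C l v * E.G l j
  diag : ∀ w < k, ∀ v < k,
    ∑ l ∈ Finset.range k, E.C l v * E.U w l = if v = w then E.sd w else 0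
  diag' : ∀ w < k, ∀ l < k,
    ∑ v ∈ Finset.range k, E.U v l * E.V w v = if l = w then E.sd' w else 0
  sep : ∀ v < k, IsSeparable (E.sd v)
  sep' : ∀ v < k, IsSeparable (E.sd' v)

/-- The valuations of the coefficients are at least `-β`, and the constant coefficients on the
diagonals have valuation at most `β`. -/
structure Elim.Bounded (E : Elim F) (k β : ℕ) : Prop where
  a : ∀ j i, ValGe β (mono 0 (E.a j i) : R F)
  h : ∀ i l, ValGe β (mono 0 (E.h i l) : R F)
  C : ∀ l v, ValGe β (E.C l v)
  U : ∀ l v, ValGe β (E.U l v)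
  sd : ∀ v < k, ValGe β (E.sd v) ∧ val (coeff (E.sd v) 0) ≤ β
  sd' : ∀ v < k, ValGe β (E.sd' v) ∧ val (coeff (E.sd' v) 0) ≤ β

/-- The condition on the run `W` that eliminates the variables `y` from `W_j + y.B_j = 0`. -/
def Elim.Cond (E : Elim F) (n : ℕ) (W : ℕ → M) : Prop :=
  ∀ j < n, ∑ l ∈ Finset.range E.n', sm (E.comb n W l) (E.G l j) = W j

namespace Elim.Valid

variable {E : Elim F} {k n : ℕ} {B : ℕ → ℕ → R F} (hE : E.Valid k n B)
include hE

theorem diag_fin (w v : Fin k) :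
    ∑ l : Fin k, E.C l v * E.U w l = if v = w then E.sd w else 0 := by
  have := hE.diag w w.2 v v.2
  rw [Finset.sum_range] at this
  simpa only [← Fin.ext_iff] using this

theorem diag_fin' (w l : Fin k) :
    ∑ v : Fin k, E.U v l * E.V w v = if l = w then E.sd' w else 0 := by
  have := hE.diag' w w.2 l l.2
  rw [Finset.sum_range] at this
  simpa only [← Fin.ext_iff] using this

/-- The condition is necessary in every `t`-decomposable module. -/
theorem cond (hM : TInj F M) {W : ℕ → M} (hW : Run n E.s E.a W) {y : Fin k → M}
    (h : ∀ j < n, W j + ∑ v : Fin k, sm (y v) (B j v) = 0) : E.Cond n W := by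
  have h' : ∀ j < n, W j = ∑ v : Fin k, sm (-y v) (B j v) := by
    intro j hj
    rw [eq_neg_of_add_eq_zero_left (h j hj), ← Finset.sum_neg_distrib]
    simp only [neg_sm]
  intro j hj
  rw [h' j hj, Finset.sum_congr rfl fun l hl => by
    rw [hE.toValid.comb_eq hM hW h' (Finset.mem_range.1 hl)] ]
  simp only [sum_sm]
  rw [Finset.sum_comm]
  refine Finset.sum_congr rfl fun v _ => ?_
  rw [hE.span j hj v v.2, sm_sum]
  exact Finset.sum_congr rfl fun i _ => (sm_mul _ _ _).symm

/-- A solution of the square system solves the original system. -/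
theorem solves {W : ℕ → M} (hc : E.Cond n W) {y : Fin k → M}
    (hy : ∀ l < E.n', ∑ v : Fin k, sm (y v) (E.C l v) = -E.comb n W l) :
    ∀ j < n, W j + ∑ v : Fin k, sm (y v) (B j v) = 0 := by
  intro j hj
  have : ∑ v : Fin k, sm (y v) (B j v) = -W j := by
    rw [← hc j hj, ← Finset.sum_neg_distrib]
    rw [Finset.sum_congr rfl fun v _ => by rw [hE.span j hj v v.2, sm_sum] ]
    rw [Finset.sum_comm]
    refine Finset.sum_congr rfl fun l hl => ?_
    rw [← neg_sm, ← hy l (Finset.mem_range.1 hl), sum_sm]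
    exact Finset.sum_congr rfl fun i _ => sm_mul _ _ _
  rw [this, add_neg_cancel]

/-- The condition is sufficient in an extension of the module. -/
theorem exists_extension {M : Type u} [AddCommGroup M] [Module (Rop F) M] (hM : TDec F M)
    {W : ℕ → M} (hc : E.Cond n W) :
    ∃ (N : Type u) (_ : AddCommGroup N) (_ : Module (Rop F) N) (f : M →ₗ[Rop F] N),
      TDec F N ∧ Function.Injective f ∧ ∃ y : Fin k → N,
        ∀ j < n, f (W j) + ∑ v : Fin k, sm (y v) (B j v) = 0 := by
  have hS := nonDeg_of_diag hE.diag_fin fun v => hE.sep v v.2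
  let w : Fin k → M := fun l => -E.comb n W l
  refine ⟨Adjoin (fun (l v : Fin k) => E.C l v) w, inferInstance, inferInstance, toAdjoin _ w,
    tDec_adjoin hS hM, toAdjoin_injective hS, adjoinSol _ w, ?_⟩
  refine hE.solves (W := fun j => toAdjoin _ w (W j)) (fun j hj => ?_) fun l hl => ?_
  · simp only [← Sat.map_comb, ← hc j hj, map_sum, map_sm]
  · have := adjoinSol_spec (S := fun (l v : Fin k) => E.C l v) (w := w) ⟨l, hl.trans_le hE.le⟩
    rw [← Sat.map_comb, ← map_neg]
    exact this

/-- Near zero the condition is sufficient in henselian filtered modules. -/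
theorem exists_small {β : ℕ} (hβ : E.Bounded k β) {P : ℤ → Set M} (hP : IsHens F P) {W : ℕ → M}
    (hW : Run n E.s E.a W) (hc : E.Cond n W)
    (h : ∀ j < n, W j ∈ P ((2 * d F + 1) ^ E.s * (6 * β + 1))) :
    ∃ y : Fin k → M, (∀ v, y v ∈ P (3 * β + 1)) ∧
      ∀ j < n, W j + ∑ v : Fin k, sm (y v) (B j v) = 0 := by
  have hWβ := hP.run_mem hW hβ.a (ε := 6 * β + 1) (by omega) (by omega) h
  have hcomb : ∀ l, E.comb n W l ∈ P (5 * β + 1) := fun l =>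
    hP.sum_mem fun i hi => hP.sm_mem_of_valGe (hβ.h i l) (by positivity)
      (hP.anti _ _ (by omega) (hWβ i (Finset.mem_range.1 hi)))
  obtain ⟨y, hy, hyC⟩ := hP.exists_solution hE.diag_fin hE.diag_fin' (fun v => hE.sep v v.2)
    (fun v => hE.sep' v v.2) (fun l v => hβ.C l v) (fun l v => hβ.U l v) (fun v => hβ.sd v v.2)
    (fun v => hβ.sd' v v.2) (w := fun l => -E.comb n W l) fun l => hP.neg_mem (hcomb l)
  exact ⟨y, hy, hE.solves hc fun l hl => hyC ⟨l, hl.trans_le hE.le⟩⟩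

end Elim.Valid

/-- The unit vectors have separable multiples in the column module of `S`. -/
theorem NonDeg.exists_diag {k : ℕ} {S : Fin k → Fin k → R F} (hS : NonDeg S) :
    ∃ (U : Fin k → Fin k → R F) (sd : Fin k → R F), (∀ w, IsSeparable (sd w)) ∧
      ∀ w v, ∑ l, S l v * U w l = if v = w then sd w else 0 := by
  choose c u hc h using fun w : Fin k => hS.exists_separable_multiple (Pi.single w 1)
  refine ⟨u, c, hc, fun w v => ?_⟩
  have := congrFun (h w) v
  rw [Finset.sum_apply] at this
  refine Eq.trans this ?_
  change (Pi.single w (1 : R F) : Fin k → R F) v * c w = _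
  rw [Pi.single_apply]
  split_ifs
  · rw [one_mul]
  · rw [zero_mul]

/-- If `S U` is diagonal with separable entries, the constant part of `U` is invertible. -/
theorem nonDeg_of_diag_right {k : ℕ} {S U : Fin k → Fin k → R F} {sd : Fin k → R F}
    (hSU : ∀ w v : Fin k, ∑ l : Fin k, S l v * U w l = if v = w then sd w else 0)
    (hsd : ∀ v : Fin k, IsSeparable (sd v)) : NonDeg U := by
  refine Fintype.linearIndependent_iff.2 fun c hc => ?_
  have h1 : ∑ l, sm (S l) (∑ w, U w l * mono 0 (c w)) = fun v => sd v * mono 0 (c v) := by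
    funext v
    rw [Finset.sum_apply]
    change ∑ l, S l v * ∑ w, U w l * mono 0 (c w) = _
    simp only [Finset.mul_sum, ← mul_assoc]
    rw [Finset.sum_comm]
    simp only [← Finset.sum_mul, hSU]
    simp
  have h2 : coef0 (∑ l, sm (S l) (∑ w, U w l * mono 0 (c w))) = 0 := by
    rw [coef0_sum_sm]
    refine Finset.sum_eq_zero fun l _ => ?_
    have := congrFun hc l
    simp only [Finset.sum_apply, Pi.smul_apply, smul_eq_mul, coef0] at this
    rw [coeff_sum]
    simp only [coeff_mul_K]
    simp only [mul_comm (c _)] at this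
    rw [this, Pi.zero_apply, zero_smul]
  intro v
  have h3 := congrFun h2 v
  rw [h1] at h3
  have h4 : coeff (sd v) 0 * c v = 0 := by
    rw [← coeff_mul_K]; exact h3
  exact (mul_eq_zero.1 h4).resolve_left (hsd v)

/-- Every system has elimination data: `U` diagonalises the completed saturation, its constant part
is again invertible, and `V` diagonalises `U`. -/
theorem exists_elim (k n : ℕ) (B : ℕ → ℕ → R F) : ∃ E : Elim F, E.Valid k n B := by
  obtain ⟨E, hE, hli, G, hG⟩ := exists_sat k n B
  obtain ⟨hle, S, hS, hSC⟩ := exists_nonDeg_extension hli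
  obtain ⟨U, sd, hsd, hSU⟩ := hS.exists_diag
  have hU := nonDeg_of_diag_right hSU hsd
  obtain ⟨V, sd', hsd', hUV⟩ := hU.exists_diag
  let ext2 : (Fin k → Fin k → R F) → ℕ → ℕ → R F := fun f l v =>
    if h : l < k ∧ v < k then f ⟨l, h.1⟩ ⟨v, h.2⟩ else 0
  let ext1 : (Fin k → R F) → ℕ → R F := fun f v => if h : v < k then f ⟨v, h⟩ else 0
  have he2 : ∀ f l v (hl : l < k) (hv : v < k), ext2 f l v = f ⟨l, hl⟩ ⟨v, hv⟩ :=
    fun f l v hl hv => dif_pos ⟨hl, hv⟩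
  have he1 : ∀ f v (hv : v < k), ext1 f v = f ⟨v, hv⟩ := fun f v hv => dif_pos hv
  have hSC' : ∀ l < E.n', ∀ v < k, ext2 S l v = E.C l v := fun l hl v hv => by
    rw [he2 S l v (hl.trans_le hle) hv]
    exact congrFun (hSC ⟨l, hl⟩) ⟨v, hv⟩
  refine ⟨{ E with C := ext2 S, G := G, U := ext2 U, V := ext2 V, sd := ext1 sd, sd' := ext1 sd' },
    { init := hE.init, run := hE.run, col := fun l hl v hv => ?_, le := hle,
      span := fun j hj v hv => ?_, diag := fun w hw v hv => ?_, diag' := fun w hw v hv => ?_,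
      sep := fun v hv => ?_, sep' := fun v hv => ?_ }⟩
  · exact (hSC' l hl v hv).trans (hE.col l hl v hv)
  · refine (hG j hj v hv).trans (Finset.sum_congr rfl fun l hl => ?_)
    rw [← hSC' l (Finset.mem_range.1 hl) v hv]
  · have := hSU ⟨w, hw⟩ ⟨v, hv⟩
    simp only [Fin.mk.injEq] at this
    simp only [Finset.sum_range, he1 sd w hw]
    refine Eq.trans (Finset.sum_congr rfl fun l _ => ?_) this
    rw [he2 S l v l.2 hv, he2 U w l hw l.2]
  · have := hUV ⟨w, hw⟩ ⟨v, hv⟩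
    simp only [Fin.mk.injEq] at this
    simp only [Finset.sum_range, he1 sd' w hw]
    refine Eq.trans (Finset.sum_congr rfl fun l _ => ?_) this
    rw [he2 U l v l.2 hv, he2 V w l hw l.2]
  · simp only [he1 sd v hv]
    exact hsd ⟨v, hv⟩
  · simp only [he1 sd' v hv]
    exact hsd' ⟨v, hv⟩

/-- Modules without separable torsion that are divisible by separable elements are injective for
square systems. -/
theorem exists_solution_of_divisible {N : Type*} [AddCommGroup N] [Module (Rop F) N]
    (hdiv : ∀ s : R F, IsSeparable s → ∀ x : N, ∃ y, sm y s = x)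
    (htf : ∀ r : R F, r ≠ 0 → ∀ x : N, sm x r = 0 → x = 0)
    {k : ℕ} {S : Fin k → Fin k → R F} (hS : NonDeg S) (w : Fin k → N) :
    ∃ y : Fin k → N, ∀ l, ∑ v, sm (y v) (S l v) = w l := by
  obtain ⟨U, sd, hsd, hSU⟩ := hS.exists_diag
  obtain ⟨V, sd', hsd', hUV⟩ := (nonDeg_of_diag_right hSU hsd).exists_diag
  choose y hy using fun v => hdiv (sd v) (hsd v) (∑ l, sm (w l) (U v l))
  refine ⟨y, fun l => sub_eq_zero.1 (htf (sd' l) (fun h => hsd' l (by rw [h, coeff_zero])) _ ?_)⟩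
  exact sm_sub_eq_zero_of_diag hSU hUV hy l

end Elim

/-! ### Structures and modules -/

section Structures

open FirstOrder.Language

section Raw

variable {Ω : FirstOrder.Language.{0, 0}} {M : Type*} [((L F).sum Ω).Structure M]

variable (F Ω M) in
/-- The interpretation of `0`. -/
def opZero : M := Structure.funMap (L := (L F).sum Ω) (n := 0) (Sum.inl ModFunc.zero) ![]

variable (F Ω) in
/-- The interpretation of `-`. -/
def opNeg (x : M) : M := Structure.funMap (L := (L F).sum Ω) (n := 1) (Sum.inl ModFunc.neg) ![x]

variable (F Ω) in
/-- The interpretation of `+`. -/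
def opAdd (x y : M) : M :=
  Structure.funMap (L := (L F).sum Ω) (n := 2) (Sum.inl ModFunc.add) ![x, y]

variable (Ω) in
/-- The interpretation of the scalar `r`. -/
def opSmul (x : M) (r : R F) : M :=
  Structure.funMap (L := (L F).sum Ω) (n := 1) (Sum.inl (ModFunc.smul r)) ![x]

variable (F) in
/-- The interpretation of `λ_i`. -/
def opLam {M : Type*} [(Llam F).Structure M] (i : Fin (d F)) (x : M) : M :=
  Structure.funMap (L := Llam F) (n := 1) (Sum.inr (LamFunc.lam i)) ![x]

variable {α : Type*} (v : α → M)

theorem realize_tZero : (tZero : ((L F).sum Ω).Term α).realize v = opZero F Ω M :=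
  congrArg (Structure.funMap (L := (L F).sum Ω) (n := 0) (Sum.inl ModFunc.zero))
    (Subsingleton.elim _ _)

theorem realize_tNeg (x : ((L F).sum Ω).Term α) :
    (tNeg x).realize v = opNeg F Ω (x.realize v) :=
  congrArg (Structure.funMap (L := (L F).sum Ω) (n := 1) (Sum.inl ModFunc.neg))
    (funext fun i => by fin_cases i; rfl)

theorem realize_tAdd (x y : ((L F).sum Ω).Term α) :
    (tAdd x y).realize v = opAdd F Ω (x.realize v) (y.realize v) :=
  congrArg (Structure.funMap (L := (L F).sum Ω) (n := 2) (Sum.inl ModFunc.add))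
    (funext fun i => by fin_cases i <;> rfl)

theorem realize_tSmul (x : ((L F).sum Ω).Term α) (r : R F) :
    (tSmul x r).realize v = opSmul Ω (x.realize v) r :=
  congrArg (Structure.funMap (L := (L F).sum Ω) (n := 1) (Sum.inl (ModFunc.smul r)))
    (funext fun i => by fin_cases i; rfl)

theorem realize_tLam {M : Type*} [(Llam F).Structure M] {α : Type*} (v : α → M) (i : Fin (d F))
    (x : (Llam F).Term α) : (tLam i x).realize v = opLam F i (x.realize v) :=
  congrArg (Structure.funMap (L := Llam F) (n := 1) (Sum.inr (LamFunc.lam i)))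
    (funext fun i => by fin_cases i; rfl)

end Raw

variable (F) in
/-- The interpretation of the symbols of `L` agrees with the given module structure. -/
structure IsMod (Ω : FirstOrder.Language.{0, 0}) (M : Type*) [AddCommGroup M] [Module (Rop F) M]
    [((L F).sum Ω).Structure M] : Prop where
  zero : opZero F Ω M = 0
  neg : ∀ x : M, opNeg F Ω x = -x
  add : ∀ x y : M, opAdd F Ω x y = x + y
  smul : ∀ (r : R F) (x : M), opSmul Ω x r = sm x r

section Mod

variable {Ω : FirstOrder.Language.{0, 0}} {M : Type*} [AddCommGroup M] [Module (Rop F) M]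

theorem realize_tDecomp [(Llam F).Structure M] (h : IsMod F (lamLang F) M) {α : Type*} (v : α → M)
    (x : Fin (d F) → (Llam F).Term α) :
    (tDecomp x).realize v = tsum F fun i => (x i).realize v := by
  have key : ∀ l : List ((Llam F).Term α),
      (l.foldr tAdd tZero).realize v = (l.map fun t => t.realize v).sum := by
    intro l
    induction l with
    | nil => exact (realize_tZero v).trans h.zero
    | cons t l ih => rw [List.foldr_cons, realize_tAdd, h.add, ih, List.map_cons, List.sum_cons]
  rw [tDecomp, key, List.map_ofFn, List.sum_ofFn, tsum]
  refine Finset.sum_congr rfl fun i _ => ?_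
  exact (realize_tSmul v _ _).trans (h.smul _ _)

end Mod

theorem exists_module_of_Tlam {M : Type*} [(Llam F).Structure M] (h : M ⊨ Tlam F) :
    ∃ (_ : AddCommGroup M) (_ : Module (Rop F) M), IsMod F (lamLang F) M ∧ TDec F M ∧
      ∀ x : M, x = tsum F fun i => opLam F i x := by
  have hax : ∀ σ, TLamAx F σ → M ⊨ σ := fun σ hσ => h.realize_of_mem σ hσ
  have h1 := hax _ .add_assoc
  have h2 := hax _ .add_comm
  have h3 := hax _ .add_zero
  have h4 := hax _ .add_neg
  have h5 := fun r => hax _ (.add_smul r)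
  have h6 := fun r s => hax _ (.smul_add r s)
  have h7 := fun r s => hax _ (.smul_mul r s)
  have h8 := hax _ .smul_one
  have h9 := hax _ .decomp
  have h10 := fun i => hax _ (.decomp_unique i)
  simp [Sentence.Realize, Formula.Realize, realize_tAdd, realize_tZero, realize_tNeg,
    realize_tSmul, Fin.snoc, -MulOpposite.forall] at h1 h2 h3 h4 h5 h6 h7 h8
  let _ : Add M := ⟨opAdd F (lamLang F)⟩
  let _ : Zero M := ⟨opZero F (lamLang F) M⟩
  let _ : Neg M := ⟨opNeg F (lamLang F)⟩
  let gM : AddCommGroup M :=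
    { AddGroup.ofLeftAxioms h1 (fun a => (h2 _ _).trans (h3 a)) (fun a => (h2 _ _).trans (h4 a)) with
      add_comm := h2 }
  let mM : Module (Rop F) M :=
    { smul := fun r x => opSmul (lamLang F) x (.op r)
      one_smul := h8
      mul_smul := fun r s x => h7 (.op s) (.op r) x
      smul_zero := fun r => by
        have h := h5 (.op r) (0 : M) (0 : M)
        change opSmul (lamLang F) ((0 : M) + 0) (.op r) =
          opSmul (lamLang F) (0 : M) (.op r) + opSmul (lamLang F) (0 : M) (.op r) at h
        rw [add_zero] at h
        exact left_eq_add.1 h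
      smul_add := fun r x y => h5 (.op r) x y
      add_smul := fun r s x => h6 (.op r) (.op s) x
      zero_smul := fun x => by
        have h := h6 0 0 x
        change opSmul (lamLang F) x (0 + 0 : R F) =
          opSmul (lamLang F) x (0 : R F) + opSmul (lamLang F) x (0 : R F) at h
        rw [add_zero] at h
        exact left_eq_add.1 h }
  have hM : IsMod F (lamLang F) M := ⟨rfl, fun _ => rfl, fun _ _ => rfl, fun _ _ => rfl⟩
  have h9' : ∀ x : M, x = tsum F fun i => opLam F i x := by
    intro x
    have := h9
    simp only [Sentence.Realize, Formula.Realize, BoundedFormula.realize_all,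
      BoundedFormula.realize_bdEqual, realize_tDecomp hM, realize_tLam] at this
    exact this x
  refine ⟨gM, mM, hM, fun x => ⟨_, h9' x, fun f hf => funext fun i => ?_⟩, h9'⟩
  have h := h10 i
  simp only [Sentence.Realize, BoundedFormula.realize_alls, BoundedFormula.realize_imp,
      BoundedFormula.realize_bdEqual, realize_tDecomp hM, realize_tLam] at h
  have := h (Fin.snoc f x)
  simp at this
  exact this hf

end Structures

/-! ### The structure of a `t`-decomposable module -/

section ModuleStructure

open FirstOrder.Language

/-- The `L`-structure of a right `R`-module. -/
def modFun {M : Type*} [AddCommGroup M] [Module (Rop F) M] :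
    ∀ {n : ℕ}, ModFunc (R F) n → (Fin n → M) → M
  | _, .zero, _ => 0
  | _, .neg, x => -x 0
  | _, .add, x => x 0 + x 1
  | _, .smul r, x => sm (x 0) r

/-- The coordinates `λ_i(x)` in a `t`-decomposable module. -/
def TDec.coord {M : Type*} [AddCommGroup M] [Module (Rop F) M] (h : TDec F M) (x : M) :
    Fin (d F) → M := (h x).choose

theorem TDec.coord_spec {M : Type*} [AddCommGroup M] [Module (Rop F) M] (h : TDec F M) (x : M) :
    x = tsum F (h.coord x) := (h x).choose_spec.1

/-- The `L(λ)`-structure of a `t`-decomposable module. -/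
abbrev lamStructure {M : Type*} [AddCommGroup M] [Module (Rop F) M] (h : TDec F M) :
    (Llam F).Structure M where
  funMap := fun {n} f x => match n, f with
    | _, .inl g => modFun g x
    | _, .inr (.lam i) => h.coord (x 0) i
  RelMap := fun r => by rcases r with r | r <;> exact r.elim

variable {M : Type*} [AddCommGroup M] [Module (Rop F) M] [(Llam F).Structure M]

theorem models_Tlam (hM : IsMod F (lamLang F) M) (hT : TInj F M)
    (hl : ∀ x : M, x = tsum F fun i => opLam F i x) : M ⊨ Tlam F := by
  refine ⟨fun σ hσ => ?_⟩
  cases hσ with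
  | decomp =>
    simp only [Sentence.Realize, Formula.Realize, BoundedFormula.realize_all,
      BoundedFormula.realize_bdEqual, realize_tDecomp hM, realize_tLam]
    exact fun x => hl x
  | decomp_unique i =>
    simp only [Sentence.Realize, BoundedFormula.realize_alls, BoundedFormula.realize_imp,
      BoundedFormula.realize_bdEqual, realize_tDecomp hM, realize_tLam]
    intro xs hx
    simp only [Function.comp, Term.realize_var, Sum.elim_inr] at hx ⊢
    exact congrFun (hT.eq (hx.symm.trans (hl _))) i
  | add_assoc => simp [Sentence.Realize, Formula.Realize, realize_tAdd, hM.add, add_assoc]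
  | add_comm => simp [Sentence.Realize, Formula.Realize, realize_tAdd, hM.add, add_comm]
  | add_zero => simp [Sentence.Realize, Formula.Realize, realize_tAdd, realize_tZero, hM.add, hM.zero]
  | add_neg =>
    simp [Sentence.Realize, Formula.Realize, realize_tAdd, realize_tZero, realize_tNeg, hM.add,
      hM.zero, hM.neg]
  | add_smul r =>
    simp [Sentence.Realize, Formula.Realize, realize_tAdd, realize_tSmul, hM.add, hM.smul, add_sm]
  | smul_add r s =>
    simp [Sentence.Realize, Formula.Realize, realize_tAdd, realize_tSmul, hM.add, hM.smul, sm_add]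
  | smul_mul r s =>
    simp [Sentence.Realize, Formula.Realize, realize_tSmul, hM.smul, sm_mul]
  | smul_one =>
    simp [Sentence.Realize, Formula.Realize, realize_tSmul, hM.smul, sm_one]

theorem models_TfreeZero (hM : IsMod F (lamLang F) M) (hT : TInj F M)
    (hl : ∀ x : M, x = tsum F fun i => opLam F i x)
    (hdiv : ∀ s : R F, IsSeparable s → ∀ x : M, ∃ y, sm y s = x)
    (htf : ∀ r : R F, r ≠ 0 → ∀ x : M, sm x r = 0 → x = 0) (hne : ∃ x : M, x ≠ 0) :
    M ⊨ TfreeZero F := by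
  refine ⟨fun σ hσ => ?_⟩
  cases hσ with
  | free h =>
    cases h with
    | lam h => exact (models_Tlam hM hT hl).realize_of_mem _ h
    | divisible s hs =>
      simp only [Sentence.Realize, Formula.Realize, BoundedFormula.realize_all,
        BoundedFormula.realize_ex, BoundedFormula.realize_bdEqual, realize_tSmul, hM.smul]
      intro x
      obtain ⟨y, hy⟩ := hdiv s hs x
      exact ⟨y, hy.symm⟩
  | torsionFree r hr =>
    simp only [Sentence.Realize, Formula.Realize, BoundedFormula.realize_all,
      BoundedFormula.realize_imp, BoundedFormula.realize_bdEqual, realize_tSmul, hM.smul,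
      realize_tZero, hM.zero]
    exact fun x hx => htf r hr x hx
  | nonzero =>
    simp only [Sentence.Realize, Formula.Realize, BoundedFormula.realize_ex,
      BoundedFormula.realize_not, BoundedFormula.realize_bdEqual, realize_tZero, hM.zero]
    obtain ⟨x, hx⟩ := hne
    exact ⟨x, hx⟩

end ModuleStructure

/-! ### Positive quantifier-free formulas -/

section PosQF

open FirstOrder.Language

theorem IsPosQF.isQF {Λ : FirstOrder.Language} {α : Type*} {φ : Λ.Formula α} (h : IsPosQF φ) :
    BoundedFormula.IsQF φ := by
  induction h with
  | atomic h => exact h.isQF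
  | inf _ _ h₁ h₂ => exact h₁.inf h₂
  | sup _ _ h₁ h₂ => exact h₁.sup h₂

/-- Injective linear maps between `t`-decomposable modules preserve and reflect quantifier-free
formulas. -/
theorem realize_iff_of_injective {M N : Type*} [AddCommGroup M] [Module (Rop F) M]
    [AddCommGroup N] [Module (Rop F) N] [(Llam F).Structure M] [(Llam F).Structure N]
    (hM : IsMod F (lamLang F) M) (hN : IsMod F (lamLang F) N)
    (hlM : ∀ x : M, x = tsum F fun i => opLam F i x) (hTN : TInj F N)
    (hlN : ∀ x : N, x = tsum F fun i => opLam F i x) (f : M →ₗ[Rop F] N)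
    (hf : Function.Injective f) {α : Type*} {θ : (Llam F).Formula α} (hθ : IsPosQF θ)
    (x : α → M) : θ.Realize (fun i => f (x i)) ↔ θ.Realize x := by
  have hlam : ∀ i x, f (opLam F i x) = opLam F i (f x) := by
    intro i x
    have : (fun i => f (opLam F i x)) = fun i => opLam F i (f x) := by
      apply hTN.eq
      rw [← hlN (f x)]
      conv_rhs => rw [hlM x]
      rw [map_tsum]
      rfl
    exact congrFun this i
  let e : M ↪[Llam F] N :=
    { toFun := f
      inj' := hf
      map_fun' := by
        intro n g x
        match n, g with
        | _, .inl .zero =>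
          rw [show x = ![] from Subsingleton.elim _ _]
          exact (congrArg f hM.zero).trans ((map_zero f).trans (hN.zero.symm.trans
            (congrArg (Structure.funMap (L := Llam F) (n := 0) (Sum.inl ModFunc.zero))
              (Subsingleton.elim _ _))))
        | _, .inl .neg =>
          rw [show x = ![x 0] from by ext i; fin_cases i; rfl]
          refine (congrArg f (hM.neg _)).trans ((map_neg f _).trans ((hN.neg _).symm.trans
            (congrArg (Structure.funMap (L := Llam F) (n := 1) (Sum.inl ModFunc.neg)) ?_)))
          funext i; fin_cases i; rfl
        | _, .inl .add =>
          rw [show x = ![x 0, x 1] from by ext i; fin_cases i <;> rfl]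
          refine (congrArg f (hM.add _ _)).trans ((map_add f _ _).trans ((hN.add _ _).symm.trans
            (congrArg (Structure.funMap (L := Llam F) (n := 2) (Sum.inl ModFunc.add)) ?_)))
          funext i; fin_cases i <;> rfl
        | _, .inl (.smul r) =>
          rw [show x = ![x 0] from by ext i; fin_cases i; rfl]
          refine (congrArg f (hM.smul _ _)).trans ((map_sm f _ _).trans ((hN.smul _ _).symm.trans
            (congrArg (Structure.funMap (L := Llam F) (n := 1) (Sum.inl (ModFunc.smul r))) ?_)))
          funext i; fin_cases i; rfl
        | _, .inr (.lam i) =>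
          rw [show x = ![x 0] from by ext i; fin_cases i; rfl]
          refine (hlam i _).trans
            (congrArg (Structure.funMap (L := Llam F) (n := 1) (Sum.inr (LamFunc.lam i))) ?_)
          funext i; fin_cases i; rfl
      map_rel' := by
        intro n r
        rcases r with r | r <;> exact r.elim }
  have := hθ.isQF.realize_embedding e (v := x) (xs := default)
  rw [Subsingleton.elim (e ∘ (default : Fin 0 → M)) default] at this
  exact this

end PosQF

/-! ### The formula that eliminates the quantifiers -/

section Psi

open FirstOrder.Language

/-- A sum of terms. -/
def tSum {α : Type*} (l : List ((Llam F).Term α)) : (Llam F).Term α := l.foldr tAdd tZero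

theorem realize_tSum {M : Type*} [AddCommGroup M] [Module (Rop F) M] [(Llam F).Structure M]
    (h : IsMod F (lamLang F) M) {α : Type*} (v : α → M) (n : ℕ) (t : ℕ → (Llam F).Term α) :
    (tSum ((List.range n).map t)).realize v = ∑ i ∈ Finset.range n, (t i).realize v := by
  have key : ∀ l : List ((Llam F).Term α),
      (tSum l).realize v = (l.map fun t => t.realize v).sum := by
    intro l
    induction l with
    | nil => exact (realize_tZero v).trans h.zero
    | cons t l ih =>
      rw [tSum, List.foldr_cons, realize_tAdd, h.add, ← tSum, ih, List.map_cons, List.sum_cons]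
  rw [key, List.map_map, ← Fin.sum_univ_eq_sum_range, ← List.sum_ofFn, List.ofFn_eq_map,
    ← List.map_coe_finRange_eq_range, List.map_map]
  rfl

/-- Runs are given by terms of `L(λ)`. -/
theorem exists_run_terms {α : Type} (n s : ℕ) (a : ℕ → ℕ → K F) (t₀ : ℕ → (Llam F).Term α) :
    ∃ t : ℕ → (Llam F).Term α, (∀ i < n, t i = t₀ i) ∧
      ∀ (M : Type u) [AddCommGroup M] [Module (Rop F) M] [(Llam F).Structure M],
        IsMod F (lamLang F) M → (∀ x : M, x = tsum F fun i => opLam F i x) → ∀ v : α → M,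
          Run n s a fun i => (t i).realize v := by
  induction s with
  | zero => exact ⟨t₀, fun _ _ => rfl, fun M _ _ _ _ _ v j hj => absurd hj (Nat.not_lt_zero j)⟩
  | succ s ih =>
    obtain ⟨t, h0, ht⟩ := ih
    set q := n + d F * s with hq
    let t' : ℕ → (Llam F).Term α := fun i => if hi : q ≤ i ∧ i < q + d F then
      tLam ⟨i - q, by omega⟩ (tSum ((List.range q).map fun i => tSmul (t i) (mono 0 (a s i))))
      else t i
    have ht' : ∀ i < q, t' i = t i := fun i hi => dif_neg (by omega)
    refine ⟨t', fun i hi => (ht' i (by omega)).trans (h0 i hi), fun M _ _ _ hM hl v j hj => ?_⟩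
    rcases Nat.lt_succ_iff_lt_or_eq.1 hj with hj | rfl
    · exact (ht M hM hl v).congr (fun i hi => by rw [ht' i hi]) j hj
    · have h1 : ∑ i ∈ Finset.range q, sm ((t' i).realize v) (mono 0 (a j i)) =
          ∑ i ∈ Finset.range q, sm ((t i).realize v) (mono 0 (a j i)) :=
        Finset.sum_congr rfl fun i hi => by rw [ht' i (Finset.mem_range.1 hi)]
      rw [← hq, h1, hl (∑ i ∈ Finset.range q, _)]
      congr 1
      funext e
      have := e.2
      simp only [t']
      rw [dif_pos ⟨by omega, by omega⟩, realize_tLam, realize_tSum hM]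
      simp only [realize_tSmul, hM.smul, Nat.add_sub_cancel_left]

/-- `ψ` expresses the elimination condition on the run that starts with the elements `x.A_j`. -/
def IsPsi {m : ℕ} (E : Elim F) (n : ℕ) (A : ℕ → ℕ → R F) (ψ : (Llam F).Formula (Fin m)) : Prop :=
  ∀ (M : Type u) [AddCommGroup M] [Module (Rop F) M] [(Llam F).Structure M],
    IsMod F (lamLang F) M → TInj F M → (∀ x : M, x = tsum F fun i => opLam F i x) →
      ∀ (x : Fin m → M) (W : ℕ → M), (∀ j < n, W j = ∑ i : Fin m, sm (x i) (A j i)) →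
        Run n E.s E.a W → (ψ.Realize x ↔ E.Cond n W)

theorem exists_psi {m : ℕ} (E : Elim F) (n : ℕ) (A : ℕ → ℕ → R F) :
    ∃ ψ : (Llam F).Formula (Fin m), IsPosQF ψ ∧ IsPsi E n A ψ := by
  obtain ⟨t, h0, ht⟩ := exists_run_terms n E.s E.a fun j =>
    (tSum ((List.range m).map fun i => if h : i < m then
      tSmul (.var (Sum.inl ⟨i, h⟩) : (Llam F).Term (Fin m ⊕ Fin 0)) (A j i) else tZero))
  let eq : ℕ → (Llam F).Formula (Fin m) := fun j =>
    BoundedFormula.equal (tSum ((List.range E.n').map fun l =>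
      tSmul (tSum ((List.range (n + d F * E.s)).map fun i => tSmul (t i) (mono 0 (E.h i l))))
        (E.G l j))) (t j)
  refine ⟨((List.range n).map eq).foldr (· ⊓ ·) (BoundedFormula.equal tZero tZero), ?_, ?_⟩
  · generalize List.range n = l
    induction l with
    | nil => exact .atomic (.equal _ _)
    | cons j l ih => exact .inf (.atomic (.equal _ _)) ih
  · intro M _ _ _ hM hT hl x W hW hrun
    have hreal : ∀ l : List ℕ, Formula.Realize (((l.map eq).foldr (· ⊓ ·)
        (BoundedFormula.equal tZero tZero) : (Llam F).Formula (Fin m))) x ↔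
          ∀ j ∈ l, (eq j).Realize x := by
      intro l
      induction l with
      | nil => exact ⟨fun _ j hj => absurd hj List.not_mem_nil, fun _ => rfl⟩
      | cons j l ih =>
        rw [List.map_cons, List.foldr_cons, Formula.realize_inf, ih]
        simp
    rw [hreal]
    set v : Fin m ⊕ Fin 0 → M := Sum.elim x default with hv
    have hWt : ∀ i < n + d F * E.s, (t i).realize v = W i := by
      refine (ht M hM hl v).unique hT hrun fun j hj => ?_
      rw [h0 j hj, hW j hj, realize_tSum hM, Finset.sum_range]
      refine Finset.sum_congr rfl fun i _ => ?_
      rw [dif_pos i.2, realize_tSmul, hM.smul]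
      rfl
    have hcomb : ∀ l, ∑ i ∈ Finset.range (n + d F * E.s), sm ((t i).realize v) (mono 0 (E.h i l)) =
        E.comb n W l := fun l => Finset.sum_congr rfl fun i hi => by
      rw [hWt i (Finset.mem_range.1 hi)]
    have heq : ∀ j < n, (eq j).Realize x ↔
        ∑ l ∈ Finset.range E.n', sm (E.comb n W l) (E.G l j) = W j := by
      intro j hj
      change Term.realize v _ = Term.realize v _ ↔ _
      simp only [realize_tSum hM, realize_tSmul, hM.smul, hcomb, hWt j (by omega)]
    exact ⟨fun h j hj => (heq j hj).1 (h j (List.mem_range.2 hj)),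
      fun h j hj => (heq j (List.mem_range.1 hj)).2 (h j (List.mem_range.1 hj))⟩

end Psi

/-! ### Structures with a predicate -/

section Ball

open FirstOrder.Language

variable (F) in
/-- The reduct to `L(λ)`. -/
abbrev lamRed (M : Type*) [(LOlam F).Structure M] : (Llam F).Structure M := (ofLlam F).reduct M

variable (F) in
/-- The reduct to `L_𝓞`. -/
abbrev ballRed (M : Type*) [(LOlam F).Structure M] : (LO F).Structure M := (ofLO F).reduct M

variable (F) in
/-- The interpretation of `𝓞` in an `L_𝓞`-structure. -/
def ballSet (M : Type*) [(LO F).Structure M] : Set M :=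
  {x | Structure.RelMap (L := LO F) (n := 1) (Sum.inr BallRel.mem) ![x]}

/-- The set `P_γ`. -/
def ballP {M : Type*} [AddCommGroup M] [Module (Rop F) M] (O : Set M) : WithTop ℤ → Set M
  | ⊤ => {0}
  | (γ : ℤ) => {x | sm x (mono 0 (unif F ^ (-γ))) ∈ O}

theorem ballP_zero {M : Type*} [AddCommGroup M] [Module (Rop F) M] (O : Set M) :
    ballP (F := F) O ((0 : ℤ) : WithTop ℤ) = O := by
  ext x
  change sm x (mono 0 (unif F ^ (-0 : ℤ))) ∈ O ↔ _
  rw [neg_zero, zpow_zero, mono_zero_one, sm_one]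

section Realize

variable {M : Type*} [AddCommGroup M] [Module (Rop F) M] [(LOlam F).Structure M]

theorem isMod_ballRed (h : @IsMod F _ _ (lamLang F) M _ _ (lamRed F M)) :
    @IsMod F _ _ ballLang M _ _ (ballRed F M) :=
  let _ := lamRed F M
  let _ := ballRed F M
  ⟨h.zero, h.neg, h.add, h.smul⟩

variable (h : @IsMod F _ _ (lamLang F) M _ _ (lamRed F M))
include h

theorem realize_fP {α : Type} {n : ℕ} (γ : WithTop ℤ) (t : (Llam F).Term (α ⊕ Fin n))
    (v : α → M) (xs : Fin n → M) : (fP γ t).Realize v xs ↔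
      (let _ := lamRed F M; let _ := ballRed F M
       t.realize (Sum.elim v xs) ∈ ballP (F := F) (ballSet F M) γ) := by
  let _ := lamRed F M
  let _ := ballRed F M
  have : (ofLlam F).IsExpansionOn M := LHom.isExpansionOn_reduct (ofLlam F) M
  match γ with
  | ⊤ =>
    change ((ofLlam F).onTerm t).realize _ = ((ofLlam F).onTerm tZero).realize _ ↔ _
    rw [LHom.realize_onTerm, LHom.realize_onTerm, realize_tZero, h.zero]
    rfl
  | (γ : ℤ) =>
    change Structure.RelMap (L := LOlam F) (n := 1) (Sum.inr BallRel.mem) _ ↔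
      Structure.RelMap (L := LOlam F) (n := 1) (Sum.inr BallRel.mem) _
    apply iff_of_eq
    congr 1
    funext i
    fin_cases i
    change ((ofLlam F).onTerm (tSmul t (mono 0 (unif F ^ (-γ))))).realize _ = _
    rw [LHom.realize_onTerm, realize_tSmul, h.smul]
    rfl

theorem realize_fEq {α : Type} {n : ℕ} (t t' : (Llam F).Term (α ⊕ Fin n))
    (v : α → M) (xs : Fin n → M) : (fEq t t').Realize v xs ↔
      (let _ := lamRed F M; t.realize (Sum.elim v xs) = t'.realize (Sum.elim v xs)) := by
  let _ := lamRed F M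
  have : (ofLlam F).IsExpansionOn M := LHom.isExpansionOn_reduct (ofLlam F) M
  change ((ofLlam F).onTerm t).realize _ = ((ofLlam F).onTerm t').realize _ ↔ _
  rw [LHom.realize_onTerm, LHom.realize_onTerm]

theorem realize_ballPow {m : ℕ} (γ : ℤ) (x : Fin m → M) :
    (ballPow m γ : (LOlam F).Formula (Fin m)).Realize x ↔
      (let _ := ballRed F M; ∀ i, x i ∈ ballP (F := F) (ballSet F M) γ) := by
  let _ := lamRed F M
  rw [ballPow]
  unfold Formula.Realize
  rw [BoundedFormula.realize_iInf]
  simp only [realize_fP h]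
  rfl

end Realize

theorem exists_module_of_onTheory {M : Type*} [(LOlam F).Structure M]
    (h : M ⊨ (ofLlam F).onTheory (Tlam F)) :
    ∃ (_ : AddCommGroup M) (_ : Module (Rop F) M),
      @IsMod F _ _ (lamLang F) M _ _ (lamRed F M) ∧ TDec F M ∧
      (let _ := lamRed F M; ∀ x : M, x = tsum F fun i => opLam F i x) := by
  let _ := lamRed F M
  have : (ofLlam F).IsExpansionOn M := LHom.isExpansionOn_reduct (ofLlam F) M
  exact exists_module_of_Tlam ((LHom.onTheory_model _ _).1 h)

theorem onTheory_of_Thens {M : Type*} [(LOlam F).Structure M] (h : M ⊨ Thens F) :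
    M ⊨ (ofLlam F).onTheory (Tlam F) := by
  refine ⟨fun σ hσ => ?_⟩
  obtain ⟨τ, hτ, rfl⟩ := hσ
  exact h.realize_of_mem _ (.lam hτ)

theorem isHens_of_Thens {M : Type*} [AddCommGroup M] [Module (Rop F) M] [(LOlam F).Structure M]
    (h : @IsMod F _ _ (lamLang F) M _ _ (lamRed F M)) (hT : TInj F M)
    (hl : let _ := lamRed F M; ∀ x : M, x = tsum F fun i => opLam F i x) (hM : M ⊨ Thens F) :
    let _ := ballRed F M
    IsHens F fun γ : ℤ => ballP (F := F) (ballSet F M) γ := by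
  let _ := lamRed F M
  let _ := ballRed F M
  have hax : ∀ σ, THensAx F σ → M ⊨ σ := fun σ hσ => hM.realize_of_mem σ hσ
  have h1 := fun γ => hax _ (.ball_zero γ)
  have h2 := fun γ => hax _ (.ball_sub γ)
  have h3 := fun γ δ h => hax _ (.ball_le γ δ h)
  have h4 := fun γ δ h => hax _ (.ball_ne γ δ h)
  have h5 := fun γ δ r => hax _ (.ultrametric γ δ r)
  have h6 := fun γ r hr h => hax _ (.regular γ r hr h)
  have h7 := fun γ => hax _ (.lam_regular γ)
  have h8 := fun s hs γ hγ => hax _ (.hensel s hs γ hγ)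
  simp [Sentence.Realize, Formula.Realize, realize_tAdd, realize_tZero, realize_tNeg,
    realize_tSmul, realize_tLam, Fin.snoc, realize_fP h, realize_fEq h, h.zero, h.neg, h.add,
    h.smul, -MulOpposite.forall] at h1 h2 h3 h4 h5 h6 h7 h8
  have hanti : ∀ γ δ : WithTop ℤ, γ ≤ δ → ∀ x ∈ ballP (F := F) (ballSet F M) δ,
      x ∈ ballP (F := F) (ballSet F M) γ := by
    intro γ δ hle x hx
    rcases hle.eq_or_lt with rfl | hlt
    · exact hx
    · exact h3 γ δ hlt x hx
  exact
    { zero_mem := fun γ => h1 γ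
      sub_mem := fun γ x y hx hy => by rw [sub_eq_add_neg]; exact h2 γ x y hx hy
      anti := fun γ δ hle x hx => hanti γ δ (WithTop.coe_le_coe.2 hle) x hx
      exists_ne := fun γ => h4 γ ⊤ (WithTop.coe_lt_top γ)
      sm_mem := fun γ δ r x hx hle => by
        have := h5 γ ⊤ r x 0 hx (h1 ⊤)
        rw [add_zero, min_top_right] at this
        exact hanti _ _ hle _ this
      regular := fun γ δ r x hr hj hx hx' hlt hmem => by
        refine (h6 γ r hr hj x hx hx').2 (hanti _ δ ?_ _ hmem)
        obtain ⟨t, ht⟩ := WithTop.ne_top_iff_exists.1 hlt.ne_top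
        rw [← ht] at hlt ⊢
        exact_mod_cast hlt
      coord_mem := fun γ δ f e hf hle => by
        have h9 : f = fun i => opLam F i (tsum F f) := hT.eq (hl _)
        rw [h9]
        refine hanti _ _ ?_ _ ((h7 γ _).1 hf e)
        change (δ : WithTop ℤ) ≤ ((⌈((γ - (e : ℕ) : ℤ) : ℚ) / (d F : ℚ)⌉ : ℤ) : WithTop ℤ)
        rw [WithTop.coe_le_coe]
        have hd : (0 : ℚ) < d F := by exact_mod_cast d_pos (F := F)
        have h10 : (δ : ℚ) ≤ ((γ - (e : ℕ) : ℤ) : ℚ) / (d F : ℚ) := by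
          rw [le_div_iff₀ hd, mul_comm]
          exact_mod_cast hle
        exact_mod_cast h10.trans (Int.le_ceil _)
      hensel := fun s γ v x hs hγ hv hx hx0 => by
        obtain ⟨y, hy, huniq⟩ := h8 s hs γ hγ x (by rw [hv]; exact hx) hx0
        exact ⟨y, hy, fun z hz => huniq z hz.1 hz.2⟩ }

end Ball

/-! ### Linear forms of coded terms and formulas -/

section Codes

open FirstOrder.Language

variable (ν : ℕ → K F)

/-- The scalar coded by a list. -/
def ofCodes (l : List ℕ) : R F := ofFun l.length fun i => ν (l.getD i 0)

/-- The scalar with a given code. -/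
def scal (s : ℕ) : R F := ofCodes ν ((Encodable.decode (α := List ℕ) s).getD [])

theorem CodesScalar.eq_scal {s : ℕ} {r : R F} (h : CodesScalar ν s r) : r = scal ν s := by
  obtain ⟨l, rfl, hl⟩ := h
  apply R_ext
  intro i
  rw [hl, scal, Encodable.encodek, Option.getD_some, ofCodes, coeff_ofFun]
  split_ifs with hi
  · simp [List.getD, hi]
  · simp [List.getD, hi]

/-- The coefficient of the variable with the number `v` in the term with the code `c`, in terms of
the coefficients `T` for the smaller codes. -/
def linStep (v c : ℕ) (T : ℕ → R F) : R F :=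
  if c.unpair.1 = 0 then (if c.unpair.2 = v then 1 else 0)
  else if c.unpair.1 = 2 then -T c.unpair.2
  else if c.unpair.1 = 3 then T c.unpair.2.unpair.1 + T c.unpair.2.unpair.2
  else if c.unpair.1 = 4 then T c.unpair.2.unpair.2 * scal ν c.unpair.2.unpair.1
  else 0

/-- The coefficient of the variable with the number `v` in the term with the code `c`. -/
def lin (v c : ℕ) : R F := linStep ν v c fun i => if _h : i < c then lin v i else 0
termination_by c

theorem lt_pair_of_pos {a b : ℕ} (h : 0 < a) : b < Nat.pair a b :=
  (Nat.lt_add_of_pos_left h).trans_le (Nat.add_le_pair a b)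

/-- Terms are linear forms. -/
theorem CodesTerm.realize {α : Type} [Fintype α] {e : α → ℕ} (he : Function.Injective e) {c : ℕ}
    {t : (LO F).Term α} (h : CodesTerm ν e c t) {M : Type*} [AddCommGroup M] [Module (Rop F) M]
    [(LO F).Structure M] (hM : IsMod F ballLang M) (x : α → M) :
    t.realize x = ∑ a, sm (x a) (lin ν (e a) c) := by
  classical
  induction h with
  | var a =>
    rw [Finset.sum_eq_single a]
    · rw [lin, linStep, Nat.unpair_pair, if_pos rfl, if_pos rfl, sm_one]
      rfl
    · intro b _ hb
      rw [lin, linStep, Nat.unpair_pair, if_pos rfl, if_neg fun h => hb (he h).symm, sm_zero]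
    · exact fun h => absurd (Finset.mem_univ a) h
  | zero =>
    rw [realize_tZero, hM.zero]
    symm
    refine Finset.sum_eq_zero fun a _ => ?_
    rw [lin, linStep, Nat.unpair_pair]
    exact sm_zero _
  | @neg c t h ih =>
    rw [realize_tNeg, hM.neg, ih, ← Finset.sum_neg_distrib]
    refine Finset.sum_congr rfl fun a _ => ?_
    conv_rhs => rw [lin, linStep, Nat.unpair_pair]
    simp only [dif_pos (lt_pair_of_pos (a := 2) (b := c) (by omega))]
    exact (sm_neg _ _).symm
  | @add c c' t t' h h' ih ih' =>
    rw [realize_tAdd, hM.add, ih, ih', ← Finset.sum_add_distrib]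
    refine Finset.sum_congr rfl fun a _ => ?_
    have h1 := lt_pair_of_pos (a := 3) (b := Nat.pair c c') (by omega)
    conv_rhs => rw [lin, linStep, Nat.unpair_pair]
    simp only [Nat.unpair_pair, dif_pos ((Nat.left_le_pair c c').trans_lt h1),
      dif_pos ((Nat.right_le_pair c c').trans_lt h1)]
    exact (sm_add _ _ _).symm
  | @smul c s t r h h' ih =>
    rw [realize_tSmul, hM.smul, ih, sum_sm]
    refine Finset.sum_congr rfl fun a _ => ?_
    have h1 := lt_pair_of_pos (a := 4) (b := Nat.pair s c) (by omega)
    conv_rhs => rw [lin, linStep, Nat.unpair_pair]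
    simp only [Nat.unpair_pair, dif_pos ((Nat.right_le_pair s c).trans_lt h1), h'.eq_scal]
    exact (sm_mul _ _ _).symm

/-- The linear form that has to vanish, for the atomic formula with the code `c`. -/
def eqForm (v c : ℕ) : R F :=
  if c.unpair.1 = 0 then lin ν v c.unpair.2.unpair.1 - lin ν v c.unpair.2.unpair.2 else 0

/-- The linear form whose value has to be in `𝓞`, for the atomic formula with the code `c`. -/
def memForm (v c : ℕ) : R F := if c.unpair.1 = 0 then 0 else lin ν v c.unpair.2

theorem varCode_injective {m k : ℕ} : Function.Injective (varCode : Fin m ⊕ Fin k → ℕ) := by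
  rintro (i | i) (j | j) h <;> simp only [varCode] at h
  · exact congrArg _ (Fin.ext (by omega))
  · omega
  · omega
  · exact congrArg _ (Fin.ext (by omega))

variable {M : Type*} [AddCommGroup M] [Module (Rop F) M] [(LO F).Structure M]

theorem CodesAtomic.realize_eq {m k c : ℕ} {θ : (LO F).BoundedFormula (Fin m) k}
    (h : CodesAtomic ν c θ) (hM : IsMod F ballLang M) {x : Fin m → M} {y : Fin k → M}
    (hθ : θ.Realize x y) :
    ∑ i : Fin m, sm (x i) (eqForm ν (2 * i) c) + ∑ j : Fin k, sm (y j) (eqForm ν (2 * j + 1) c) =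
      0 := by
  cases h with
  | @equal c c' t t' h h' =>
    have h1 : t.realize (Sum.elim x y) = t'.realize (Sum.elim x y) := hθ
    rw [h.realize ν varCode_injective hM, h'.realize ν varCode_injective hM,
      Fintype.sum_sum_type, Fintype.sum_sum_type, ← sub_eq_zero] at h1
    simp only [eqForm, Nat.unpair_pair, if_pos, sm_sub, Finset.sum_sub_distrib]
    rw [← h1]
    simp only [Sum.elim_inl, Sum.elim_inr, varCode]
    abel
  | @mem c t h =>
    simp only [eqForm, Nat.unpair_pair, if_neg one_ne_zero, sm_zero, Finset.sum_const_zero,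
      add_zero]

theorem CodesAtomic.realize {m k c : ℕ} {θ : (LO F).BoundedFormula (Fin m) k}
    (h : CodesAtomic ν c θ) (hM : IsMod F ballLang M) {x : Fin m → M} {y : Fin k → M}
    (heq : ∑ i : Fin m, sm (x i) (eqForm ν (2 * i) c) +
      ∑ j : Fin k, sm (y j) (eqForm ν (2 * j + 1) c) = 0)
    (hmem : ∑ i : Fin m, sm (x i) (memForm ν (2 * i) c) +
      ∑ j : Fin k, sm (y j) (memForm ν (2 * j + 1) c) ∈ ballSet F M) :
    θ.Realize x y := by
  cases h with
  | @equal c c' t t' h h' =>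
    change t.realize (Sum.elim x y) = t'.realize (Sum.elim x y)
    rw [h.realize ν varCode_injective hM, h'.realize ν varCode_injective hM,
      Fintype.sum_sum_type, Fintype.sum_sum_type, ← sub_eq_zero]
    simp only [eqForm, Nat.unpair_pair, if_pos, sm_sub, Finset.sum_sub_distrib] at heq
    rw [← heq]
    simp only [Sum.elim_inl, Sum.elim_inr, varCode]
    abel
  | @mem c t h =>
    change Structure.RelMap (L := LO F) (n := 1) (Sum.inr BallRel.mem) _
    simp only [memForm, Nat.unpair_pair, if_neg one_ne_zero] at hmem
    have h1 : t.realize (Sum.elim x y) ∈ ballSet F M := by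
      rw [h.realize ν varCode_injective hM, Fintype.sum_sum_type]
      exact hmem
    have h2 : ![t.realize (Sum.elim x y)] = fun i => (![t] i).realize (Sum.elim x y) := by
      funext i; fin_cases i; rfl
    rw [← h2]
    exact h1

/-- The number of bound variables. -/
def numVar (c : ℕ) : ℕ := c.unpair.1

/-- The codes of the atomic formulas. -/
def atoms (c : ℕ) : List ℕ := (Encodable.decode (α := List ℕ) c.unpair.2).getD []

/-- The number of atomic formulas. -/
def numEq (c : ℕ) : ℕ := (atoms c).length

/-- The coefficient of `x_v` in the `j`-th equation. -/
def colA (c j v : ℕ) : R F := eqForm ν (2 * v) ((atoms c).getD j 0)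

/-- The coefficient of `y_v` in the `j`-th equation. -/
def colB (c j v : ℕ) : R F := eqForm ν (2 * v + 1) ((atoms c).getD j 0)

/-- The coefficient of `x_v` in the `j`-th membership condition. -/
def memA (c j v : ℕ) : R F := memForm ν (2 * v) ((atoms c).getD j 0)

/-- The coefficient of `y_v` in the `j`-th membership condition. -/
def memB (c j v : ℕ) : R F := memForm ν (2 * v + 1) ((atoms c).getD j 0)

variable {ν}

theorem CodesPP.exists_sol {m c : ℕ} {φ : (LO F).Formula (Fin m)} (h : CodesPP ν c φ)
    (hM : IsMod F ballLang M) {x : Fin m → M} (hφ : φ.Realize x) :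
    ∃ y : Fin (numVar c) → M, ∀ j < numEq c, ∑ i : Fin m, sm (x i) (colA ν c j i) +
      ∑ v : Fin (numVar c), sm (y v) (colB ν c j v) = 0 := by
  obtain ⟨k, l, cs, hl, rfl, rfl⟩ := h
  have hk : numVar (Nat.pair k (Encodable.encode cs)) = k := by rw [numVar, Nat.unpair_pair]
  have hcs : atoms (Nat.pair k (Encodable.encode cs)) = cs := by
    rw [atoms, Nat.unpair_pair, Encodable.encodek]; rfl
  rw [BoundedFormula.realize_exs] at hφ
  obtain ⟨y, hy⟩ := hφ
  rw [BoundedFormula.realize_foldr_inf] at hy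
  simp only [numEq, colA, colB, hcs]
  rw [hk]
  refine ⟨y, fun j hj => ?_⟩
  have hj' : j < l.length := by rwa [← hl.length_eq]
  have := (hl.get hj hj').realize_eq ν hM (hy _ (List.get_mem l ⟨j, hj'⟩))
  simpa [List.getD, hj] using this

theorem CodesPP.realize {m c : ℕ} {φ : (LO F).Formula (Fin m)} (h : CodesPP ν c φ)
    (hM : IsMod F ballLang M) {x : Fin m → M} {y : Fin (numVar c) → M}
    (heq : ∀ j < numEq c, ∑ i : Fin m, sm (x i) (colA ν c j i) +
      ∑ v : Fin (numVar c), sm (y v) (colB ν c j v) = 0)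
    (hmem : ∀ j < numEq c, ∑ i : Fin m, sm (x i) (memA ν c j i) +
      ∑ v : Fin (numVar c), sm (y v) (memB ν c j v) ∈ ballSet F M) : φ.Realize x := by
  obtain ⟨k, l, cs, hl, rfl, rfl⟩ := h
  have hk : numVar (Nat.pair k (Encodable.encode cs)) = k := by rw [numVar, Nat.unpair_pair]
  have hcs : atoms (Nat.pair k (Encodable.encode cs)) = cs := by
    rw [atoms, Nat.unpair_pair, Encodable.encodek]; rfl
  simp only [numEq, colA, colB, memA, memB, hcs] at heq hmem
  revert y
  rw [hk]
  intro y heq hmem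
  rw [BoundedFormula.realize_exs]
  refine ⟨y, ?_⟩
  rw [BoundedFormula.realize_foldr_inf]
  intro θ hθ
  obtain ⟨j, hj', rfl⟩ := List.mem_iff_getElem.1 hθ
  have hj : j < cs.length := by rwa [hl.length_eq]
  have h1 := heq j hj
  have h2 := hmem j hj
  simp only [List.getD, hj, List.getElem?_eq_getElem, Option.getD_some] at h1 h2
  exact (hl.get hj hj').realize ν hM h1 h2

end Codes

/-! ### Consequences in torsion-free modules -/

section Trans

variable {M : Type*} [AddCommGroup M] [Module (Rop F) M]

/-- A sequence composed of `m` terms of `f`, `k` terms of `g` and the terms of `h`. -/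
def split3 {α : Type*} (m k : ℕ) (f g h : ℕ → α) (v : ℕ) : α :=
  if v < m then f v else if v < m + k then g (v - m) else h (v - m - k)

theorem sum_split3 (m k q : ℕ) (x y w : ℕ → M) (f g h : ℕ → R F) :
    ∑ v ∈ Finset.range (m + k + q), sm (split3 m k x y w v) (split3 m k f g h v) =
      ∑ v ∈ Finset.range m, sm (x v) (f v) + ∑ v ∈ Finset.range k, sm (y v) (g v) +
        ∑ v ∈ Finset.range q, sm (w v) (h v) := by
  rw [Finset.sum_range_add, Finset.sum_range_add]
  congr 1
  · congr 1
    · refine Finset.sum_congr rfl fun v hv => ?_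
      have := Finset.mem_range.1 hv
      simp only [split3, if_pos this]
    · refine Finset.sum_congr rfl fun v hv => ?_
      have := Finset.mem_range.1 hv
      have h1 : ¬ m + v < m := by omega
      have h2 : m + v < m + k := by omega
      simp only [split3, if_neg h1, if_pos h2, Nat.add_sub_cancel_left]
  · refine Finset.sum_congr rfl fun v hv => ?_
    have h1 : ¬ m + k + v < m := by omega
    have h2 : ¬ m + k + v < m + k := by omega
    have h3 : m + k + v - m - k = v := by omega
    simp only [split3, if_neg h1, if_neg h2, h3]

/-- The equation of the `j`-th step of a program, as a column of coefficients. -/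
def stepCol (n : ℕ) (a : ℕ → ℕ → K F) (j i : ℕ) : R F :=
  if i < n + d F * j then mono 0 (a j i)
  else if i < n + d F * j + d F then -mono 1 (unif F ^ (i - (n + d F * j))) else 0

theorem sum_stepCol {n s j : ℕ} (a : ℕ → ℕ → K F) (hj : j < s) (W : ℕ → M) :
    ∑ i ∈ Finset.range (n + d F * s), sm (W i) (stepCol n a j i) =
      ∑ i ∈ Finset.range (n + d F * j), sm (W i) (mono 0 (a j i)) -
        tsum F fun e => W (n + d F * j + e) := by
  have hle : n + d F * j + d F ≤ n + d F * s := by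
    have := Nat.mul_le_mul_left (d F) (Nat.succ_le_of_lt hj)
    rw [Nat.mul_succ] at this; omega
  obtain ⟨q, hq⟩ := Nat.exists_eq_add_of_le hle
  rw [hq, Finset.sum_range_add, Finset.sum_range_add, sub_eq_add_neg]
  have h3 : ∑ i ∈ Finset.range q,
      sm (W (n + d F * j + d F + i)) (stepCol n a j (n + d F * j + d F + i)) = 0 := by
    refine Finset.sum_eq_zero fun i _ => ?_
    rw [stepCol, if_neg (by omega), if_neg (by omega), sm_zero]
  rw [h3, add_zero]
  congr 1
  · refine Finset.sum_congr rfl fun i hi => ?_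
    rw [stepCol, if_pos (Finset.mem_range.1 hi)]
  · rw [Finset.sum_range, tsum, ← Finset.sum_neg_distrib]
    refine Finset.sum_congr rfl fun e _ => ?_
    rw [stepCol, if_neg (by omega), if_pos (by have := e.2; omega), sm_neg, Nat.add_sub_cancel_left]
    rfl

/-- The relations between `x`, `y` and the run `W` on `x.A₁`: the `n` equations `x.A + y.B = 0`,
the `n₁` equations `W_j = x.A₁_j`, and the steps of the program. -/
def relCol (m k n n₁ : ℕ) (A B A₁ : ℕ → ℕ → R F) (a : ℕ → ℕ → K F) (j v : ℕ) : R F :=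
  if j < n then split3 m k (A j) (B j) (fun _ => 0) v
  else if j < n + n₁ then
    split3 m k (fun i => -A₁ (j - n) i) (fun _ => 0) (fun i => if i = j - n then 1 else 0) v
  else split3 m k (fun _ => 0) (fun _ => 0) (stepCol n₁ a (j - n - n₁)) v

/-- The `j`-th equation of the elimination condition, as a column of coefficients. -/
def goalCol (m k : ℕ) (E : Elim F) (j v : ℕ) : R F :=
  split3 m k (fun _ => 0) (fun _ => 0)
    (fun i => ∑ l ∈ Finset.range E.n', mono 0 (E.h i l) * E.G l j - if i = j then 1 else 0) v

section Sums

variable {m k n n₁ : ℕ} {A B A₁ : ℕ → ℕ → R F} (x y W : ℕ → M)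

theorem sum_relCol_eq {a : ℕ → ℕ → K F} (q : ℕ) {j : ℕ} (hj : j < n) :
    ∑ v ∈ Finset.range (m + k + q), sm (split3 m k x y W v) (relCol m k n n₁ A B A₁ a j v) =
      ∑ v ∈ Finset.range m, sm (x v) (A j v) + ∑ v ∈ Finset.range k, sm (y v) (B j v) := by
  simp only [relCol, if_pos hj]
  rw [sum_split3]
  simp [sm_zero]

theorem sum_relCol_init {a : ℕ → ℕ → K F} {q : ℕ} (hq : n₁ ≤ q) {j : ℕ} (hj : j < n₁) :
    ∑ v ∈ Finset.range (m + k + q), sm (split3 m k x y W v) (relCol m k n n₁ A B A₁ a (n + j) v) =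
      W j - ∑ v ∈ Finset.range m, sm (x v) (A₁ j v) := by
  have h1 : ¬ n + j < n := by omega
  have h2 : n + j < n + n₁ := by omega
  simp only [relCol, if_neg h1, if_pos h2]
  rw [sum_split3]
  simp only [Nat.add_sub_cancel_left, sm_neg, Finset.sum_neg_distrib, sm_zero,
    Finset.sum_const_zero, add_zero]
  have h3 : ∑ i ∈ Finset.range q, sm (W i) (if i = j then (1 : R F) else 0) = W j := by
    rw [Finset.sum_eq_single j, if_pos rfl, sm_one]
    · intro i _ hi
      rw [if_neg hi, sm_zero]
    · exact fun h => absurd (Finset.mem_range.2 (by omega)) h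
  rw [h3, sub_eq_add_neg, add_comm]

theorem sum_relCol_step {a : ℕ → ℕ → K F} {s j : ℕ} (hj : j < s) :
    ∑ v ∈ Finset.range (m + k + (n₁ + d F * s)),
      sm (split3 m k x y W v) (relCol m k n n₁ A B A₁ a (n + n₁ + j) v) =
        ∑ i ∈ Finset.range (n₁ + d F * j), sm (W i) (mono 0 (a j i)) -
          tsum F fun e => W (n₁ + d F * j + e) := by
  have h1 : ¬ n + n₁ + j < n := by omega
  have h2 : ¬ n + n₁ + j < n + n₁ := by omega
  have h3 : n + n₁ + j - n - n₁ = j := by omega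
  simp only [relCol, if_neg h1, if_neg h2, h3]
  rw [sum_split3, sum_stepCol a hj]
  simp [sm_zero]

theorem sum_goalCol (E : Elim F) {j : ℕ} (hj : j < n₁) :
    ∑ v ∈ Finset.range (m + k + (n₁ + d F * E.s)), sm (split3 m k x y W v) (goalCol m k E j v) =
      ∑ l ∈ Finset.range E.n', sm (E.comb n₁ W l) (E.G l j) - W j := by
  simp only [goalCol]
  rw [sum_split3]
  simp only [sm_zero, Finset.sum_const_zero, zero_add, sm_sub, Finset.sum_sub_distrib, sm_sum,
    sm_mul, Sat.comb, sum_sm]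
  rw [Finset.sum_comm]
  congr 1
  rw [Finset.sum_eq_single j, if_pos rfl, sm_one]
  · intro i _ hi
    rw [if_neg hi, sm_zero]
  · exact fun h => absurd (Finset.mem_range.2 (by omega)) h

end Sums

variable (F) in
/-- The data showing that relations with the columns `B` have the consequences `g` up to separable
torsion: a saturation `C` of the columns `B` with `g r = C z`. -/
structure Trans extends Sat F where
  z : ℕ → ℕ → R F
  r : ℕ → R F

/-- `T` holds a saturation of the columns `B`, and `g_j r_j = ∑_l C_l z_lj` with separable `r_j`. -/
structure Trans.Valid (T : Trans F) (k n : ℕ) (B : ℕ → ℕ → R F) (n₁ : ℕ) (g : ℕ → ℕ → R F) : Prop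
    extends T.toSat.Valid k n B where
  rel : ∀ j < n₁, ∀ v < k, g j v * T.r j = ∑ l ∈ Finset.range T.n', T.C l v * T.z l j
  sep : ∀ j < n₁, IsSeparable (T.r j)

/-- Where the relations `B` hold, the consequence `g_j` is annihilated by the separable `r_j`. -/
theorem Trans.Valid.sm_eq_zero {T : Trans F} {k n n₁ : ℕ} {B g : ℕ → ℕ → R F}
    (hT : T.Valid k n B n₁ g) (hM : TInj F M) {u : ℕ → M}
    (hu : ∀ j < n, ∑ v ∈ Finset.range k, sm (u v) (B j v) = 0) {j : ℕ} (hj : j < n₁) :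
    sm (∑ v ∈ Finset.range k, sm (u v) (g j v)) (T.r j) = 0 := by
  have hC : ∀ l < T.n', ∑ v ∈ Finset.range k, sm (u v) (T.C l v) = 0 := by
    intro l hl
    have := hT.toValid.comb_eq hM (run_zero n T.s T.a) (y := fun v : Fin k => u v)
      (fun j hj => by rw [← hu j hj, Finset.sum_range]) hl
    rw [Finset.sum_range, ← this]
    exact Finset.sum_eq_zero fun i _ => zero_sm _
  simp only [sum_sm, ← sm_mul]
  rw [Finset.sum_congr rfl fun v hv => by rw [hT.rel j hj v (Finset.mem_range.1 hv)] ]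
  simp only [sm_sum, sm_mul]
  rw [Finset.sum_comm]
  refine Finset.sum_eq_zero fun l hl => ?_
  rw [← sum_sm, hC l (Finset.mem_range.1 hl), zero_sm]

/-- If the relations `B` have the consequences `g` in a nonzero torsion-free divisible module, then
this is due to the data `Trans`. -/
theorem exists_trans {N : Type*} [AddCommGroup N] [Module (Rop F) N]
    (hdiv : ∀ s : R F, IsSeparable s → ∀ x : N, ∃ y, sm y s = x)
    (htf : ∀ r : R F, r ≠ 0 → ∀ x : N, sm x r = 0 → x = 0) (hne : ∃ x : N, x ≠ 0)
    {k n n₁ : ℕ} {B g : ℕ → ℕ → R F}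
    (h : ∀ u : ℕ → N, (∀ j < n, ∑ v ∈ Finset.range k, sm (u v) (B j v) = 0) →
      ∀ j < n₁, ∑ v ∈ Finset.range k, sm (u v) (g j v) = 0) :
    ∃ T : Trans F, T.Valid k n B n₁ g := by
  obtain ⟨E, hE, hli, G, hG⟩ := exists_sat k n B
  obtain ⟨hle, S, hS, hSC⟩ := exists_nonDeg_extension hli
  choose r u hr hru using fun j => hS.exists_separable_multiple fun v : Fin k => g j v
  obtain ⟨p, hp⟩ := hne
  have hSC' : ∀ l (hl : l < E.n') (v : Fin k), S ⟨l, hl.trans_le hle⟩ v = E.C l v :=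
    fun l hl v => congrFun (hSC ⟨l, hl⟩) v
  -- the multiples of the additional columns are zero, as the additional columns are independent
  have hu : ∀ j < n₁, ∀ l : Fin k, ¬ (l : ℕ) < E.n' → u j l = 0 := by
    intro j hj l hl
    obtain ⟨y, hy⟩ := exists_solution_of_divisible hdiv htf hS (Pi.single l p)
    let y' : ℕ → N := fun v => if hv : v < k then y ⟨v, hv⟩ else 0
    have hy' : ∀ v : Fin k, y' v = y v := fun v => dif_pos v.2
    have h1 : ∀ j < n, ∑ v ∈ Finset.range k, sm (y' v) (B j v) = 0 := by
      intro j hj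
      rw [Finset.sum_range]
      simp only [hy']
      rw [Finset.sum_congr rfl fun v _ => by rw [hG j hj v v.2, sm_sum] ]
      rw [Finset.sum_comm]
      refine Finset.sum_eq_zero fun i hi => ?_
      have hi := Finset.mem_range.1 hi
      simp only [sm_mul, ← hSC' i hi]
      rw [← sum_sm, hy, Pi.single_eq_of_ne, zero_sm]
      intro hil
      exact hl (by rw [← hil]; exact hi)
    have h2 := h y' h1 j hj
    rw [Finset.sum_range] at h2
    simp only [hy'] at h2
    have h3 : sm (∑ v, sm (y v) (g j v)) (r j) = ∑ i, sm (∑ v, sm (y v) (S i v)) (u j i) := by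
      simp only [sum_sm, ← sm_mul]
      rw [Finset.sum_comm]
      refine Finset.sum_congr rfl fun v _ => ?_
      rw [← sm_sum]
      congr 1
      have := congrFun (hru j) v
      rw [Finset.sum_apply] at this
      exact this.symm
    rw [h2, zero_sm] at h3
    simp only [hy] at h3
    rw [Finset.sum_eq_single l, Pi.single_eq_same] at h3
    · by_contra hc
      exact hp (htf _ hc p h3.symm)
    · intro i _ hi
      rw [Pi.single_eq_of_ne hi, zero_sm]
    · exact fun h => absurd (Finset.mem_univ l) h
  refine ⟨{ E with z := fun l j => if hl : l < k then u j ⟨l, hl⟩ else 0, r := r },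
    { init := hE.init, run := hE.run, col := hE.col, rel := fun j hj v hv => ?_,
      sep := fun j _ => hr j }⟩
  have h1 := congrFun (hru j) ⟨v, hv⟩
  rw [Finset.sum_apply] at h1
  refine h1.symm.trans ?_
  have h2 : ∑ l ∈ Finset.range k, (if hl : l < k then S ⟨l, hl⟩ ⟨v, hv⟩ * u j ⟨l, hl⟩ else 0) =
      ∑ l, sm (S l) (u j l) ⟨v, hv⟩ := by
    rw [Finset.sum_range]
    exact Finset.sum_congr rfl fun l _ => dif_pos l.2
  rw [← h2]
  symm
  refine (Finset.sum_congr rfl fun l hl => ?_).trans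
    (Finset.sum_subset (Finset.range_mono hle) fun l hl hl' => ?_)
  · have hl := Finset.mem_range.1 hl
    simp only [dif_pos (hl.trans_le hle), hSC' l hl ⟨v, hv⟩]
  · have hl := Finset.mem_range.1 hl
    rw [dif_pos hl, hu j hj ⟨l, hl⟩ fun h => hl' (Finset.mem_range.2 h), mul_zero]

end Trans

/-! ### Entailments -/

section Entail

open FirstOrder.Language

/-- The `L_𝓞(λ)`-structure of a `t`-decomposable module in which `𝓞` is the whole module. -/
abbrev totalStructure {M : Type*} [AddCommGroup M] [Module (Rop F) M] (h : TDec F M) :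
    (LOlam F).Structure M where
  funMap := fun f x => match f with
    | .inl g => (lamStructure h).funMap g x
  RelMap := fun r _ => match r with
    | .inl r => by rcases r with r | r <;> exact r.elim
    | .inr _ => True

variable {ν : ℕ → K F}

theorem totalStructure_isMod {M : Type*} [AddCommGroup M] [Module (Rop F) M] (h : TDec F M) :
    let _ := totalStructure h
    let _ := lamRed F M
    IsMod F (lamLang F) M :=
  let _ := totalStructure h
  let _ := lamRed F M
  ⟨rfl, fun _ => rfl, fun _ _ => rfl, fun _ _ => rfl⟩

theorem totalStructure_coord {M : Type*} [AddCommGroup M] [Module (Rop F) M] (h : TDec F M) :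
    let _ := totalStructure h
    let _ := lamRed F M
    ∀ x : M, x = tsum F fun i => opLam F i x := fun x => h.coord_spec x

theorem total_models_Tlam {M : Type*} [AddCommGroup M] [Module (Rop F) M] (h : TDec F M) :
    let _ := totalStructure h
    M ⊨ (ofLlam F).onTheory (Tlam F) := by
  let _ := totalStructure h
  let _ := lamRed F M
  have : (ofLlam F).IsExpansionOn M := LHom.isExpansionOn_reduct (ofLlam F) M
  exact (LHom.onTheory_model _ _).2
    (models_Tlam (totalStructure_isMod h) h.tInj (totalStructure_coord h))

theorem total_models_TfreeZeroTotal {M : Type*} [AddCommGroup M] [Module (Rop F) M] (h : TDec F M)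
    (hdiv : ∀ s : R F, IsSeparable s → ∀ x : M, ∃ y, sm y s = x)
    (htf : ∀ r : R F, r ≠ 0 → ∀ x : M, sm x r = 0 → x = 0) (hne : ∃ x : M, x ≠ 0) :
    let _ := totalStructure h
    M ⊨ TfreeZeroTotal F := by
  let _ := totalStructure h
  let _ := lamRed F M
  have : (ofLlam F).IsExpansionOn M := LHom.isExpansionOn_reduct (ofLlam F) M
  rw [TfreeZeroTotal, Theory.model_union_iff]
  constructor
  · exact (LHom.onTheory_model _ _).2 (models_TfreeZero (totalStructure_isMod h) h.tInj
      (totalStructure_coord h) hdiv htf hne)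
  · refine ⟨fun σ hσ => ?_⟩
    rw [Set.mem_singleton_iff.1 hσ]
    exact fun _ => trivial

theorem realize_ofLO {M : Type*} [(LOlam F).Structure M] {α : Type*} (φ : (LO F).Formula α)
    (x : α → M) : ((ofLO F).onFormula φ).Realize x ↔ (let _ := ballRed F M; φ.Realize x) := by
  let _ := ballRed F M
  have : (ofLO F).IsExpansionOn M := LHom.isExpansionOn_reduct (ofLO F) M
  exact LHom.realize_onFormula _ _

theorem realize_ofLlam {M : Type*} [(LOlam F).Structure M] {α : Type*} (φ : (Llam F).Formula α)
    (x : α → M) : ((ofLlam F).onFormula φ).Realize x ↔ (let _ := lamRed F M; φ.Realize x) := by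
  let _ := lamRed F M
  have : (ofLlam F).IsExpansionOn M := LHom.isExpansionOn_reduct (ofLlam F) M
  exact LHom.realize_onFormula _ _

variable {m c : ℕ} {φ : (LO F).Formula (Fin m)} {E : Elim F} {ψ : (Llam F).Formula (Fin m)}

/-- The elimination condition follows from the formula. -/
theorem psi_of_phi (hc : CodesPP ν c φ) (hE : E.Valid (numVar c) (numEq c) (colB ν c))
    (hψ : IsPsi E (numEq c) (colA ν c) ψ) :
    (ofLlam F).onTheory (Tlam F) ⊨ᵇ
      ((ofLO F).onFormula φ).imp ((ofLlam F).onFormula ψ) := by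
  rw [Theory.models_formula_iff]
  intro M x
  rw [Formula.realize_imp, realize_ofLO, realize_ofLlam]
  intro hφ
  let _ := lamRed F M
  let _ := ballRed F M
  obtain ⟨gM, mM, hM, hT, hl⟩ := exists_module_of_onTheory (F := F) (M := M) M.is_model
  obtain ⟨y, hy⟩ := hc.exists_sol (isMod_ballRed hM) hφ
  obtain ⟨W, hW, hrun⟩ := exists_run hT (numEq c) E.s E.a fun j =>
    ∑ i : Fin m, sm (x i) (colA ν c j i)
  refine (hψ M hM hT.tInj hl x W hW hrun).2 (hE.cond hT.tInj hrun (y := y) fun j hj => ?_)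
  rw [hW j hj]
  exact hy j hj

/-- The elimination condition is the strongest positive quantifier-free consequence of the
formula: it makes the formula true in an extension. -/
theorem psi_strongest (hc : CodesPP ν c φ) (hE : E.Valid (numVar c) (numEq c) (colB ν c))
    (hψ : IsPsi E (numEq c) (colA ν c) ψ) {θ : (Llam F).Formula (Fin m)} (hθ : IsPosQF θ)
    (h : (ofLlam F).onTheory (Tlam F) ⊨ᵇ
      ((ofLO F).onFormula φ).imp ((ofLlam F).onFormula θ)) : Tlam F ⊨ᵇ ψ.imp θ := by
  rw [Theory.models_formula_iff] at h ⊢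
  intro M x
  rw [Formula.realize_imp]
  intro hx
  obtain ⟨gM, mM, hM, hT, hl⟩ := exists_module_of_Tlam (F := F) (M := M) M.is_model
  obtain ⟨W, hW, hrun⟩ := exists_run hT (numEq c) E.s E.a fun j =>
    ∑ i : Fin m, sm (x i) (colA ν c j i)
  obtain ⟨N, gN, mN, f, hTN, hf, y, hy⟩ :=
    hE.exists_extension hT ((hψ M hM hT.tInj hl x W hW hrun).1 hx)
  -- the membership conditions of the formula hold trivially if `𝓞` is the whole extension
  let _ := totalStructure hTN
  let _ := lamRed F N
  let _ := ballRed F N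
  have hN : IsMod F (lamLang F) N := totalStructure_isMod hTN
  have hmod : N ⊨ (ofLlam F).onTheory (Tlam F) := total_models_Tlam hTN
  have h1 : ((ofLO F).onFormula φ).Realize (fun i => f (x i)) →
      ((ofLlam F).onFormula θ).Realize (fun i => f (x i)) :=
    h (Theory.ModelType.of _ N) fun i => f (x i)
  rw [realize_ofLO, realize_ofLlam] at h1
  rw [← realize_iff_of_injective hM hN hl hTN.tInj (totalStructure_coord hTN) f hf hθ]
  refine h1 (hc.realize (isMod_ballRed hN) (y := y) (fun j hj => ?_) fun j hj => trivial)
  rw [← hy j hj, hW j hj, map_sum]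
  simp only [map_sm]

/-- The valuations of the coefficients in the formula with the code `c` are at least `-β`. -/
structure FormBounded (ν : ℕ → K F) (m c β : ℕ) : Prop where
  colA : ∀ j < numEq c, ∀ i < m, ValGe β (colA ν c j i)
  memA : ∀ j < numEq c, ∀ i < m, ValGe β (memA ν c j i)
  memB : ∀ j < numEq c, ∀ v < numVar c, ValGe β (memB ν c j v)

variable (F) in
/-- The radius of the ball on which the elimination is valid. -/
def radius (s β : ℕ) : ℤ := (2 * d F + 1) ^ s * (6 * β + 1) + β

theorem le_radius (s β : ℕ) : (β : ℤ) + (3 * β + 1) ≤ radius F s β := by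
  have h1 : (1 : ℤ) ≤ (2 * d F + 1) ^ s := one_le_pow₀ (by omega)
  have h2 : (0 : ℤ) ≤ β := Int.natCast_nonneg _
  unfold radius
  nlinarith

section Small

variable {M : Type*} [AddCommGroup M] [Module (Rop F) M] {P : ℤ → Set M} {β : ℕ} {x : Fin m → M}

theorem FormBounded.init_mem (hP : IsHens F P) (hβ : FormBounded ν m c β) {s : ℕ}
    (hx : ∀ i, x i ∈ P (radius F s β)) {j : ℕ} (hj : j < numEq c) :
    ∑ i : Fin m, sm (x i) (HenselMod.colA ν c j i) ∈ P ((2 * d F + 1) ^ s * (6 * β + 1)) :=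
  hP.sum_mem fun i _ => hP.sm_mem_of_valGe (hβ.colA j hj i i.2) (by positivity) (hx i)

theorem exists_small_sol (hP : IsHens F P) (hE : E.Valid (numVar c) (numEq c) (colB ν c))
    (hEβ : E.Bounded (numVar c) β) (hβ : FormBounded ν m c β)
    (hx : ∀ i, x i ∈ P (radius F E.s β)) {W : ℕ → M}
    (hW : ∀ j < numEq c, W j = ∑ i : Fin m, sm (x i) (colA ν c j i))
    (hrun : Run (numEq c) E.s E.a W) (hcond : E.Cond (numEq c) W) :
    ∃ y : Fin (numVar c) → M,
      (∀ j < numEq c, ∑ i : Fin m, sm (x i) (colA ν c j i) +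
        ∑ v : Fin (numVar c), sm (y v) (colB ν c j v) = 0) ∧
      ∀ j < numEq c, ∑ i : Fin m, sm (x i) (memA ν c j i) +
        ∑ v : Fin (numVar c), sm (y v) (memB ν c j v) ∈ P 0 := by
  obtain ⟨y, hy, hsol⟩ := hE.exists_small hEβ hP hrun hcond fun j hj => by
    rw [hW j hj]
    exact hβ.init_mem hP hx hj
  have hr := le_radius (F := F) E.s β
  refine ⟨y, fun j hj => by rw [← hW j hj]; exact hsol j hj, fun j hj => hP.add_mem ?_ ?_⟩
  · exact hP.sum_mem fun i _ => hP.sm_mem_of_valGe (hβ.memA j hj i i.2) le_rfl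
      (hP.anti _ _ (by omega) (hx i))
  · exact hP.sum_mem fun v _ => hP.sm_mem_of_valGe (hβ.memB j hj v v.2) le_rfl
      (hP.anti _ _ (by omega) (hy v))

end Small

/-- Near zero the formula follows from the elimination condition. -/
theorem phi_of_psi_small {M : Type u} [AddCommGroup M] [Module (Rop F) M] [(LOlam F).Structure M]
    (hM : @IsMod F _ _ (lamLang F) M _ _ (lamRed F M)) (hT : TDec F M)
    (hl : let _ := lamRed F M; ∀ x : M, x = tsum F fun i => opLam F i x) (hMT : M ⊨ Thens F)
    (hc : CodesPP ν c φ) (hE : E.Valid (numVar c) (numEq c) (colB ν c))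
    (hψ : IsPsi E (numEq c) (colA ν c) ψ) {β : ℕ} (hEβ : E.Bounded (numVar c) β)
    (hβ : FormBounded ν m c β) {x : Fin m → M}
    (hx : let _ := ballRed F M
      ∀ i, x i ∈ ballP (F := F) (ballSet F M) (radius F E.s β))
    (h : let _ := lamRed F M; ψ.Realize x) : let _ := ballRed F M; φ.Realize x := by
  let _ := lamRed F M
  let _ := ballRed F M
  have hP := isHens_of_Thens hM hT.tInj hl hMT
  obtain ⟨W, hW, hrun⟩ := exists_run hT (numEq c) E.s E.a fun j =>
    ∑ i : Fin m, sm (x i) (colA ν c j i)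
  obtain ⟨y, hy, hmem⟩ := exists_small_sol hP hE hEβ hβ hx hW hrun
    ((hψ M hM hT.tInj hl x W hW hrun).1 h)
  refine hc.realize (isMod_ballRed hM) hy fun j hj => ?_
  rw [← ballP_zero (F := F) (ballSet F M)]
  exact hmem j hj

/-- The equivalence near zero of the formula and its strongest positive quantifier-free
consequence. -/
theorem thens_models_iff (hc : CodesPP ν c φ) (hE : E.Valid (numVar c) (numEq c) (colB ν c))
    {β : ℕ} (hEβ : E.Bounded (numVar c) β) (hβ : FormBounded ν m c β)
    (h₁ : (ofLlam F).onTheory (Tlam F) ⊨ᵇ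
      ((ofLO F).onFormula φ).imp ((ofLlam F).onFormula ψ))
    (h₂ : ∀ θ : (Llam F).Formula (Fin m), IsPosQF θ →
      ((ofLlam F).onTheory (Tlam F) ⊨ᵇ
        ((ofLO F).onFormula φ).imp ((ofLlam F).onFormula θ)) → Tlam F ⊨ᵇ ψ.imp θ) :
    Thens F ⊨ᵇ ((ofLO F).onFormula φ ⊓ ballPow m (radius F E.s β)).iff
      ((ofLlam F).onFormula ψ ⊓ ballPow m (radius F E.s β)) := by
  obtain ⟨ψ', hψ', hspec⟩ := exists_psi (m := m) E (numEq c) (colA ν c)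
  have h3 := h₂ ψ' hψ' (psi_of_phi hc hE hspec)
  rw [Theory.models_formula_iff] at h₁ h3 ⊢
  intro M x
  rw [Formula.realize_iff, Formula.realize_inf, Formula.realize_inf]
  have hMT : M ⊨ Thens F := M.is_model
  have hMl := onTheory_of_Thens hMT
  have h4 : ((ofLO F).onFormula φ).Realize x → ((ofLlam F).onFormula ψ).Realize x :=
    h₁ (Theory.ModelType.of _ M) x
  refine ⟨fun ⟨ha, hb⟩ => ⟨h4 ha, hb⟩, fun ⟨ha, hb⟩ => ⟨?_, hb⟩⟩
  let _ := lamRed F M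
  let _ := ballRed F M
  have : (ofLlam F).IsExpansionOn M := LHom.isExpansionOn_reduct (ofLlam F) M
  have hMl' : M ⊨ Tlam F := (LHom.onTheory_model _ _).1 hMl
  have h5 : ψ.Realize x → ψ'.Realize x := h3 (Theory.ModelType.of _ M) x
  obtain ⟨gM, mM, hM, hT, hl⟩ := exists_module_of_onTheory (F := F) (M := M) hMl
  rw [realize_ofLO]
  exact phi_of_psi_small hM hT hl hMT hc hE hspec hEβ hβ ((realize_ballPow hM _ x).1 hb)
    (h5 ((realize_ofLlam _ _).1 ha))

/-- The data showing that the formula with the code `c` implies the one with the code `c₁` near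
zero: an elimination `E` for the second formula, and the data `T` showing that the elimination
condition follows from the relations of the first formula up to separable torsion. -/
structure ImpliesNear (ν : ℕ → K F) (m c c₁ β : ℕ) (E : Elim F) (T : Trans F) : Prop where
  elim : E.Valid (numVar c₁) (numEq c₁) (colB ν c₁)
  bounded : E.Bounded (numVar c₁) β
  bounded_G : ∀ l j, ValGe β (E.G l j)
  form : FormBounded ν m c₁ β
  trans : T.Valid (m + numVar c + (numEq c₁ + d F * E.s)) (numEq c + numEq c₁ + E.s)
    (relCol m (numVar c) (numEq c) (numEq c₁) (colA ν c) (colB ν c) (colA ν c₁) E.a) (numEq c₁)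
    (goalCol m (numVar c) E)
  bounded_r : ∀ j < numEq c₁, ValGe β (T.r j) ∧ val (coeff (T.r j) 0) ≤ β

theorem split3_apply {α : Type*} (m k : ℕ) (u : ℕ → α) :
    split3 m k u (fun v => u (m + v)) (fun v => u (m + k + v)) = u := by
  funext v
  unfold split3
  split_ifs with h1 h2
  · rfl
  · exact congrArg u (by omega)
  · exact congrArg u (by omega)

/-- The elimination condition of the second formula, from the relations of the first one. -/
theorem ImpliesNear.cond {c₁ β : ℕ} {T : Trans F} (h : ImpliesNear ν m c c₁ β E T)
    {M : Type*} [AddCommGroup M] [Module (Rop F) M] {P : ℤ → Set M} (hP : IsHens F P)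
    (hT : TInj F M) {x : Fin m → M} (hx : ∀ i, x i ∈ P (radius F E.s β))
    {y : Fin (numVar c) → M} (hy : ∀ j < numEq c, ∑ i : Fin m, sm (x i) (colA ν c j i) +
      ∑ v : Fin (numVar c), sm (y v) (colB ν c j v) = 0)
    {W : ℕ → M} (hW : ∀ j < numEq c₁, W j = ∑ i : Fin m, sm (x i) (colA ν c₁ j i))
    (hrun : Run (numEq c₁) E.s E.a W) : E.Cond (numEq c₁) W := by
  let x' : ℕ → M := fun i => if hi : i < m then x ⟨i, hi⟩ else 0
  let y' : ℕ → M := fun v => if hv : v < numVar c then y ⟨v, hv⟩ else 0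
  have hx' : ∀ i : Fin m, x' i = x i := fun i => dif_pos i.2
  have hy' : ∀ v : Fin (numVar c), y' v = y v := fun v => dif_pos v.2
  intro j hj
  rw [← sub_eq_zero, ← sum_goalCol x' y' W E hj]
  have hWβ := hP.run_mem hrun h.bounded.a (ε := 6 * β + 1) (by omega) (by omega) fun i hi => by
    rw [hW i hi]
    exact h.form.init_mem hP hx hi
  refine hP.eq_zero_of_sm_eq_zero (h.trans.sep j hj) (h.bounded_r j hj).1 (h.bounded_r j hj).2 ?_
    (h.trans.sm_eq_zero hT (fun i hi => ?_) hj)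
  · rw [sum_goalCol x' y' W E hj, sub_eq_add_neg]
    refine hP.add_mem (hP.sum_mem fun l _ => ?_) (hP.neg_mem ?_)
    · refine hP.sm_mem_of_valGe (h.bounded_G l j) (by positivity)
        (hP.sum_mem fun i hi => hP.sm_mem_of_valGe (h.bounded.h i l) (by positivity)
          (hP.anti _ _ (by omega) (hWβ i (Finset.mem_range.1 hi))))
    · exact hP.anti _ _ (by omega) (hWβ j (by omega))
  · rcases lt_or_ge i (numEq c) with h1 | h1
    · rw [sum_relCol_eq x' y' W _ h1, Finset.sum_range, Finset.sum_range]
      simp only [hx', hy']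
      exact hy i h1
    · rcases lt_or_ge i (numEq c + numEq c₁) with h2 | h2
      · obtain ⟨i, rfl⟩ := Nat.exists_eq_add_of_le h1
        rw [sum_relCol_init x' y' W (by omega) (by omega), Finset.sum_range, hW i (by omega)]
        simp only [hx', sub_self]
      · obtain ⟨i, rfl⟩ := Nat.exists_eq_add_of_le h2
        rw [sum_relCol_step x' y' W (by omega), hrun i (by omega), sub_self]

theorem ImpliesNear.thens_models {c₁ β : ℕ} {φ₁ : (LO F).Formula (Fin m)} {T : Trans F}
    (h : ImpliesNear ν m c c₁ β E T) (hc : CodesPP ν c φ) (hc₁ : CodesPP ν c₁ φ₁) {γ : ℤ}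
    (hγ : radius F E.s β ≤ γ) : Thens F ⊨ᵇ ((ofLO F).onFormula φ ⊓ ballPow m γ).imp
      ((ofLO F).onFormula φ₁) := by
  rw [Theory.models_formula_iff]
  intro M x
  rw [Formula.realize_imp, Formula.realize_inf, realize_ofLO, realize_ofLO]
  rintro ⟨hφ, hb⟩
  have hMT : M ⊨ Thens F := M.is_model
  obtain ⟨gM, mM, hM, hT, hl⟩ := exists_module_of_onTheory (F := F) (M := M)
    (onTheory_of_Thens hMT)
  let _ := lamRed F M
  let _ := ballRed F M
  have hP := isHens_of_Thens hM hT.tInj hl hMT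
  have hx := fun i => hP.anti _ _ hγ ((realize_ballPow hM _ x).1 hb i)
  obtain ⟨y, hy⟩ := hc.exists_sol (isMod_ballRed hM) hφ
  obtain ⟨W, hW, hrun⟩ := exists_run hT (numEq c₁) E.s E.a fun j =>
    ∑ i : Fin m, sm (x i) (colA ν c₁ j i)
  obtain ⟨y₁, hy₁, hmem⟩ := exists_small_sol hP h.elim h.bounded h.form hx hW hrun
    (h.cond hP hT.tInj hx hy hW hrun)
  refine hc₁.realize (isMod_ballRed hM) hy₁ fun j hj => ?_
  rw [← ballP_zero (F := F) (ballSet F M)]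
  exact hmem j hj

/-- If the first formula implies the second one in the nonzero torsion-free divisible modules, then
there are data which show this. -/
theorem exists_trans_of_models {c₁ : ℕ} {φ₁ : (LO F).Formula (Fin m)}
    (hc : CodesPP ν c φ) (hc₁ : CodesPP ν c₁ φ₁)
    (hE : E.Valid (numVar c₁) (numEq c₁) (colB ν c₁))
    (h : TfreeZeroTotal F ⊨ᵇ ((ofLO F).onFormula φ).imp ((ofLO F).onFormula φ₁)) :
    ∃ T : Trans F, T.Valid (m + numVar c + (numEq c₁ + d F * E.s)) (numEq c + numEq c₁ + E.s)
      (relCol m (numVar c) (numEq c) (numEq c₁) (colA ν c) (colB ν c) (colA ν c₁) E.a) (numEq c₁)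
      (goalCol m (numVar c) E) := by
  rw [Theory.models_formula_iff] at h
  obtain ⟨N, gN, mN, hTN, hdiv, htf, hne⟩ := exists_torsionFree_model F
  refine exists_trans hdiv htf hne fun u hu j hj => ?_
  set k := numVar c
  let x : ℕ → N := u
  let y : ℕ → N := fun v => u (m + v)
  let W : ℕ → N := fun v => u (m + k + v)
  have hsplit : split3 m k x y W = u := split3_apply m k u
  rw [← hsplit] at hu ⊢
  rw [sum_goalCol x y W E hj, sub_eq_zero]
  let _ := totalStructure hTN
  let _ := lamRed F N
  let _ := ballRed F N
  have hN : IsMod F (lamLang F) N := totalStructure_isMod hTN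
  have hmod : N ⊨ TfreeZeroTotal F := total_models_TfreeZeroTotal hTN hdiv htf hne
  have : Nonempty N := ⟨0⟩
  have h1 : ((ofLO F).onFormula φ).Realize (fun i : Fin m => x i) →
      ((ofLO F).onFormula φ₁).Realize (fun i : Fin m => x i) :=
    h (Theory.ModelType.of _ N) fun i => x i
  rw [realize_ofLO, realize_ofLO] at h1
  obtain ⟨y₁, hy₁⟩ := hc₁.exists_sol (isMod_ballRed hN) <| h1 <|
    hc.realize (isMod_ballRed hN) (y := fun v => y v)
      (fun j hj => by
        rw [← hu j (by omega), sum_relCol_eq x y W _ hj, Finset.sum_range, Finset.sum_range])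
      fun j hj => trivial
  refine hE.cond hTN.tInj (W := W) (fun i hi => ?_) (y := y₁) (fun i hi => ?_) j hj
  · rw [← sub_eq_zero, ← sum_relCol_step x y W (k := k) (n := numEq c) (A := colA ν c)
      (B := colB ν c) (A₁ := colA ν c₁) hi]
    exact hu _ (by omega)
  · have h2 := hu (numEq c + i) (by omega)
    rw [sum_relCol_init x y W (by omega) hi, Finset.sum_range, sub_eq_zero] at h2
    rw [h2]
    exact hy₁ i hi

end Entail

/-! ### Computable families of scalars -/

section Comp

attribute [fun_prop] Computable Computable.id Computable.const Computable.comp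

variable {α β γ : Type*} [Primcodable α] [Primcodable β] [Primcodable γ]

@[fun_prop]
theorem computable_fst {f : α → β × γ} (hf : Computable f) : Computable fun a => (f a).1 :=
  Computable.fst.comp hf

@[fun_prop]
theorem computable_snd {f : α → β × γ} (hf : Computable f) : Computable fun a => (f a).2 :=
  Computable.snd.comp hf

@[fun_prop]
theorem computable_mk {f : α → β} {g : α → γ} (hf : Computable f) (hg : Computable g) :
    Computable fun a => (f a, g a) := hf.pair hg

@[fun_prop]
theorem computable_add {f g : α → ℕ} (hf : Computable f) (hg : Computable g) :
    Computable fun a => f a + g a := Primrec.nat_add.to_comp.comp hf hg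

@[fun_prop]
theorem computable_mul {f g : α → ℕ} (hf : Computable f) (hg : Computable g) :
    Computable fun a => f a * g a := Primrec.nat_mul.to_comp.comp hf hg

@[fun_prop]
theorem computable_sub {f g : α → ℕ} (hf : Computable f) (hg : Computable g) :
    Computable fun a => f a - g a := Primrec.nat_sub.to_comp.comp hf hg

@[fun_prop]
theorem computable_pow {f g : α → ℕ} (hf : Computable f) (hg : Computable g) :
    Computable fun a => f a ^ g a := by
  refine (Computable.nat_rec (f := g) (g := fun _ => 1) (h := fun a p => p.2 * f a) hg
    (by fun_prop) (.mk (by fun_prop))).of_eq fun a => ?_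
  induction g a with
  | zero => rfl
  | succ n ih => rw [pow_succ, ← ih]

@[fun_prop]
theorem computable_pair {f g : α → ℕ} (hf : Computable f) (hg : Computable g) :
    Computable fun a => Nat.pair (f a) (g a) := Primrec₂.natPair.to_comp.comp hf hg

@[fun_prop]
theorem computable_unpair {f : α → ℕ} (hf : Computable f) :
    Computable fun a => Nat.unpair (f a) := Computable.unpair.comp hf

@[fun_prop]
theorem computable_length {f : α → List β} (hf : Computable f) :
    Computable fun a => (f a).length := Computable.list_length.comp hf

@[fun_prop]
theorem computable_getD {f : α → List β} {g : α → ℕ} (b : β) (hf : Computable f)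
    (hg : Computable g) : Computable fun a => (f a).getD (g a) b :=
  (Primrec.list_getD b).to_comp.comp hf hg

/-- A list that is the table of a computable function is computable. -/
theorem exists_table {f : α → ℕ → β} (hf : Computable fun p : α × ℕ => f p.1 p.2) :
    Computable fun p : α × ℕ => (List.range p.2).map (f p.1) := by
  refine (Computable.nat_rec (f := fun p : α × ℕ => p.2) (g := fun _ => [])
    (h := fun a p => p.2 ++ [f a.1 p.1]) (by fun_prop) (by fun_prop)
    (.mk (Computable.list_concat.comp (by fun_prop)
      (hf.comp (g := fun q : (α × ℕ) × ℕ × List β => (q.1.1, q.2.1)) (by fun_prop))))).of_eq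
    fun a => ?_
  obtain ⟨a, n⟩ := a
  induction n with
  | zero => rfl
  | succ n ih =>
    rw [List.range_succ, List.map_append, ← ih]
    rfl

/-- A decidable predicate. -/
@[fun_prop]
def CPred (p : α → Prop) : Prop := ∃ g : α → Bool, Computable g ∧ ∀ a, g a = true ↔ p a

@[fun_prop]
theorem CPred.comp {p : β → Prop} {g : α → β} (hp : CPred p) (hg : Computable g) :
    CPred fun a => p (g a) := by
  obtain ⟨q, hq, h⟩ := hp
  exact ⟨fun a => q (g a), hq.comp hg, fun a => h _⟩

theorem CPred.of_iff {p q : α → Prop} (hp : CPred p) (h : ∀ a, q a ↔ p a) : CPred q := by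
  obtain ⟨g, hg, hgp⟩ := hp
  exact ⟨g, hg, fun a => (hgp a).trans (h a).symm⟩

@[fun_prop]
theorem CPred.and {p q : α → Prop} (hp : CPred p) (hq : CPred q) : CPred fun a => p a ∧ q a := by
  obtain ⟨f, hf, h⟩ := hp
  obtain ⟨g, hg, h'⟩ := hq
  refine ⟨fun a => bif f a then g a else false, Computable.cond hf hg (by fun_prop), fun a => ?_⟩
  change (bif f a then g a else false) = true ↔ p a ∧ q a
  rw [← h, ← h']
  cases f a <;> simp

/-- A bounded universal quantifier. -/
def BAll (n : ℕ) (p : ℕ → Prop) : Prop := ∀ i < n, p i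

@[fun_prop]
theorem CPred.bAll {n : α → ℕ} {p : α → ℕ → Prop} (hn : Computable n)
    (hp : CPred fun q : α × ℕ => p q.1 q.2) : CPred fun a => BAll (n a) (p a) := by
  obtain ⟨f, hf, h⟩ := hp
  refine ⟨fun a => Nat.rec true (fun i b => bif f (a, i) then b else false) (n a),
    Computable.nat_rec (h := fun a p => bif f (a, p.1) then p.2 else false) hn (by fun_prop)
      (.mk (Computable.cond (by fun_prop) (by fun_prop) (by fun_prop))), fun a => ?_⟩
  change (Nat.rec true (fun i b => bif f (a, i) then b else false) (n a) : Bool) = true ↔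
    ∀ i < n a, p a i
  induction n a with
  | zero => simp
  | succ n ih =>
    have h1 : f (a, n) = true ↔ p a n := h (a, n)
    rw [Nat.forall_lt_succ_right, ← ih, ← h1]
    change (bif f (a, n) then (Nat.rec true (fun i b => bif f (a, i) then b else false) n : Bool)
      else false) = true ↔ _
    cases f (a, n) <;> simp

@[fun_prop]
theorem cPred_le {f g : α → ℕ} (hf : Computable f) (hg : Computable g) :
    CPred fun a => f a ≤ g a :=
  ⟨fun a => decide (f a ≤ g a), (Primrec.nat_le.decide.to_comp.comp hf hg), fun a => by simp⟩

@[fun_prop]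
theorem cPred_lt {f g : α → ℕ} (hf : Computable f) (hg : Computable g) :
    CPred fun a => f a < g a :=
  ⟨fun a => decide (f a < g a), (Primrec.nat_lt.decide.to_comp.comp hf hg), fun a => by simp⟩

@[fun_prop]
theorem cPred_eq {f g : α → ℕ} (hf : Computable f) (hg : Computable g) :
    CPred fun a => f a = g a :=
  ⟨fun a => decide (f a = g a), (Primrec.eq.decide.to_comp.comp hf hg), fun a => by simp⟩

/-- An unbounded search for a witness of a decidable predicate. -/
theorem exists_search {p : α → β → Prop} (hp : CPred fun q : α × β => p q.1 q.2) {v : α → β → γ}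
    (hv : Computable fun q : α × β => v q.1 q.2) : ∃ δ : α →. γ, Partrec δ ∧
      ∀ a, (∃ w, p a w) → ∃ c ∈ δ a, ∃ w, p a w ∧ c = v a w := by
  obtain ⟨g, hg, h⟩ := hp
  let s : α → ℕ → Option γ := fun a n => (Encodable.decode (α := β) n).bind fun w =>
    bif g (a, w) then some (v a w) else none
  have hs : Computable₂ s := by
    refine Computable.option_bind (Computable.decode.comp Computable.snd)
      (.mk (Computable.cond ?_ ?_ (Computable.const none)))
    · exact hg.comp (g := fun q : (α × ℕ) × β => (q.1.1, q.2)) (by fun_prop)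
    · exact Computable.option_some.comp
        (hv.comp (g := fun q : (α × ℕ) × β => (q.1.1, q.2)) (by fun_prop))
  refine ⟨_, Partrec.rfindOpt hs, fun a ⟨w, hw⟩ => ?_⟩
  have hdom : (Nat.rfindOpt (s a)).Dom := Nat.rfindOpt_dom.2 ⟨Encodable.encode w, v a w, by
    simp only [s, Encodable.encodek]
    change (bif g (a, w) then some (v a w) else none) = _
    rw [(h (a, w)).2 hw]; rfl⟩
  refine ⟨_, Part.get_mem hdom, ?_⟩
  obtain ⟨n, hn⟩ := Nat.rfindOpt_spec (Part.get_mem hdom)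
  obtain ⟨w', -, hw'⟩ := Option.bind_eq_some_iff.1 hn
  refine ⟨w', (h (a, w')).1 ?_, ?_⟩
  · by_contra hc
    rw [Bool.not_eq_true] at hc
    rw [hc] at hw'
    cases hw'
  · cases hg' : g (a, w') with
    | false => rw [hg'] at hw'; cases hw'
    | true => rw [hg'] at hw'; exact (Option.some.inj hw').symm

variable (F) in
/-- A computable presentation of `K`. -/
structure Pres where
  ν : ℕ → K F
  isComp : IsComputablePresentation ν

variable (p : Pres F)

/-- A computable family of elements of `K`. -/
@[fun_prop]
def KComp (f : α → K F) : Prop := ∃ g : α → ℕ, Computable g ∧ ∀ a, p.ν (g a) = f a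

variable {p}

namespace KComp

@[fun_prop]
theorem const (x : K F) : KComp p fun _ : α => x := by
  obtain ⟨n, hn⟩ := p.isComp.surj x
  exact ⟨fun _ => n, by fun_prop, fun _ => hn⟩

theorem num {g : α → ℕ} (hg : Computable g) : KComp p fun a => p.ν (g a) := ⟨g, hg, fun _ => rfl⟩

@[fun_prop]
theorem comp {f : β → K F} {g : α → β} (hf : KComp p f) (hg : Computable g) :
    KComp p fun a => f (g a) := by
  obtain ⟨q, hq, h⟩ := hf
  exact ⟨fun a => q (g a), hq.comp hg, fun a => h _⟩

theorem of_eq {f g : α → K F} (hf : KComp p f) (h : ∀ a, f a = g a) : KComp p g :=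
  (funext h : f = g) ▸ hf

@[fun_prop]
theorem add {f g : α → K F} (hf : KComp p f) (hg : KComp p g) : KComp p fun a => f a + g a := by
  obtain ⟨q, hq, h⟩ := hf
  obtain ⟨q', hq', h'⟩ := hg
  obtain ⟨s, hs, hadd⟩ := p.isComp.add
  exact ⟨fun a => s (q a, q' a), hs.comp (hq.pair hq'), fun a => by rw [hadd, h, h']⟩

@[fun_prop]
theorem mul {f g : α → K F} (hf : KComp p f) (hg : KComp p g) : KComp p fun a => f a * g a := by
  obtain ⟨q, hq, h⟩ := hf
  obtain ⟨q', hq', h'⟩ := hg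
  obtain ⟨s, hs, hmul⟩ := p.isComp.mul
  exact ⟨fun a => s (q a, q' a), hs.comp (hq.pair hq'), fun a => by rw [hmul, h, h']⟩

@[fun_prop]
theorem neg {f : α → K F} (hf : KComp p f) : KComp p fun a => -f a :=
  ((const (-1)).mul hf).of_eq fun _ => neg_one_mul _

@[fun_prop]
theorem sub {f g : α → K F} (hf : KComp p f) (hg : KComp p g) : KComp p fun a => f a - g a :=
  (hf.add hg.neg).of_eq fun _ => (sub_eq_add_neg _ _).symm

@[fun_prop]
theorem ite {c : α → Prop} [∀ a, Decidable (c a)] {f g : α → K F} (hc : CPred c) (hf : KComp p f)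
    (hg : KComp p g) : KComp p fun a => if c a then f a else g a := by
  obtain ⟨q, hq, h⟩ := hf
  obtain ⟨q', hq', h'⟩ := hg
  obtain ⟨e, he, hc⟩ := hc
  refine ⟨fun a => bif e a then q a else q' a, Computable.cond he hq hq', fun a => ?_⟩
  change p.ν (bif e a then q a else q' a) = if c a then f a else g a
  split_ifs with h1
  · rw [(hc a).2 h1, cond_true, h]
  · rw [Bool.eq_false_iff.2 (mt (hc a).1 h1), cond_false, h']

/-- Primitive recursion with values in `K`. -/
theorem natRec {n : α → ℕ} {f : α → K F} {g : α → ℕ → K F → K F} (hn : Computable n)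
    (hf : KComp p f) (hg : ∀ q : α × ℕ × ℕ → ℕ, Computable q →
      KComp p fun a : α × ℕ × ℕ => g a.1 a.2.1 (p.ν (q a))) :
    KComp p fun a => Nat.rec (f a) (g a) (n a) := by
  obtain ⟨q, hq, h⟩ := hf
  obtain ⟨s, hs, hs'⟩ := hg (fun a => a.2.2) (by fun_prop)
  refine ⟨fun a => Nat.rec (q a) (fun i y => s (a, i, y)) (n a),
    Computable.nat_rec (h := fun a y => s (a, y)) hn hq (.mk (by fun_prop)), fun a => ?_⟩
  beta_reduce
  induction n a with
  | zero => exact h a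
  | succ n ih => exact (hs' (a, n, _)).trans (congrArg (g a n) ih)

@[fun_prop]
theorem sum {n : α → ℕ} {f : α → ℕ → K F} (hn : Computable n)
    (hf : KComp p fun q : α × ℕ => f q.1 q.2) :
    KComp p fun a => ∑ i ∈ Finset.range (n a), f a i := by
  refine (natRec (f := fun _ => 0) (g := fun a i y => y + f a i) hn (const 0) fun q hq =>
    (num hq).add (hf.comp (g := fun a : α × ℕ × ℕ => (a.1, a.2.1)) (by fun_prop))).of_eq fun a => ?_
  induction n a with
  | zero => rfl
  | succ n ih => rw [Finset.sum_range_succ, ← ih]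

@[fun_prop]
theorem pow {n : α → ℕ} {f : α → K F} (hf : KComp p f) (hn : Computable n) :
    KComp p fun a => f a ^ n a := by
  refine (natRec (f := fun _ => 1) (g := fun a _ y => y * f a) hn (const 1) fun q hq =>
    (num hq).mul (hf.comp (g := fun a : α × ℕ × ℕ => a.1) (by fun_prop))).of_eq fun a => ?_
  induction n a with
  | zero => rfl
  | succ n ih => rw [pow_succ, ← ih]

@[fun_prop]
theorem eq {f g : α → K F} (hf : KComp p f) (hg : KComp p g) : CPred fun a => f a = g a := by
  obtain ⟨q, hq, h⟩ := hf
  obtain ⟨q', hq', h'⟩ := hg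
  obtain ⟨_, hd⟩ := p.isComp.eq
  refine ⟨_, hd.comp (hq.pair hq'), fun a => ?_⟩
  rw [decide_eq_true_iff]
  change p.ν (q a) = p.ν (q' a) ↔ _
  rw [h, h']

end KComp

variable (p) in
/-- A computable family of elements of `R`: the coefficients are computable, and there is a
computable bound for the degrees. -/
@[fun_prop]
def RComp (f : α → R F) : Prop := ∃ N : α → ℕ, Computable N ∧ (∀ a, DegLT (f a) (N a)) ∧
  KComp p fun q : α × ℕ => coeff (f q.1) q.2

@[fun_prop]
theorem RComp.coeff {f : α → R F} (hf : RComp p f) {n : α → ℕ} (hn : Computable n) :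
    KComp p fun a => coeff (f a) (n a) := by
  obtain ⟨N, hN, hdeg, h⟩ := hf
  exact h.comp (g := fun a => (a, n a)) (by fun_prop)

namespace RComp

@[fun_prop]
theorem comp {f : β → R F} {g : α → β} (hf : RComp p f) (hg : Computable g) :
    RComp p fun a => f (g a) := by
  obtain ⟨N, hN, hdeg, h⟩ := hf
  exact ⟨fun a => N (g a), hN.comp hg, fun a => hdeg _,
    h.comp (g := fun q : α × ℕ => (g q.1, q.2)) (by fun_prop)⟩

theorem of_eq {f g : α → R F} (hf : RComp p f) (h : ∀ a, f a = g a) : RComp p g :=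
  (funext h : f = g) ▸ hf

@[fun_prop]
theorem add {f g : α → R F} (hf : RComp p f) (hg : RComp p g) : RComp p fun a => f a + g a := by
  obtain ⟨N, hN, hdeg, h⟩ := hf
  obtain ⟨N', hN', hdeg', h'⟩ := hg
  refine ⟨fun a => N a + N' a, by fun_prop, fun a i hi => ?_,
    (h.add h').of_eq fun q => (coeff_add _ _ _).symm⟩
  beta_reduce at hi ⊢
  rw [coeff_add, hdeg a i (by omega), hdeg' a i (by omega), add_zero]

@[fun_prop]
theorem mono {n : α → ℕ} {f : α → K F} (hn : Computable n) (hf : KComp p f) :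
    RComp p fun a => mono (n a) (f a) := by
  refine ⟨fun a => n a + 1, by fun_prop, fun a i hi => ?_, ?_⟩
  · beta_reduce at hi
    rw [coeff_mono, if_neg (by omega)]
  · simp only [coeff_mono]
    fun_prop

@[fun_prop]
theorem mul {f g : α → R F} (hf : RComp p f) (hg : RComp p g) : RComp p fun a => f a * g a := by
  obtain ⟨N, hN, hdeg, h⟩ := hf
  obtain ⟨N', hN', hdeg', h'⟩ := hg
  refine ⟨fun a => N a + N' a, by fun_prop, fun a => degLT_mul (hdeg a) (hdeg' a), ?_⟩
  simp only [coeff_mul]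
  refine KComp.sum (by fun_prop) ((KComp.pow ?_ (by fun_prop)).mul ?_)
  · exact h.comp (g := fun q : (α × ℕ) × ℕ => (q.1.1, q.2)) (by fun_prop)
  · exact h'.comp (g := fun q : (α × ℕ) × ℕ => (q.1.1, q.1.2 - q.2)) (by fun_prop)

@[fun_prop]
theorem const (r : R F) : RComp p fun _ : α => r := by
  induction r using R_induction with
  | h0 => exact ⟨fun _ => 0, by fun_prop, fun a i _ => rfl, KComp.const 0⟩
  | hadd r s h h' => exact h.add h'
  | hm j b => fun_prop

@[fun_prop]
theorem neg {f : α → R F} (hf : RComp p f) : RComp p fun a => -f a :=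
  ((const (-1)).mul hf).of_eq fun _ => neg_one_mul _

@[fun_prop]
theorem sub {f g : α → R F} (hf : RComp p f) (hg : RComp p g) : RComp p fun a => f a - g a :=
  (hf.add hg.neg).of_eq fun _ => (sub_eq_add_neg _ _).symm

@[fun_prop]
theorem ite {c : α → Prop} [∀ a, Decidable (c a)] {f g : α → R F} (hc : CPred c) (hf : RComp p f)
    (hg : RComp p g) : RComp p fun a => if c a then f a else g a := by
  obtain ⟨N, hN, hdeg, h⟩ := hf
  obtain ⟨N', hN', hdeg', h'⟩ := hg
  refine ⟨fun a => N a + N' a, by fun_prop, fun a i hi => ?_,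
    (KComp.ite (c := fun q : α × ℕ => c q.1) (hc.comp (by fun_prop)) h h').of_eq fun q => ?_⟩
  · beta_reduce at hi ⊢
    split_ifs
    · exact hdeg a i (by omega)
    · exact hdeg' a i (by omega)
  · beta_reduce
    split_ifs <;> rfl

@[fun_prop]
theorem sum {n : α → ℕ} {f : α → ℕ → R F} (hn : Computable n)
    (hf : RComp p fun q : α × ℕ => f q.1 q.2) :
    RComp p fun a => ∑ i ∈ Finset.range (n a), f a i := by
  obtain ⟨N, hN, hdeg, h⟩ := hf
  refine ⟨fun a => Nat.rec 0 (fun i y => N (a, i) + y) (n a),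
    Computable.nat_rec (h := fun a q => N (a, q.1) + q.2) hn (by fun_prop) (.mk (by fun_prop)),
    fun a => ?_, ?_⟩
  · beta_reduce
    induction n a with
    | zero => exact fun _ _ => rfl
    | succ n ih =>
      intro i hi
      change N (a, n) + Nat.rec 0 (fun i y => N (a, i) + y) n ≤ i at hi
      rw [Finset.sum_range_succ, coeff_add, ih i (by omega), hdeg (a, n) i (by omega), add_zero]
  · simp only [coeff_sum]
    refine KComp.sum (by fun_prop) ?_
    exact h.comp (g := fun q : (α × ℕ) × ℕ => ((q.1.1, q.2), q.1.2)) (by fun_prop)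

@[fun_prop]
theorem eq {f g : α → R F} (hf : RComp p f) (hg : RComp p g) : CPred fun a => f a = g a := by
  have h := hf.sub hg
  obtain ⟨N, hN, hdeg, hc⟩ := h
  refine (CPred.bAll (n := N) (p := fun a i => HenselMod.coeff (f a - g a) i = 0) hN
    (hc.eq (KComp.const 0))).of_iff fun a => ?_
  rw [← sub_eq_zero]
  refine ⟨fun h i _ => ?_, fun h => R_ext fun i => ?_⟩
  · exact (congrArg (fun r => HenselMod.coeff r i) h).trans (coeff_zero i)
  rcases lt_or_ge i (N a) with hi | hi
  · exact h i hi
  · exact hdeg a i hi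

@[fun_prop]
theorem ofCodes {f : α → List ℕ} (hf : Computable f) : RComp p fun a => ofCodes p.ν (f a) := by
  refine ⟨fun a => (f a).length, by fun_prop, fun a => degLT_ofFun _ _, ?_⟩
  simp only [HenselMod.ofCodes, coeff_ofFun]
  exact KComp.ite (by fun_prop) (KComp.num (by fun_prop)) (KComp.const 0)

theorem exists_codes {f : α → R F} (hf : RComp p f) :
    ∃ l : α → List ℕ, Computable l ∧ ∀ a, HenselMod.ofCodes p.ν (l a) = f a := by
  obtain ⟨N, hN, hdeg, q, hq, h⟩ := hf
  refine ⟨fun a => (List.range (N a)).map fun i => q (a, i),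
    (exists_table (f := fun a i => q (a, i)) hq).comp (g := fun a => (a, N a)) (by fun_prop),
    fun a => R_ext fun i => ?_⟩
  rw [HenselMod.ofCodes, coeff_ofFun]
  simp only [List.length_map, List.length_range]
  split_ifs with hi
  · have h1 : p.ν (q (a, i)) = HenselMod.coeff (f a) i := h (a, i)
    rw [← h1]
    simp [List.getD, hi]
  · exact (hdeg a i (not_lt.1 hi)).symm

/-- Course-of-values recursion with values in `R`. -/
theorem strongRec {f : α → ℕ → R F} {g : α → ℕ → (ℕ → R F) → R F}
    (h : ∀ a n, f a n = g a n fun i => if i < n then f a i else 0)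
    (hg : RComp p fun q : α × List (List ℕ) =>
      g q.1 q.2.length fun i => HenselMod.ofCodes p.ν (q.2.getD i [])) :
    RComp p fun q : α × ℕ => f q.1 q.2 := by
  obtain ⟨l, hl, hlg⟩ := hg.exists_codes
  let tbl : α → ℕ → List (List ℕ) := fun a n => Nat.rec [] (fun _ t => t ++ [l (a, t)]) n
  have htbl : Computable fun q : α × ℕ => tbl q.1 q.2 :=
    Computable.nat_rec (f := fun q : α × ℕ => q.2) (g := fun _ => [])
      (h := fun q t => t.2 ++ [l (q.1, t.2)]) (by fun_prop) (by fun_prop)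
      (.mk (Computable.list_concat.comp (by fun_prop) (by fun_prop)))
  have hlen : ∀ a n, (tbl a n).length = n := fun a n => by
    induction n with
    | zero => rfl
    | succ n ih => exact (List.length_append).trans (congrArg (· + 1) ih)
  have key : ∀ a n, (∀ i, HenselMod.ofCodes p.ν ((tbl a n).getD i []) =
      if i < n then f a i else 0) := by
    intro a n
    induction n with
    | zero => intro i; rfl
    | succ n ih =>
      intro i
      have e : tbl a (n + 1) = tbl a n ++ [l (a, tbl a n)] := rfl
      rw [e]
      rcases lt_trichotomy i n with hi | rfl | hi
      · rw [List.getD_append _ _ _ _ (by rw [hlen]; exact hi), ih, if_pos hi, if_pos (by omega)]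
      · rw [List.getD_append_right _ _ _ _ (by rw [hlen]), hlen, Nat.sub_self, if_pos (by omega)]
        change HenselMod.ofCodes p.ν (l (a, tbl a i)) = _
        rw [hlg, h a i]
        simp only [hlen]
        exact congrArg _ (funext fun i => ih i)
      · rw [List.getD_eq_default _ _ (by
          rw [List.length_append, hlen, List.length_singleton]; omega), if_neg (by omega)]
        rfl
  refine ((ofCodes (f := fun q : α × ℕ => l (q.1, tbl q.1 q.2)) (by fun_prop))).of_eq fun q => ?_
  rw [hlg, h]
  simp only [hlen]
  exact congrArg _ (funext fun i => key _ _ i)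

end RComp

end Comp

/-! ### Certificates -/

section Cert

variable {α : Type*} [Primcodable α] {p : Pres F}

@[fun_prop]
theorem CPred.not {q : α → Prop} (hq : CPred q) : CPred fun a => ¬ q a := by
  obtain ⟨g, hg, h⟩ := hq
  refine ⟨fun a => bif g a then false else true,
    Computable.cond hg (by fun_prop) (by fun_prop), fun a => ?_⟩
  change (bif g a then false else true) = true ↔ ¬ q a
  rw [← h]
  cases g a <;> simp

@[fun_prop]
theorem CPred.isSeparable {f : α → R F} (hf : RComp p f) : CPred fun a => IsSeparable (f a) :=
  ((hf.coeff (Computable.const 0)).eq (KComp.const 0)).not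

@[fun_prop]
theorem RComp.sum_finset {ι : Type*} {s : Finset ι} {f : α → ι → R F}
    (hf : ∀ i, RComp p fun a => f a i) : RComp p fun a => ∑ i ∈ s, f a i := by
  classical
  induction s using Finset.induction_on with
  | empty => exact RComp.const 0
  | insert i s hi ih =>
    simp only [Finset.sum_insert hi]
    exact (hf i).add ih

@[fun_prop]
theorem computable_decodeList {f : α → ℕ} (hf : Computable f) :
    Computable fun a => (Encodable.decode (α := List ℕ) (f a)).getD [] :=
  Computable.option_getD (Computable.decode.comp hf) (Computable.const [])

@[fun_prop]
theorem rComp_scal {f : α → ℕ} (hf : Computable f) : RComp p fun a => scal p.ν (f a) := by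
  unfold scal
  fun_prop

@[fun_prop]
theorem rComp_lin {f g : α → ℕ} (hf : Computable f) (hg : Computable g) :
    RComp p fun a => lin p.ν (f a) (g a) := by
  refine RComp.comp (f := fun q : ℕ × ℕ => lin p.ν q.1 q.2) (g := fun a => (f a, g a))
    (RComp.strongRec (g := fun v c T => linStep p.ν v c T) (fun v c => ?_) ?_) (by fun_prop)
  · rw [lin]
    simp only [dite_eq_ite]
  · unfold linStep
    fun_prop

@[fun_prop]
theorem rComp_eqForm {f g : α → ℕ} (hf : Computable f) (hg : Computable g) :
    RComp p fun a => eqForm p.ν (f a) (g a) := by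
  unfold eqForm
  fun_prop

@[fun_prop]
theorem rComp_memForm {f g : α → ℕ} (hf : Computable f) (hg : Computable g) :
    RComp p fun a => memForm p.ν (f a) (g a) := by
  unfold memForm
  fun_prop

@[fun_prop]
theorem computable_numVar {c : α → ℕ} (hc : Computable c) : Computable fun a => numVar (c a) := by
  unfold numVar
  fun_prop

@[fun_prop]
theorem computable_numEq {c : α → ℕ} (hc : Computable c) : Computable fun a => numEq (c a) := by
  unfold numEq atoms
  fun_prop

@[fun_prop]
theorem rComp_colA {c j v : α → ℕ} (hc : Computable c) (hj : Computable j) (hv : Computable v) :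
    RComp p fun a => colA p.ν (c a) (j a) (v a) := by
  unfold colA atoms
  fun_prop

@[fun_prop]
theorem rComp_colB {c j v : α → ℕ} (hc : Computable c) (hj : Computable j) (hv : Computable v) :
    RComp p fun a => colB p.ν (c a) (j a) (v a) := by
  unfold colB atoms
  fun_prop

@[fun_prop]
theorem rComp_memA {c j v : α → ℕ} (hc : Computable c) (hj : Computable j) (hv : Computable v) :
    RComp p fun a => memA p.ν (c a) (j a) (v a) := by
  unfold memA atoms
  fun_prop

@[fun_prop]
theorem rComp_memB {c j v : α → ℕ} (hc : Computable c) (hj : Computable j) (hv : Computable v) :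
    RComp p fun a => memB p.ν (c a) (j a) (v a) := by
  unfold memB atoms
  fun_prop

/-- Certificates: a list of parameters, a table of elements of `R` given by the numbers of their
coefficients, and a table showing that these coefficients have bounded valuations. -/
abbrev Cert : Type := List ℕ × List (List ℕ) × List (List ℕ)

namespace Cert

variable (p)

/-- The `(i, j)`-th element of `R` with the tag `t`; the tag tells the families of data apart. -/
def entry (w : Cert) (t i j : ℕ) : R F := ofCodes p.ν (w.2.1.getD (Nat.pair t (Nat.pair i j)) [])

/-- The bound for the valuations. -/
def bound (w : Cert) : ℕ := w.1.getD 2 0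

/-- The valuations of all coefficients `a` in the table are at least `-β`, as there is a `b` with
`b - b ^ d = X ^ (1 + d β) a ^ d`. -/
def Small (w : Cert) : Prop :=
  BAll w.2.1.length fun n => BAll (w.2.1.getD n []).length fun i =>
    coeff (ofCodes p.ν (w.2.2.getD n [])) i - coeff (ofCodes p.ν (w.2.2.getD n [])) i ^ d F =
      unif F ^ (1 + d F * w.bound) * coeff (ofCodes p.ν (w.2.1.getD n [])) i ^ d F

/-- The saturation given by a certificate. -/
def sat (w : Cert) : Sat F where
  s := w.1.getD 0 0
  n' := w.1.getD 1 0
  a j i := coeff (w.entry p 0 j i) 0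
  b := w.entry p 1
  h i l := coeff (w.entry p 2 i l) 0
  C := w.entry p 3

/-- The elimination given by a certificate. -/
def elim (w : Cert) : Elim F where
  toSat := w.sat p
  G := w.entry p 4
  U := w.entry p 5
  V := w.entry p 6
  sd v := w.entry p 7 v 0
  sd' v := w.entry p 8 v 0

/-- The consequences up to torsion given by a certificate. -/
def trans (w : Cert) : Trans F where
  toSat := w.sat p
  z := w.entry p 4
  r j := w.entry p 5 j 0

/-- The certificate is correct for the elimination from the formula with the code `c`. -/
structure ElimOK (m c : ℕ) (w : Cert) : Prop where
  small : w.Small p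
  valid : (w.elim p).Valid (numVar c) (numEq c) (colB p.ν c)
  inv : BAll (numVar c) fun v => coeff (w.entry p 7 v 0) 0 * coeff (w.entry p 9 v 0) 0 = 1 ∧
    coeff (w.entry p 8 v 0) 0 * coeff (w.entry p 10 v 0) 0 = 1
  colA : BAll (numEq c) fun j => BAll m fun i =>
    w.entry p 11 j i = colA p.ν c j i ∧ w.entry p 12 j i = memA p.ν c j i
  memB : BAll (numEq c) fun j => BAll (numVar c) fun v => w.entry p 13 j v = memB p.ν c j v

/-- The certificates are correct for the implication between the formulas with the codes `c` and
`c₁`. -/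
structure ImpOK (m c c₁ : ℕ) (w : Cert × Cert) : Prop where
  elim : w.1.ElimOK p m c₁
  small : w.2.Small p
  valid : (w.2.trans p).Valid (m + numVar c + (numEq c₁ + d F * (w.1.elim p).s))
    (numEq c + numEq c₁ + (w.1.elim p).s)
    (relCol m (numVar c) (numEq c) (numEq c₁) (HenselMod.colA p.ν c) (colB p.ν c)
      (HenselMod.colA p.ν c₁) (w.1.elim p).a) (numEq c₁) (goalCol m (numVar c) (w.1.elim p))
  inv : BAll (numEq c₁) fun j => coeff (w.2.entry p 5 j 0) 0 * coeff (w.2.entry p 6 j 0) 0 = 1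

variable {p}

/-! #### Decidability -/

@[fun_prop]
theorem rComp_entry {w : α → Cert} {t : ℕ} {i j : α → ℕ} (hw : Computable w) (hi : Computable i)
    (hj : Computable j) : RComp p fun a => (w a).entry p t (i a) (j a) := by
  unfold entry
  fun_prop

@[fun_prop]
theorem computable_bound {w : α → Cert} (hw : Computable w) : Computable fun a => (w a).bound := by
  unfold bound
  fun_prop

@[fun_prop]
theorem cPred_small {w : α → Cert} (hw : Computable w) : CPred fun a => (w a).Small p := by
  unfold Small
  fun_prop

theorem cPred_valid_sat {w : α → Cert} (hw : Computable w) {k n : α → ℕ} (hk : Computable k)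
    (hn : Computable n) {B : α → ℕ → ℕ → R F}
    (hB : RComp p fun q : (α × ℕ) × ℕ => B q.1.1 q.1.2 q.2) :
    CPred fun a => ((w a).sat p).Valid (k a) (n a) (B a) := by
  refine CPred.of_iff (p := fun a =>
    BAll (n a) (fun i => BAll (k a) fun v => (w a).entry p 1 i v = B a i v) ∧
    BAll ((w a).1.getD 0 0) (fun j => BAll (k a) fun v =>
      ∑ i ∈ Finset.range (n a + d F * j),
        (w a).entry p 1 i v * mono 0 (coeff ((w a).entry p 0 j i) 0) =
      ∑ e : Fin (d F), (w a).entry p 1 (n a + d F * j + e) v * tE e) ∧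
    BAll ((w a).1.getD 1 0) fun l => BAll (k a) fun v => (w a).entry p 3 l v =
      ∑ i ∈ Finset.range (n a + d F * (w a).1.getD 0 0),
        (w a).entry p 1 i v * mono 0 (coeff ((w a).entry p 2 i l) 0)) ?_
    fun a => ⟨fun h => ⟨h.init, h.run, h.col⟩, fun h => ⟨h.1, h.2.1, h.2.2⟩⟩
  refine CPred.and (CPred.bAll hn (CPred.bAll (by fun_prop) (RComp.eq (by fun_prop) hB)))
    (CPred.and ?_ ?_)
  · refine CPred.bAll (by fun_prop) (CPred.bAll (by fun_prop) (RComp.eq (by fun_prop)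
      (RComp.sum_finset fun e => ?_)))
    fun_prop
  · fun_prop

theorem cPred_elimOK {m c : α → ℕ} {w : α → Cert} (hm : Computable m) (hc : Computable c)
    (hw : Computable w) : CPred fun a => (w a).ElimOK p (m a) (c a) := by
  have h := cPred_valid_sat (p := p) (k := fun a => numVar (c a)) (n := fun a => numEq (c a))
    (B := fun a => colB p.ν (c a)) hw (by fun_prop) (by fun_prop) (by fun_prop)
  refine CPred.of_iff (p := fun a => (w a).Small p ∧
    (((w a).sat p).Valid (numVar (c a)) (numEq (c a)) (colB p.ν (c a)) ∧
      (w a).1.getD 1 0 ≤ numVar (c a) ∧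
      BAll (numEq (c a)) (fun j => BAll (numVar (c a)) fun v => colB p.ν (c a) j v =
        ∑ l ∈ Finset.range ((w a).1.getD 1 0), (w a).entry p 3 l v * (w a).entry p 4 l j) ∧
      BAll (numVar (c a)) (fun i => BAll (numVar (c a)) fun v =>
        ∑ l ∈ Finset.range (numVar (c a)), (w a).entry p 3 l v * (w a).entry p 5 i l =
          if v = i then (w a).entry p 7 i 0 else 0) ∧
      BAll (numVar (c a)) (fun i => BAll (numVar (c a)) fun l =>
        ∑ v ∈ Finset.range (numVar (c a)), (w a).entry p 5 v l * (w a).entry p 6 i v =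
          if l = i then (w a).entry p 8 i 0 else 0) ∧
      BAll (numVar (c a)) (fun v => IsSeparable ((w a).entry p 7 v 0)) ∧
      BAll (numVar (c a)) (fun v => IsSeparable ((w a).entry p 8 v 0))) ∧
    BAll (numVar (c a)) (fun v =>
      coeff ((w a).entry p 7 v 0) 0 * coeff ((w a).entry p 9 v 0) 0 = 1 ∧
      coeff ((w a).entry p 8 v 0) 0 * coeff ((w a).entry p 10 v 0) 0 = 1) ∧
    BAll (numEq (c a)) (fun j => BAll (m a) fun i =>
      (w a).entry p 11 j i = HenselMod.colA p.ν (c a) j i ∧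
        (w a).entry p 12 j i = memA p.ν (c a) j i) ∧
    BAll (numEq (c a)) fun j => BAll (numVar (c a)) fun v =>
      (w a).entry p 13 j v = HenselMod.memB p.ν (c a) j v) (by fun_prop)
    fun a => ⟨fun h => ⟨h.small, ⟨h.valid.toValid, h.valid.le, h.valid.span, h.valid.diag,
      h.valid.diag', h.valid.sep, h.valid.sep'⟩, h.inv, h.colA, h.memB⟩,
      fun ⟨h1, ⟨h2, h3, h4, h5, h6, h7, h8⟩, h9, h10, h11⟩ =>
        ⟨h1, { toValid := h2, le := h3, span := h4, diag := h5, diag' := h6, sep := h7, sep' := h8 },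
          h9, h10, h11⟩⟩

@[fun_prop]
theorem rComp_goalCol {m k j v : α → ℕ} {w : α → Cert} (hm : Computable m) (hk : Computable k)
    (hw : Computable w) (hj : Computable j) (hv : Computable v) :
    RComp p fun a => goalCol (m a) (k a) ((w a).elim p) (j a) (v a) := by
  have h : RComp p fun a => ∑ l ∈ Finset.range ((w a).1.getD 1 0),
      mono 0 (coeff ((w a).entry p 2 (v a - m a - k a) l) 0) * (w a).entry p 4 l (j a) := by
    fun_prop
  have h' : RComp p fun a => if v a - m a - k a = j a then (1 : R F) else 0 := by
    fun_prop
  exact RComp.ite (by fun_prop) (by fun_prop) (RComp.ite (by fun_prop) (by fun_prop) (h.sub h'))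

theorem cPred_impOK {m c c₁ : α → ℕ} {w : α → Cert × Cert} (hm : Computable m)
    (hc : Computable c) (hc₁ : Computable c₁) (hw : Computable w) :
    CPred fun a => ImpOK p (m a) (c a) (c₁ a) (w a) := by
  have h0 := cPred_elimOK (p := p) (w := fun a => (w a).1) hm hc₁ (by fun_prop)
  have h := cPred_valid_sat (p := p) (w := fun a => (w a).2)
    (k := fun a => m a + numVar (c a) + (numEq (c₁ a) + d F * (w a).1.1.getD 0 0))
    (n := fun a => numEq (c a) + numEq (c₁ a) + (w a).1.1.getD 0 0)
    (B := fun a => relCol (m a) (numVar (c a)) (numEq (c a)) (numEq (c₁ a))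
      (HenselMod.colA p.ν (c a)) (colB p.ν (c a)) (HenselMod.colA p.ν (c₁ a))
      fun j i => coeff ((w a).1.entry p 0 j i) 0)
    (by fun_prop) (by fun_prop) (by fun_prop)
    (by simp only [relCol, split3, stepCol]; fun_prop)
  refine CPred.of_iff (p := fun a => (w a).1.ElimOK p (m a) (c₁ a) ∧ (w a).2.Small p ∧
    (((w a).2.sat p).Valid (m a + numVar (c a) + (numEq (c₁ a) + d F * (w a).1.1.getD 0 0))
      (numEq (c a) + numEq (c₁ a) + (w a).1.1.getD 0 0)
      (relCol (m a) (numVar (c a)) (numEq (c a)) (numEq (c₁ a))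
        (HenselMod.colA p.ν (c a)) (colB p.ν (c a)) (HenselMod.colA p.ν (c₁ a))
        fun j i => coeff ((w a).1.entry p 0 j i) 0) ∧
      BAll (numEq (c₁ a)) (fun j =>
        BAll (m a + numVar (c a) + (numEq (c₁ a) + d F * (w a).1.1.getD 0 0)) fun v =>
          goalCol (m a) (numVar (c a)) ((w a).1.elim p) j v * (w a).2.entry p 5 j 0 =
            ∑ l ∈ Finset.range ((w a).2.1.getD 1 0),
              (w a).2.entry p 3 l v * (w a).2.entry p 4 l j) ∧
      BAll (numEq (c₁ a)) fun j => IsSeparable ((w a).2.entry p 5 j 0)) ∧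
    BAll (numEq (c₁ a)) fun j =>
      coeff ((w a).2.entry p 5 j 0) 0 * coeff ((w a).2.entry p 6 j 0) 0 = 1)
    (h0.and (CPred.and (by fun_prop) (CPred.and (h.and
      (CPred.and (by fun_prop) (by fun_prop)))
        (by fun_prop))))
    fun a => ⟨fun h => ⟨h.elim, h.small, ⟨h.valid.toValid, h.valid.rel, h.valid.sep⟩, h.inv⟩,
      fun ⟨h1, h2, ⟨h3, h4, h5⟩, h6⟩ => ⟨h1, h2, { toValid := h3, rel := h4, sep := h5 }, h6⟩⟩

end Cert

end Cert

/-! ### Soundness and completeness of certificates -/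

section CertSpec

variable {p : Pres F}

theorem val_le_of_mul_eq_one {a b : K F} {β : ℕ} (h : a * b = 1)
    (hb : ((-β : ℤ) : WithTop ℤ) ≤ val b) : val a ≤ β := by
  obtain ⟨n, hn⟩ := exists_val_eq (left_ne_zero_of_mul_eq_one h)
  obtain ⟨k, hk⟩ := exists_val_eq (right_ne_zero_of_mul_eq_one h)
  have h1 := congrArg val h
  rw [val_mul, val_one, hn, hk, ← WithTop.coe_add, ← WithTop.coe_zero, WithTop.coe_inj] at h1
  rw [hk, WithTop.coe_le_coe] at hb
  rw [hn]
  exact_mod_cast (by omega : n ≤ β)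

theorem ValGe.mono {r : R F} {β β' : ℕ} (h : ValGe β r) (hβ : β ≤ β') : ValGe β' r :=
  fun i => le_trans (WithTop.coe_le_coe.2 (by omega)) (h i)

theorem ValGe.mono_zero {r : R F} {β : ℕ} (h : ValGe β r) (n : ℕ) :
    ValGe β (HenselMod.mono 0 (coeff r n) : R F) := by
  intro i
  rw [coeff_mono]
  split_ifs
  · exact h n
  · rw [val_zero]; exact le_top

theorem exists_valGe (r : R F) : ∃ β, ValGe β r := by
  obtain ⟨N, hN⟩ := exists_degLT r
  have h1 : ∀ a : K F, ∃ β : ℕ, ((-β : ℤ) : WithTop ℤ) ≤ val a := fun a => by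
    by_cases ha : a = 0
    · exact ⟨0, by rw [ha, val_zero]; exact le_top⟩
    · obtain ⟨n, hn⟩ := exists_val_eq ha
      exact ⟨n.natAbs, by rw [hn, WithTop.coe_le_coe]; omega⟩
  choose b hb using h1
  refine ⟨∑ i ∈ Finset.range N, b (coeff r i), fun i => ?_⟩
  rcases lt_or_ge i N with hi | hi
  · refine le_trans (WithTop.coe_le_coe.2 ?_) (hb _)
    have := Finset.single_le_sum (f := fun i => b (coeff r i)) (fun _ _ => Nat.zero_le _)
      (Finset.mem_range.2 hi)
    beta_reduce at this
    omega
  · rw [hN i hi, val_zero]; exact le_top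

namespace Cert

theorem Small.valGe {w : Cert} (h : w.Small p) (t i j : ℕ) :
    ValGe w.bound (w.entry p t i j) := by
  unfold entry
  generalize Nat.pair t (Nat.pair i j) = n
  intro e
  rcases lt_or_ge e (w.2.1.getD n []).length with he | he
  · rcases lt_or_ge n w.2.1.length with hn | hn
    · exact le_val_of_sub_pow_eq (h n hn e he)
    · rw [List.getD_eq_default _ _ hn] at he
      exact absurd he (Nat.not_lt_zero e)
  · rw [ofCodes, coeff_ofFun, if_neg (not_lt.2 he), val_zero]
    exact le_top

theorem ElimOK.bounded {m c : ℕ} {w : Cert} (h : w.ElimOK p m c) :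
    (w.elim p).Bounded (numVar c) w.bound where
  a j i := (h.small.valGe 0 j i).mono_zero 0
  h i l := (h.small.valGe 2 i l).mono_zero 0
  C := h.small.valGe 3
  U := h.small.valGe 5
  sd v hv := ⟨h.small.valGe 7 v 0, val_le_of_mul_eq_one (h.inv v hv).1 (h.small.valGe 9 v 0 0)⟩
  sd' v hv := ⟨h.small.valGe 8 v 0, val_le_of_mul_eq_one (h.inv v hv).2 (h.small.valGe 10 v 0 0)⟩

theorem ElimOK.formBounded {m c : ℕ} {w : Cert} (h : w.ElimOK p m c) :
    FormBounded p.ν m c w.bound where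
  colA j hj i hi := (h.colA j hj i hi).1 ▸ h.small.valGe 11 j i
  memA j hj i hi := (h.colA j hj i hi).2 ▸ h.small.valGe 12 j i
  memB j hj v hv := h.memB j hj v hv ▸ h.small.valGe 13 j v

theorem ImpOK.impliesNear {m c c₁ : ℕ} {w : Cert × Cert} (h : ImpOK p m c c₁ w) :
    ImpliesNear p.ν m c c₁ (w.1.bound + w.2.bound) (w.1.elim p) (w.2.trans p) := by
  have h1 : w.1.bound ≤ w.1.bound + w.2.bound := by omega
  have h2 : w.2.bound ≤ w.1.bound + w.2.bound := by omega
  have hb := h.elim.bounded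
  have hf := h.elim.formBounded
  have hle : ∀ {a : WithTop ℤ} {β β' : ℕ}, a ≤ β → β ≤ β' → a ≤ β' := fun h h' =>
    h.trans (by exact_mod_cast h')
  exact
    { elim := h.elim.valid
      bounded :=
        { a := fun j i => (hb.a j i).mono h1
          h := fun i l => (hb.h i l).mono h1
          C := fun l v => (hb.C l v).mono h1
          U := fun l v => (hb.U l v).mono h1
          sd := fun v hv => ⟨(hb.sd v hv).1.mono h1, hle (hb.sd v hv).2 h1⟩
          sd' := fun v hv => ⟨(hb.sd' v hv).1.mono h1, hle (hb.sd' v hv).2 h1⟩ }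
      bounded_G := fun l j => (h.elim.small.valGe 4 l j).mono h1
      form :=
        { colA := fun j hj i hi => (hf.colA j hj i hi).mono h1
          memA := fun j hj i hi => (hf.memA j hj i hi).mono h1
          memB := fun j hj v hv => (hf.memB j hj v hv).mono h1 }
      trans := h.valid
      bounded_r := fun j hj => ⟨(h.small.valGe 5 j 0).mono h2,
        hle (val_le_of_mul_eq_one (h.inv j hj) (h.small.valGe 6 j 0 0)) h2⟩ }

/-- Coefficients have numbers, as the presentation of `K` is surjective. -/
theorem exists_list (p : Pres F) (N : ℕ) (f : ℕ → K F) :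
    ∃ l : List ℕ, l.length = N ∧ ∀ i, coeff (ofCodes p.ν l) i = if i < N then f i else 0 := by
  choose g hg using p.isComp.surj
  refine ⟨(List.range N).map fun i => g (f i), by simp, fun i => ?_⟩
  rw [ofCodes, coeff_ofFun]
  simp only [List.length_map, List.length_range]
  split_ifs with hi
  · simp [List.getD, hi, hg]
  · rfl

/-- Every finite table has a certificate. -/
theorem exists_tables (p : Pres F) (X : ℕ → R F) (L : ℕ) :
    ∃ (β : ℕ) (tb tb' : List (List ℕ)), ∀ l : List ℕ, l.getD 2 0 = β →
      Small p (l, tb, tb') ∧ ∀ n < L, ofCodes p.ν (tb.getD n []) = X n := by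
  choose N hN using fun n => exists_degLT (X n)
  choose B hB using fun n => exists_valGe (X n)
  set β := ∑ n ∈ Finset.range L, B n with hβ
  have hXβ : ∀ n < L, ValGe β (X n) := fun n hn => (hB n).mono
    (Finset.single_le_sum (f := B) (fun _ _ => Nat.zero_le _) (Finset.mem_range.2 hn))
  have hb : ∀ n i, ∃ b : K F, n < L →
      b - b ^ d F = unif F ^ (1 + d F * β) * coeff (X n) i ^ d F := fun n i => by
    by_cases hn : n < L
    · obtain ⟨b, hb⟩ := exists_sub_pow_eq (hXβ n hn i)
      exact ⟨b, fun _ => hb⟩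
    · exact ⟨0, fun h => absurd h hn⟩
  choose b hb using hb
  choose l hlen hl using fun n => exists_list p (N n) (coeff (X n))
  choose l' hlen' hl' using fun n => exists_list p (N n) (b n)
  have htb : ∀ f : ℕ → List ℕ, ∀ n < L, ((List.range L).map f).getD n [] = f n := fun f n hn => by
    simp [List.getD, hn]
  refine ⟨β, (List.range L).map l, (List.range L).map l', fun q hq => ⟨fun n hn i hi => ?_,
    fun n hn => ?_⟩⟩
  · have hn : n < L := by simpa using hn
    rw [htb l n hn, hlen] at hi
    simp only [htb l n hn, htb l' n hn, hl, hl', if_pos hi]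
    rw [hb n i hn, bound, hq]
  · rw [htb l n hn]
    refine R_ext fun i => ?_
    rw [hl]
    split_ifs with hi
    · rfl
    · exact (hN n i (not_lt.1 hi)).symm

theorem pair_le_pair {a b a' b' : ℕ} (ha : a ≤ a') (hb : b ≤ b') :
    Nat.pair a b ≤ Nat.pair a' b' := by
  have h1 : Nat.pair a b ≤ Nat.pair a' b := by
    rcases ha.eq_or_lt with rfl | h
    · exact le_rfl
    · exact (Nat.pair_lt_pair_left b h).le
  have h2 : Nat.pair a' b ≤ Nat.pair a' b' := by
    rcases hb.eq_or_lt with rfl | h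
    · exact le_rfl
    · exact (Nat.pair_lt_pair_right a' h).le
  exact h1.trans h2

/-- A certificate with given parameters and given elements of `R`. -/
theorem exists_cert (p : Pres F) (s n' T M : ℕ) (Y : ℕ → ℕ → ℕ → R F) :
    ∃ w : Cert, w.Small p ∧ w.1.getD 0 0 = s ∧ w.1.getD 1 0 = n' ∧
      ∀ t < T, ∀ i < M, ∀ j < M, w.entry p t i j = Y t i j := by
  obtain ⟨β, tb, tb', h⟩ := exists_tables p
    (fun n => Y n.unpair.1 n.unpair.2.unpair.1 n.unpair.2.unpair.2)
    (Nat.pair T (Nat.pair M M) + 1)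
  obtain ⟨h1, h2⟩ := h [s, n', β] rfl
  -- the index `(t, i, j)` is below the length of the table, as pairing is monotone
  refine ⟨_, h1, rfl, rfl, fun t ht i hi j hj => ?_⟩
  have h3 := h2 (Nat.pair t (Nat.pair i j))
    (Nat.lt_succ_of_le (pair_le_pair ht.le (pair_le_pair hi.le hj.le)))
  simp only [Nat.unpair_pair] at h3
  exact h3

end Cert

/-- Only the entries with indices below some bound matter, hence finite tables suffice. -/
theorem Sat.Valid.congr {E E' : Sat F} {k n M : ℕ} {B : ℕ → ℕ → R F} (h : E.Valid k n B)
    (hs : E'.s = E.s) (hn' : E'.n' = E.n') (hk : k ≤ M) (hn : n + d F * E.s ≤ M) (hM : E.s ≤ M)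
    (hM' : E.n' ≤ M) (ha : ∀ j < M, ∀ i < M, E'.a j i = E.a j i)
    (hb : ∀ i < M, ∀ v < M, E'.b i v = E.b i v) (hh : ∀ i < M, ∀ l < M, E'.h i l = E.h i l)
    (hC : ∀ l < M, ∀ v < M, E'.C l v = E.C l v) : E'.Valid k n B where
  init i hi v hv := by rw [hb i (by omega) v (by omega), h.init i hi v hv]
  run j hj v hv := by
    rw [hs] at hj
    have h1 : n + d F * j + d F ≤ n + d F * E.s := by
      have := Nat.mul_le_mul_left (d F) (Nat.succ_le_of_lt hj)
      rw [Nat.mul_succ] at this; omega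
    refine Eq.trans ?_ ((h.run j hj v hv).trans ?_)
    · refine Finset.sum_congr rfl fun i hi => ?_
      have := Finset.mem_range.1 hi
      rw [hb i (by omega) v (by omega), ha j (by omega) i (by omega)]
    · refine Finset.sum_congr rfl fun e _ => ?_
      have := e.2
      rw [hb _ (by omega) v (by omega)]
  col l hl v hv := by
    rw [hn'] at hl
    rw [hC l (by omega) v (by omega), h.col l hl v hv, hs]
    refine Finset.sum_congr rfl fun i hi => ?_
    have := Finset.mem_range.1 hi
    rw [hb i (by omega) v (by omega), hh i (by omega) l (by omega)]

namespace Cert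

/-- Every formula has a certificate for the elimination. -/
theorem exists_elimOK (p : Pres F) (m c : ℕ) : ∃ w : Cert, w.ElimOK p m c := by
  obtain ⟨E, hE⟩ := exists_elim (numVar c) (numEq c) (HenselMod.colB p.ν c)
  set k := numVar c
  set n := numEq c
  have hle := hE.le
  obtain ⟨w, hw, hs, hn', he⟩ := exists_cert p E.s E.n' 14 (k + n + d F * E.s + E.s + m + 1)
    fun t i j => match t with
      | 0 => mono 0 (E.a i j)
      | 1 => E.b i j
      | 2 => mono 0 (E.h i j)
      | 3 => E.C i j
      | 4 => E.G i j
      | 5 => E.U i j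
      | 6 => E.V i j
      | 7 => E.sd i
      | 8 => E.sd' i
      | 9 => mono 0 (coeff (E.sd i) 0)⁻¹
      | 10 => mono 0 (coeff (E.sd' i) 0)⁻¹
      | 11 => HenselMod.colA p.ν c i j
      | 12 => memA p.ν c i j
      | _ => HenselMod.memB p.ν c i j
  set M := k + n + d F * E.s + E.s + m + 1 with hM
  have hC := he 3 (by omega)
  have hG := he 4 (by omega)
  have hU := he 5 (by omega)
  have hV := he 6 (by omega)
  have hsd := fun i hi => he 7 (by omega) i hi 0 (by omega)
  have hsd' := fun i hi => he 8 (by omega) i hi 0 (by omega)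
  have hi := fun i hi => he 9 (by omega) i hi 0 (by omega)
  have hi' := fun i hi => he 10 (by omega) i hi 0 (by omega)
  simp only at hC hG hU hV hsd hsd' hi hi'
  refine ⟨w, hw,
    { toValid := ?_, le := ?_, span := ?_, diag := ?_, diag' := ?_, sep := ?_, sep' := ?_ },
    fun v hv => ⟨?_, ?_⟩, fun j hj i hi => ⟨?_, ?_⟩, fun j hj v hv => ?_⟩
  · refine hE.toValid.congr (M := M) hs hn' (by omega) (by omega) (by omega) (by omega)
      (fun j hj i hi => ?_) (he 1 (by omega)) (fun j hj i hi => ?_) hC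
    · exact (congrArg (coeff · 0) (he 0 (by omega) j hj i hi)).trans
          ((coeff_mono 0 _ 0).trans (if_pos rfl))
    · exact (congrArg (coeff · 0) (he 2 (by omega) j hj i hi)).trans
          ((coeff_mono 0 _ 0).trans (if_pos rfl))
  · exact hn'.le.trans hE.le
  · intro j hj v hv
    rw [hE.span j hj v hv, show (w.elim p).n' = E.n' from hn']
    refine Finset.sum_congr rfl fun l hl => ?_
    have := Finset.mem_range.1 hl
    change _ = w.entry p 3 l v * w.entry p 4 l j
    rw [hC l (by omega) v (by omega), hG l (by omega) j (by omega)]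
  · intro i hi v hv
    change ∑ l ∈ Finset.range k, w.entry p 3 l v * w.entry p 5 i l =
      if v = i then w.entry p 7 i 0 else 0
    rw [hsd i (by omega), ← hE.diag i hi v hv]
    refine Finset.sum_congr rfl fun l hl => ?_
    have := Finset.mem_range.1 hl
    rw [hC l (by omega) v (by omega), hU i (by omega) l (by omega)]
  · intro i hi l hl
    change ∑ v ∈ Finset.range k, w.entry p 5 v l * w.entry p 6 i v =
      if l = i then w.entry p 8 i 0 else 0
    rw [hsd' i (by omega), ← hE.diag' i hi l hl]
    refine Finset.sum_congr rfl fun v hv => ?_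
    have := Finset.mem_range.1 hv
    rw [hU v (by omega) l (by omega), hV i (by omega) v (by omega)]
  · intro v hv
    change IsSeparable (w.entry p 7 v 0)
    rw [hsd v (by omega)]
    exact hE.sep v hv
  · intro v hv
    change IsSeparable (w.entry p 8 v 0)
    rw [hsd' v (by omega)]
    exact hE.sep' v hv
  · rw [hsd v (by omega), hi v (by omega), coeff_mono, if_pos rfl]
    exact mul_inv_cancel₀ (hE.sep v hv)
  · rw [hsd' v (by omega), hi' v (by omega), coeff_mono, if_pos rfl]
    exact mul_inv_cancel₀ (hE.sep' v hv)
  · exact he 11 (by omega) j (by omega) i (by omega)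
  · exact he 12 (by omega) j (by omega) i (by omega)
  · exact he 13 (by omega) j (by omega) v (by omega)

/-- Certificates for the implication can be found if the data `Trans` exist. -/
theorem exists_impOK {m c c₁ : ℕ} {w : Cert} (h : w.ElimOK p m c₁) {T : Trans F}
    (hT : T.Valid (m + numVar c + (numEq c₁ + d F * (w.elim p).s))
      (numEq c + numEq c₁ + (w.elim p).s)
      (relCol m (numVar c) (numEq c) (numEq c₁) (HenselMod.colA p.ν c) (colB p.ν c)
        (HenselMod.colA p.ν c₁) (w.elim p).a) (numEq c₁) (goalCol m (numVar c) (w.elim p))) :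
    ∃ w' : Cert, ImpOK p m c c₁ (w, w') := by
  generalize hk : m + numVar c + (numEq c₁ + d F * (w.elim p).s) = k at hT
  generalize hn : numEq c + numEq c₁ + (w.elim p).s = n at hT
  obtain ⟨w', hw, hs, hn', he⟩ := exists_cert p T.s T.n' 7
    (k + n + d F * T.s + T.s + T.n' + numEq c₁ + 1) fun t i j => match t with
      | 0 => mono 0 (T.a i j)
      | 1 => T.b i j
      | 2 => mono 0 (T.h i j)
      | 3 => T.C i j
      | 4 => T.z i j
      | 5 => T.r i
      | _ => mono 0 (coeff (T.r i) 0)⁻¹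
  set M := k + n + d F * T.s + T.s + T.n' + numEq c₁ + 1 with hM
  have hC := he 3 (by omega)
  have hz := he 4 (by omega)
  have hr := fun i hi => he 5 (by omega) i hi 0 (by omega)
  have hi := fun i hi => he 6 (by omega) i hi 0 (by omega)
  simp only at hC hz hr hi
  refine ⟨w', h, hw, ?_, fun j hj => ?_⟩
  · rw [hk, hn]
    refine { toValid := ?_, rel := ?_, sep := ?_ }
    · refine hT.toValid.congr (M := M) hs hn' (by omega) (by omega) (by omega) (by omega)
        (fun j hj i hi => ?_) (he 1 (by omega)) (fun j hj i hi => ?_) hC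
      · exact (congrArg (coeff · 0) (he 0 (by omega) j hj i hi)).trans
          ((coeff_mono 0 _ 0).trans (if_pos rfl))
      · exact (congrArg (coeff · 0) (he 2 (by omega) j hj i hi)).trans
          ((coeff_mono 0 _ 0).trans (if_pos rfl))
    · intro j hj v hv
      change _ * w'.entry p 5 j 0 = ∑ l ∈ Finset.range (w'.1.getD 1 0),
        w'.entry p 3 l v * w'.entry p 4 l j
      rw [hr j (by omega), hT.rel j hj v hv, hn']
      refine Finset.sum_congr rfl fun l hl => ?_
      have := Finset.mem_range.1 hl
      rw [hC l (by omega) v (by omega), hz l (by omega) j (by omega)]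
    · intro j hj
      change IsSeparable (w'.entry p 5 j 0)
      rw [hr j (by omega)]
      exact hT.sep j hj
  · change coeff (w'.entry p 5 j 0) 0 * coeff (w'.entry p 6 j 0) 0 = 1
    rw [hr j (by omega), hi j (by omega), coeff_mono, if_pos rfl]
    exact mul_inv_cancel₀ (hT.sep j hj)

end Cert

end CertSpec

/-! ### The algorithms -/

section Algorithms

theorem computable_intCast {α : Type*} [Primcodable α] {f : α → ℕ} (hf : Computable f) :
    Computable fun a => (f a : ℤ) := by
  refine Computable.encode_iff.1
    (Computable.of_eq (f := fun a => 2 * f a) (by fun_prop) fun a => ?_)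
  rfl

variable (F) in
theorem computable_radius {α : Type*} [Primcodable α] {s β : α → ℕ} (hs : Computable s)
    (hβ : Computable β) : Computable fun a => radius F (s a) (β a) := by
  refine (computable_intCast (f := fun a => (2 * d F + 1) ^ s a * (6 * β a + 1) + β a)
    (by fun_prop)).of_eq fun a => ?_
  rw [radius]
  push_cast
  rfl

variable (p : Pres F)

/-- The first algorithm: the radius of a ball on which a formula is equivalent to its strongest
positive quantifier-free consequence. -/
theorem exists_elim_radius : ∃ δ : ℕ × ℕ →. ℤ, Partrec δ ∧ ∀ m c, ∃ γ ∈ δ (m, c), ∃ w : Cert,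
    w.ElimOK p m c ∧ γ = radius F (w.elim p).s w.bound := by
  have hv : Computable fun q : (ℕ × ℕ) × Cert => radius F (q.2.1.getD 0 0) q.2.bound :=
    computable_radius F (by fun_prop) (by fun_prop)
  obtain ⟨δ, hδ, h⟩ := exists_search (p := fun (a : ℕ × ℕ) (w : Cert) => w.ElimOK p a.1 a.2)
    (v := fun _ w => radius F (w.1.getD 0 0) w.bound)
    (Cert.cPred_elimOK (w := fun q : (ℕ × ℕ) × Cert => q.2) (by fun_prop) (by fun_prop)
      (by fun_prop)) hv
  exact ⟨δ, hδ, fun m c => h (m, c) (Cert.exists_elimOK p m c)⟩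

/-- The second algorithm: the radius of a ball on which two formulas are equivalent. -/
theorem exists_iff_radius : ∃ δ : ℕ × ℕ × ℕ →. ℤ, Partrec δ ∧ ∀ m c c₁,
    (∃ w, Cert.ImpOK p m c c₁ w) → (∃ w, Cert.ImpOK p m c₁ c w) →
      ∃ γ ∈ δ (m, c, c₁), ∃ w w' : Cert × Cert, (Cert.ImpOK p m c c₁ w ∧ Cert.ImpOK p m c₁ c w') ∧
        γ = radius F (w.1.elim p).s (w.1.bound + w.2.bound) +
          radius F (w'.1.elim p).s (w'.1.bound + w'.2.bound) := by
  let r : Cert × Cert → ℕ := fun w =>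
    (2 * d F + 1) ^ w.1.1.getD 0 0 * (6 * (w.1.bound + w.2.bound) + 1) + (w.1.bound + w.2.bound)
  have hr : ∀ w, radius F (w.1.elim p).s (w.1.bound + w.2.bound) = r w := fun w => by
    simp only [r, radius]
    push_cast
    rfl
  have hcr : Computable r := by fun_prop
  obtain ⟨δ, hδ, h⟩ := exists_search
    (p := fun (a : ℕ × ℕ × ℕ) (w : (Cert × Cert) × Cert × Cert) =>
      Cert.ImpOK p a.1 a.2.1 a.2.2 w.1 ∧ Cert.ImpOK p a.1 a.2.2 a.2.1 w.2)
    (v := fun _ w => ((r w.1 + r w.2 : ℕ) : ℤ))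
    ((Cert.cPred_impOK (w := fun q : (ℕ × ℕ × ℕ) × (Cert × Cert) × Cert × Cert => q.2.1)
      (by fun_prop) (by fun_prop) (by fun_prop) (by fun_prop)).and
      (Cert.cPred_impOK (w := fun q : (ℕ × ℕ × ℕ) × (Cert × Cert) × Cert × Cert => q.2.2)
      (by fun_prop) (by fun_prop) (by fun_prop) (by fun_prop)))
    (computable_intCast (by fun_prop))
  refine ⟨δ, hδ, fun m c c₁ ⟨w, hw⟩ ⟨w', hw'⟩ => ?_⟩
  obtain ⟨γ, hγ, u, hu, hu'⟩ := h (m, c, c₁) ⟨(w, w'), hw, hw'⟩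
  exact ⟨γ, hγ, u.1, u.2, hu, by rw [hr, hr, hu', Nat.cast_add]⟩

theorem exists_impOK_of_models {m c c₁ : ℕ} {φ φ₁ : (LO F).Formula (Fin m)}
    (hc : CodesPP p.ν c φ) (hc₁ : CodesPP p.ν c₁ φ₁)
    (h : TfreeZeroTotal F ⊨ᵇ ((ofLO F).onFormula φ).imp ((ofLO F).onFormula φ₁)) :
    ∃ w, Cert.ImpOK p m c c₁ w := by
  obtain ⟨w, hw⟩ := Cert.exists_elimOK p m c₁
  obtain ⟨T, hT⟩ := exists_trans_of_models hc hc₁ hw.valid h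
  obtain ⟨w', hw'⟩ := Cert.exists_impOK hw hT
  exact ⟨_, hw'⟩

end Algorithms

end HenselMod

end

theorem mainTheorem6 {F : Type*} [Field F] [Finite F]
    (ν : ℕ → HenselMod.K F) (hν : HenselMod.IsComputablePresentation ν) :
    (∃ δ : ℕ × ℕ →. ℤ, Partrec δ ∧
      ∀ (m : ℕ) (φ : (HenselMod.LO F).Formula (Fin m)), HenselMod.IsPP φ →
        ∃ ψ : (HenselMod.Llam F).Formula (Fin m), HenselMod.IsPosQF ψ ∧
          ((HenselMod.ofLlam F).onTheory (HenselMod.Tlam F) ⊨ᵇ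
              ((HenselMod.ofLO F).onFormula φ).imp ((HenselMod.ofLlam F).onFormula ψ)) ∧
          (∀ θ : (HenselMod.Llam F).Formula (Fin m), HenselMod.IsPosQF θ →
            ((HenselMod.ofLlam F).onTheory (HenselMod.Tlam F) ⊨ᵇ
              ((HenselMod.ofLO F).onFormula φ).imp ((HenselMod.ofLlam F).onFormula θ)) →
            HenselMod.Tlam F ⊨ᵇ ψ.imp θ) ∧
          ∀ c : ℕ, HenselMod.CodesPP ν c φ →
            ∃ γ ∈ δ (m, c), HenselMod.Thens F ⊨ᵇ
              ((HenselMod.ofLO F).onFormula φ ⊓ HenselMod.ballPow m γ).iff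
                ((HenselMod.ofLlam F).onFormula ψ ⊓ HenselMod.ballPow m γ)) ∧
    (∃ δ : ℕ × ℕ × ℕ →. ℤ, Partrec δ ∧
      ∀ (m : ℕ) (φ φ₁ : (HenselMod.LO F).Formula (Fin m)), HenselMod.IsPP φ → HenselMod.IsPP φ₁ →
        (HenselMod.TfreeZeroTotal F ⊨ᵇ
          ((HenselMod.ofLO F).onFormula φ).iff ((HenselMod.ofLO F).onFormula φ₁)) →
        ∀ c c₁ : ℕ, HenselMod.CodesPP ν c φ → HenselMod.CodesPP ν c₁ φ₁ →
          ∃ γ ∈ δ (m, c, c₁), HenselMod.Thens F ⊨ᵇ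
            ((HenselMod.ofLO F).onFormula φ ⊓ HenselMod.ballPow m γ).iff
              ((HenselMod.ofLO F).onFormula φ₁ ⊓ HenselMod.ballPow m γ)) := by
  let p : HenselMod.Pres F := ⟨ν, hν⟩
  constructor
  · obtain ⟨δ, hδ, h⟩ := HenselMod.exists_elim_radius p
    refine ⟨δ, hδ, fun m φ hφ => ?_⟩
    -- `ψ` is defined from one code of `φ`; as it is the strongest consequence, any other code
    -- yields an equivalent formula, and the radius computed from that code is good for `ψ` too
    obtain ⟨c₀, hc₀⟩ := HenselMod.exists_codesPP ν hν.surj φ hφ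
    obtain ⟨E, hE⟩ := HenselMod.exists_elim (HenselMod.numVar c₀) (HenselMod.numEq c₀)
      (HenselMod.colB ν c₀)
    obtain ⟨ψ, hψ, hspec⟩ := HenselMod.exists_psi (m := m) E (HenselMod.numEq c₀)
      (HenselMod.colA ν c₀)
    have h₁ := HenselMod.psi_of_phi hc₀ hE hspec
    have h₂ := fun θ hθ => HenselMod.psi_strongest hc₀ hE hspec (θ := θ) hθ
    refine ⟨ψ, hψ, h₁, h₂, fun c hc => ?_⟩
    obtain ⟨γ, hγ, w, hw, rfl⟩ := h m c
    exact ⟨_, hγ, HenselMod.thens_models_iff hc hw.valid hw.bounded hw.formBounded h₁ h₂⟩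
  · obtain ⟨δ, hδ, h⟩ := HenselMod.exists_iff_radius p
    refine ⟨δ, hδ, fun m φ φ₁ _ _ hmod c c₁ hc hc₁ => ?_⟩
    have hmod₁ : HenselMod.TfreeZeroTotal F ⊨ᵇ
        ((HenselMod.ofLO F).onFormula φ).imp ((HenselMod.ofLO F).onFormula φ₁) := by
      rw [FirstOrder.Language.Theory.models_formula_iff] at hmod ⊢
      exact fun M x => (FirstOrder.Language.Formula.realize_iff.1 (hmod M x)).1
    have hmod₂ : HenselMod.TfreeZeroTotal F ⊨ᵇ
        ((HenselMod.ofLO F).onFormula φ₁).imp ((HenselMod.ofLO F).onFormula φ) := by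
      rw [FirstOrder.Language.Theory.models_formula_iff] at hmod ⊢
      exact fun M x => (FirstOrder.Language.Formula.realize_iff.1 (hmod M x)).2
    obtain ⟨γ, hγ, w, w', ⟨hw, hw'⟩, rfl⟩ := h m c c₁
      (HenselMod.exists_impOK_of_models p hc hc₁ hmod₁)
      (HenselMod.exists_impOK_of_models p hc₁ hc hmod₂)
    refine ⟨_, hγ, ?_⟩
    -- `γ` is the sum of the radii for the two implications, and both of them are nonnegative
    have hle := HenselMod.le_radius (F := F) (w.1.elim p).s (w.1.bound + w.2.bound)
    have hle' := HenselMod.le_radius (F := F) (w'.1.elim p).s (w'.1.bound + w'.2.bound)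
    have h1 := hw.impliesNear.thens_models hc hc₁ (le_add_of_nonneg_right (a := HenselMod.radius F
      (w.1.elim p).s (w.1.bound + w.2.bound)) (by omega : 0 ≤ HenselMod.radius F
        (w'.1.elim p).s (w'.1.bound + w'.2.bound)))
    have h2 := hw'.impliesNear.thens_models hc₁ hc (le_add_of_nonneg_left (a := HenselMod.radius F
      (w'.1.elim p).s (w'.1.bound + w'.2.bound)) (by omega : 0 ≤ HenselMod.radius F
        (w.1.elim p).s (w.1.bound + w.2.bound)))
    rw [FirstOrder.Language.Theory.models_formula_iff] at h1 h2 ⊢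
    intro M x
    rw [FirstOrder.Language.Formula.realize_iff, FirstOrder.Language.Formula.realize_inf,
      FirstOrder.Language.Formula.realize_inf]
    have h1 := h1 M x
    have h2 := h2 M x
    rw [FirstOrder.Language.Formula.realize_imp, FirstOrder.Language.Formula.realize_inf] at h1 h2
    exact ⟨fun h => ⟨h1 h, h.2⟩, fun h => ⟨h2 h, h.2⟩⟩
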